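/- \textbf{Setting.} Let $\mathbb G,\mathbb G_T$ be groups of prime order $q$, $g$ a generator of $\mathbb G$, and $\hat e:\mathbb G\times\mathbb G\to\mathbb G_T$ a non-degenerate bilinear map. \emph{Decision $k$-BDHE.} Let $h\in\mathbb Z_q$, $\theta\in\mathbb Z_q^*$ be uniform, $Q=g^h$, $X_i=g^{\theta^i}$ for $i\in\{1,\dots,k,k+2,\dots,2k\}$, $Z_0=\hat e(g^{\theta^{k+1}},Q)$, and $Z_1\in\mathbb G_T$ uniform. An algorithm $D$ with output in $\{0,1\}$ has advantage (at least) $\delta$ if $|\Pr[D(g,Q,X,Z_0)=0]-\Pr[D(g,Q,X,Z_1)=0]|\ge\delta$. \emph{The NI-CBE protocol} (maximal group size $n$, $L_s$ initial tuples). \textsf{GlobeSetup}: choose $u,h_1,\dots,h_n\in\mathbb G$ uniformly, and for $1\le\gamma\le L_s$, $1\le i\le n$ choose $\alpha_{i\gamma},\beta_{i\gamma}\in\mathbb Z_q^*$ uniformly; publish $u$, the $h_i$, $A_{i\gamma}=g^{\alpha_{i\gamma}}$, $B_{i\gamma}=g^{\beta_{i\gamma}}$ and $K_{ij\gamma}=h_j^{\alpha_{i\gamma}}u^{\beta_{i\gamma}}$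 for $j\ne i$. \textsf{KeyRegis}: a user with position $i$ gets $a_i,b_i\in\mathbb Z_q^*$ uniform, public key $(i,A_i=g^{a_i},B_i=g^{b_i},\{K_{ij}=h_j^{a_i}u^{b_i}\}_{j\ne i})$ and private key $SK_i=h_i^{a_i}u^{b_i}$. \textsf{KeyDerive}: for a group with tuple $\gamma$ and set $S$ of occupied positions, the encryption key is $Y_1=\prod_{i\in S}A_i\prod_{i\notin S}A_{i\gamma}$, $Y_2=\prod_{i\in S}B_i\prod_{i\notin S}B_{i\gamma}$, and the decryption key of $i\in S$ is $d_i=SK_i\prod_{j\in S,j\ne i}K_{ji}\prod_{j\notin S}K_{ji\gamma}$, accepted if $\hat e(d_i,g)=\hat e(h_i,Y_1)\hat e(u,Y_2)$. \textsf{Join}/\textsf{Leave} at position $I$ replace $A_{I\gamma},B_{I\gamma},K_{Ij\gamma}$ by $A_I,B_I,K_{Ij}$ in these products, respectively conversely. \textsf{Encrypt} for a set $\mathbb U\subseteq S$ of positions, with $\bar{\mathbb U}=S\setminus\mathbb U$: choose $\rho\in\mathbb Z_q^*$ uniformly; the header is $(g^\rho,(Y_1\prod_{i\in\bar{\mathbb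 U}}A_{i\gamma})^\rho)$ and the session key is $\hat e(u^\rho,\prod_{i\in S}B_i\prod_{i\in\bar{\mathbb U}}B_{i\gamma}\prod_{i\notin S}B_{i\gamma})$. \emph{The semi-static game.} The adversary $\mathcal A$ receives the public parameters and submits a set $\mathbb U$ of users. It then makes adaptive queries (at most $m$): Register a user at a position (each user has one long-term key; $\mathcal A$ gets the public key); Extract the private key of a registered user outside $\mathbb U$; Execute (form a group of registered users outside $\mathbb U$; $\mathcal A$ gets the group information, i.e. the members and $(Y_1,Y_2)$, and the decryption key of one member it names); Join and Leave (a registered user joins a group at its vacant position, or a member leaves; $\mathcal A$ gets the new group information); Reveal the decryption key of a member outside $\mathbb U$ in any session of a group; and once Test$(\mathbb U^*,\pi^*,\ell^*)$ for a session $\ell^*$ of a group $\pi^*$ and a set $\mathbb U^*\subseteq\mathbb U$ of members of it, which is answered with a header and a key $k_b$, where $b\in\{0,1\}$ is a uniform bit, the header and $k_0$ come from Encrypt for $\mathbb U^*$, and $k_1\in\mathbb G_T$ is uniform. Forming a group starts its first session, and each Join or Leave starts the next one. At most $N$ groups with at most $L$ sessions each can be formed. Inadmissible queries are refused. Finally $\mathcal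 A$ outputs $b'$; its advantage is $|2\Pr[b'=b]-1|$. \textbf{Theorem 1.} Let $n\le k$. There is a constant $C$, depending only on $n$ and $k$, such that the following holds for all $\mathbb G,\mathbb G_T,\hat e,g$ as above, all numbers of users and of tuples $L_s$, and all $N,L,m$. If an adversary $\mathcal A$ with at most $m$ queries wins the semi-static game against the NI-CBE protocol with advantage $\epsilon$, then there is an algorithm which uses $\mathcal A$ as a black-box subroutine (which it can restart and interact with), makes at most $C(m+L_s+1)$ steps, and solves the decision $k$-BDHE problem with advantage at least $\frac{1}{NL}\epsilon$. Here a step is a multiplication, inversion or exponentiation in $\mathbb G$ or $\mathbb G_T$, a pairing, an equality test of group elements, the sampling of a coin or of an element of $\mathbb Z_q$ or $\mathbb Z_q^*$, an addition or multiplication in $\mathbb Z_q$, or one interaction with $\mathcal A$; the algorithm accesses group elements and scalars only through these operations. -/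

import Mathlib

/-! ### Bilinear groups and the decision k-BDHE problem -/

/-- Two groups of order `q` (a prime in all uses), a generator `g` of the first one, and a
non-degenerate bilinear map. -/
structure BilinearGroups (q : ℕ) (G GT : Type) [CommGroup G] [CommGroup GT] where
  card_G : Nat.card G = q
  card_GT : Nat.card GT = q
  g : G
  generates : ∀ x : G, x ∈ Subgroup.zpowers g
  e : G →* G →* GT
  nondegenerate : ∃ a b : G, e a b ≠ 1

/-- Exponentiation by an element of `ℤ_q` (in a group of order `q`). -/
def gexp {q : ℕ} {H : Type} [CommGroup H] (x : H) (a : ZMod q) : H := x ^ a.val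

/-- What a solver of the decision `k`-BDHE problem is given: `g`, `Q`, the elements `X i` for
`i = 1, …, k, k+2, …, 2k`, and `Z`. -/
structure BDHEInstance (k : ℕ) (G GT : Type) where
  g : G
  Q : G
  X : {i : ℕ // 1 ≤ i ∧ i ≤ 2 * k ∧ i ≠ k + 1} → G
  Z : GT

section BDHE

variable {q : ℕ} [Fact q.Prime] {G GT : Type} [CommGroup G] [CommGroup GT] [Fintype GT]

/-- The instance with `Q = g ^ h`, `X i = g ^ (θ ^ i)` and last component `Z`. -/
def bdheInstance (B : BilinearGroups q G GT) (k : ℕ) (h : ZMod q) (θ : (ZMod q)ˣ) (Z : GT) :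
    BDHEInstance k G GT where
  g := B.g
  Q := gexp B.g h
  X i := gexp B.g ((θ : ZMod q) ^ (i : ℕ))
  Z := Z

/-- The output of `D` on `Z₀ = e(g ^ (θ ^ (k+1)), Q)`. -/
noncomputable def bdheReal (B : BilinearGroups q G GT) (k : ℕ)
    (D : BDHEInstance k G GT → PMF Bool) : PMF Bool := do
  let h ← PMF.uniformOfFintype (ZMod q)
  let θ ← PMF.uniformOfFintype (ZMod q)ˣ
  D (bdheInstance B k h θ (B.e (gexp B.g ((θ : ZMod q) ^ (k + 1))) (gexp B.g h)))

/-- The output of `D` on a uniformly random `Z₁`. -/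
noncomputable def bdheRandom (B : BilinearGroups q G GT) (k : ℕ)
    (D : BDHEInstance k G GT → PMF Bool) : PMF Bool := do
  let h ← PMF.uniformOfFintype (ZMod q)
  let θ ← PMF.uniformOfFintype (ZMod q)ˣ
  let Z ← PMF.uniformOfFintype GT
  D (bdheInstance B k h θ Z)

/-- `|Pr[D(g, Q, X, Z₀) = 0] - Pr[D(g, Q, X, Z₁) = 0]|`; the bit `0` is `false`. -/
noncomputable def bdheAdvantage (B : BilinearGroups q G GT) (k : ℕ)
    (D : BDHEInstance k G GT → PMF Bool) : ℝ :=
  |(bdheReal B k D false).toReal - (bdheRandom B k D false).toReal|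

end BDHE

/-! ### The NI-CBE protocol

`n` is the maximal group size, `tuples` the number of initial tuples in the public parameters,
`users` the number of users. Positions in a group, tuples and users are numbered from `0`. -/

/-- `A = g ^ a`, `B = g ^ b` and `K j = h_j ^ a * u ^ b` for all positions `j`. If the row belongs
to position `i`, the entry `K i` is secret (it is the private key in the case of a user) and the
other entries are public. -/
structure Row (n : ℕ) (G : Type) where
  A : G
  B : G
  K : Fin n → G

/-- The public part of a row that belongs to position `i`. -/
structure PubRow (n : ℕ) (i : Fin n) (α : Type) where
  A : α
  B : α
  K : (j : Fin n) → j ≠ i → α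

def Row.pub {n : ℕ} {G : Type} (r : Row n G) (i : Fin n) : PubRow n i G where
  A := r.A
  B := r.B
  K j _ := r.K j

def PubRow.map {n : ℕ} {i : Fin n} {α β : Type} (f : α → β) (r : PubRow n i α) : PubRow n i β where
  A := f r.A
  B := f r.B
  K j hj := f (r.K j hj)

/-- The published system parameters (the groups, the pairing and `g` are fixed throughout). -/
structure PubParams (n tuples : ℕ) (α : Type) where
  u : α
  h : Fin n → α
  tuple : Fin tuples → (i : Fin n) → PubRow n i α

def PubParams.map {n tuples : ℕ} {α β : Type} (f : α → β) (P : PubParams n tuples α) :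
    PubParams n tuples β where
  u := f P.u
  h i := f (P.h i)
  tuple γ i := (P.tuple γ i).map f

/-- The system parameters before the secret entries of the rows are dropped. -/
structure SysParams (n tuples : ℕ) (G : Type) where
  u : G
  h : Fin n → G
  tuple : Fin tuples → Fin n → Row n G

def SysParams.pub {n tuples : ℕ} {G : Type} (P : SysParams n tuples G) : PubParams n tuples G where
  u := P.u
  h := P.h
  tuple γ i := (P.tuple γ i).pub i

/-- A group member: its user index, its long-term key and its current decryption key `d`. -/
structure Member (users n : ℕ) (G : Type) where
  user : Fin users
  row : Row n G
  d : G

/-- One session of a group: the occupied positions with their members (which determines `st` and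
`Δ`), the group encryption key `(Y₁, Y₂)`, and the public parts `dk i` of the decryption keys (of
which the protocol gives every member its own copy). -/
structure Session (users n : ℕ) (G : Type) where
  members : Fin n → Option (Member users n G)
  Y₁ : G
  Y₂ : G
  dk : Fin n → G

section Protocol

variable {q : ℕ} [Fact q.Prime] {G GT : Type} [CommGroup G] [CommGroup GT]
variable {users n tuples : ℕ}

def mkRow (B : BilinearGroups q G GT) (u : G) (h : Fin n → G) (a b : (ZMod q)ˣ) : Row n G where
  A := gexp B.g (a : ZMod q)
  B := gexp B.g (b : ZMod q)
  K j := gexp (h j) (a : ZMod q) * gexp u (b : ZMod q)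

/-- GlobeSetup. -/
noncomputable def globeSetup [Fintype G] (B : BilinearGroups q G GT) (n tuples : ℕ) :
    PMF (SysParams n tuples G) := do
  let u ← PMF.uniformOfFintype G
  let h ← PMF.uniformOfFintype (Fin n → G)
  let a ← PMF.uniformOfFintype (Fin tuples → Fin n → (ZMod q)ˣ)
  let b ← PMF.uniformOfFintype (Fin tuples → Fin n → (ZMod q)ˣ)
  pure { u := u, h := h, tuple := fun γ i => mkRow B u h (a γ i) (b γ i) }

/-- KeyRegis. -/
noncomputable def keyRegis (B : BilinearGroups q G GT) (P : SysParams n tuples G) :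
    PMF (Row n G) := do
  let a ← PMF.uniformOfFintype (ZMod q)ˣ
  let b ← PMF.uniformOfFintype (ZMod q)ˣ
  pure (mkRow B P.u P.h a b)

/-- KeyDerive: the first session of a group with tuple `γ`, whose occupied positions are those `i`
with `seats i ≠ none`. A vacant position is filled with the corresponding row of the tuple. -/
def keyDerive (P : SysParams n tuples G) (γ : Fin tuples)
    (seats : Fin n → Option (Fin users × Row n G)) : Session users n G :=
  let row : Fin n → Row n G := fun j => ((seats j).map Prod.snd).getD (P.tuple γ j)
  let dk : Fin n → G := fun i => ∏ j ∈ Finset.univ.erase i, (row j).K i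
  { members := fun i => (seats i).map fun s => ⟨s.1, s.2, dk i * s.2.K i⟩
    Y₁ := ∏ j, (row j).A
    Y₂ := ∏ j, (row j).B
    dk := dk }

/-- KeyUpdate, Join: user `v` with long-term key `r` takes the position `I`. -/
def keyJoin (P : SysParams n tuples G) (γ : Fin tuples) (S : Session users n G)
    (v : Fin users) (I : Fin n) (r : Row n G) : Session users n G :=
  let t := P.tuple γ I
  { members := fun j =>
      if j = I then some ⟨v, r, S.dk I * r.K I⟩
      else (S.members j).map fun m => { m with d := m.d * r.K j * (t.K j)⁻¹ }
    Y₁ := S.Y₁ * r.A * t.A⁻¹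
    Y₂ := S.Y₂ * r.B * t.B⁻¹
    dk := fun l => if l = I then S.dk l else S.dk l * r.K l * (t.K l)⁻¹ }

/-- KeyUpdate, Leave: the member at position `J`, whose long-term key is `r`, leaves. -/
def keyLeave (P : SysParams n tuples G) (γ : Fin tuples) (S : Session users n G)
    (J : Fin n) (r : Row n G) : Session users n G :=
  let t := P.tuple γ J
  { members := fun j =>
      if j = J then none
      else (S.members j).map fun m => { m with d := m.d * (r.K j)⁻¹ * t.K j }
    Y₁ := S.Y₁ * r.A⁻¹ * t.A
    Y₂ := S.Y₂ * r.B⁻¹ * t.B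
    dk := fun l => if l = J then S.dk l else S.dk l * t.K l * (r.K l)⁻¹ }

/-- The members accept their decryption keys: `e(d_i, g) = e(h_i, Y₁) e(u, Y₂)`. -/
def Session.Accepted (B : BilinearGroups q G GT) (P : SysParams n tuples G)
    (S : Session users n G) : Prop :=
  ∀ i m, S.members i = some m → B.e m.d B.g = B.e (P.h i) S.Y₁ * B.e P.u S.Y₂

/-- `v` is a member of the group in session `S`. -/
def Session.HasMember (S : Session users n G) (v : Fin users) : Prop :=
  ∃ i m, S.members i = some m ∧ m.user = v

open Classical in
/-- Encrypt for the members whose user indices lie in `R`, with randomness `ρ`; the result is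
`(C₁, C₂, session key)`. A member outside `R` contributes its own row and that of the tuple. -/
noncomputable def encrypt (B : BilinearGroups q G GT) (P : SysParams n tuples G) (γ : Fin tuples)
    (S : Session users n G) (R : Finset (Fin users)) (ρ : (ZMod q)ˣ) : G × G × GT :=
  let occupied : Finset (Fin n) := Finset.univ.filter fun i => (S.members i).isSome
  let excluded : Finset (Fin n) :=
    Finset.univ.filter fun i => ∃ m, S.members i = some m ∧ m.user ∉ R
  let Yhat₁ := S.Y₁ * ∏ i ∈ excluded, (P.tuple γ i).A
  let memberB : Fin n → G := fun i => ((S.members i).map fun m => m.row.B).getD 1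
  (gexp B.g (ρ : ZMod q), gexp Yhat₁ (ρ : ZMod q),
    B.e (gexp P.u (ρ : ZMod q))
      ((∏ i ∈ occupied, memberB i) * (∏ i ∈ excluded, (P.tuple γ i).B) *
        ∏ i ∈ occupiedᶜ, (P.tuple γ i).B))

end Protocol

/-! ### The security game -/

/-- The queries of the adversary. Groups are named by their number `π` (which also serves as the
unique identifier of the group) and the sessions of a group by their round `ℓ`, both from `0`. -/
inductive Query (users n tuples : ℕ) : Type
  | register (γ : Fin tuples) (v : Fin users) (i : Fin n)
  | extract (v : Fin users)
  /-- form a group with the users `seats j` at positions `j` and give out the decryption key of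
  the member at position `i` -/
  | execute (γ : Fin tuples) (i : Fin n) (seats : Fin n → Option (Fin users))
  | join (v : Fin users) (π : ℕ)
  | leave (π : ℕ) (I : Fin n)
  | reveal (v : Fin users) (π ℓ : ℕ)
  | test (R : Finset (Fin users)) (π ℓ : ℕ)

/-- The public information on a session of a group. -/
structure GroupInfo (users n : ℕ) (α : Type) where
  π : ℕ
  ℓ : ℕ
  seats : Fin n → Option (Fin users)
  Y₁ : α
  Y₂ : α

inductive Answer (users n : ℕ) (α β : Type) : Type
  | refused
  | publicKey (i : Fin n) (r : PubRow n i α)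
  | privateKey (x : α)
  | formed (info : GroupInfo users n α) (d : α)
  | updated (info : GroupInfo users n α)
  | decryptionKey (d : α)
  | challenge (C₁ C₂ : α) (key : β)

def GroupInfo.map {users n : ℕ} {α α' : Type} (f : α → α') (I : GroupInfo users n α) :
    GroupInfo users n α' :=
  ⟨I.π, I.ℓ, I.seats, f I.Y₁, f I.Y₂⟩

def Answer.map {users n : ℕ} {α β α' β' : Type} (f : α → α') (f' : β → β') :
    Answer users n α β → Answer users n α' β'
  | .refused => .refused
  | .publicKey i r => .publicKey i (r.map f)
  | .privateKey x => .privateKey (f x)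
  | .formed I d => .formed (I.map f) (f d)
  | .updated I => .updated (I.map f)
  | .decryptionKey d => .decryptionKey (f d)
  | .challenge C₁ C₂ key => .challenge (f C₁) (f C₂) (f' key)

/-- A probabilistic interactive adversary with internal states `σ`: it receives the system
parameters and submits a set of users, then makes queries and receives the answers, and finally
outputs a bit. -/
structure Adversary (users n tuples : ℕ) (G GT : Type) where
  σ : Type
  start : PubParams n tuples G → PMF (Finset (Fin users) × σ)
  query : σ → PMF (Query users n tuples × σ)
  receive : σ → Answer users n G GT → PMF σ
  guess : σ → PMF Bool

/-- A formed group: its tuple and its sessions, in order. -/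
structure Group' (users n tuples : ℕ) (G : Type) where
  γ : Fin tuples
  sessions : List (Session users n G)

/-- The state of the challenger: the registered users with their positions and long-term keys, the
groups formed so far, and whether Test has been answered. -/
structure ChallengerState (users n tuples : ℕ) (G : Type) where
  keys : Fin users → Option (Fin n × Row n G)
  groups : List (Group' users n tuples G)
  tested : Bool

section Game

variable {q : ℕ} [Fact q.Prime] {G GT : Type} [CommGroup G] [CommGroup GT]
variable {users n tuples : ℕ}

def Session.info (S : Session users n G) (π ℓ : ℕ) : GroupInfo users n G :=
  ⟨π, ℓ, fun i => (S.members i).map fun m => m.user, S.Y₁, S.Y₂⟩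

/-- Append the session `S` to the group number `π`. -/
def ChallengerState.addSession (st : ChallengerState users n tuples G) (π : ℕ)
    (S : Session users n G) : ChallengerState users n tuples G :=
  { st with groups := st.groups.modify π fun gr => { gr with sessions := gr.sessions ++ [S] } }

/-- The long-term key of the user `v` if it is registered for position `j`. -/
def ChallengerState.keyAt (st : ChallengerState users n tuples G) (v : Fin users) (j : Fin n) :
    Option (Row n G) :=
  match st.keys v with
  | some (i, r) => if i = j then some r else none
  | none => none

/-- Execute is admissible: fewer than `N` groups exist, position `i` is occupied, every seated user
is registered for its position and none of them lies in `U`. -/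
def ChallengerState.CanExecute (st : ChallengerState users n tuples G) (N : ℕ)
    (U : Finset (Fin users)) (i : Fin n) (seats : Fin n → Option (Fin users)) : Prop :=
  st.groups.length < N ∧ (seats i).isSome ∧
    ∀ j v, seats j = some v → (st.keyAt v j).isSome ∧ v ∉ U

open Classical in
/-- The challenger's answer to a query, for the challenge bit `b` and the set `U` submitted by the
adversary, when at most `N` groups with at most `L` sessions each may be formed. A query on which
the challenger aborts is refused and changes nothing. -/
noncomputable def respond [Fintype GT] (B : BilinearGroups q G GT) (N L : ℕ)
    (P : SysParams n tuples G) (b : Bool) (U : Finset (Fin users))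
    (st : ChallengerState users n tuples G) :
    Query users n tuples → PMF (Answer users n G GT × ChallengerState users n tuples G)
  | .register _ v i =>
    match st.keys v with
    | some (i', r) => pure (.publicKey i' (r.pub i'), st)
    | none => do
      let r ← keyRegis B P
      pure (.publicKey i (r.pub i), { st with keys := Function.update st.keys v (some (i, r)) })
  | .extract v =>
    match st.keys v with
    | some (i, r) => if v ∈ U then pure (.refused, st) else pure (.privateKey (r.K i), st)
    | none => pure (.refused, st)
  | .execute γ i seats =>
    let S := keyDerive P γ fun j => (seats j).bind fun v => (st.keyAt v j).map fun r => (v, r)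
    match S.members i with
    | some m =>
      if st.CanExecute N U i seats ∧ S.Accepted B P then
        pure (.formed (S.info st.groups.length 0) m.d,
          { st with groups := st.groups ++ [⟨γ, [S]⟩] })
      else pure (.refused, st)
    | none => pure (.refused, st)
  | .join v π =>
    match st.groups[π]?, st.keys v with
    | some gr, some (I, r) =>
      match gr.sessions.getLast? with
      | some S =>
        let S' := keyJoin P gr.γ S v I r
        if S.members I = none ∧ gr.sessions.length < L ∧ S'.Accepted B P then
          pure (.updated (S'.info π gr.sessions.length), st.addSession π S')
        else pure (.refused, st)
      | none => pure (.refused, st)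
    | _, _ => pure (.refused, st)
  | .leave π J =>
    match st.groups[π]? with
    | some gr =>
      match gr.sessions.getLast? with
      | some S =>
        match S.members J with
        | some m =>
          let S' := keyLeave P gr.γ S J m.row
          if gr.sessions.length < L ∧ S'.Accepted B P then
            pure (.updated (S'.info π gr.sessions.length), st.addSession π S')
          else pure (.refused, st)
        | none => pure (.refused, st)
      | none => pure (.refused, st)
    | none => pure (.refused, st)
  | .reveal v π ℓ =>
    match st.groups[π]?, st.keys v with
    | some gr, some (i, _) =>
      match gr.sessions[ℓ]? with
      | some S =>
        match S.members i with
        | some m =>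
          if m.user = v ∧ v ∉ U then pure (.decryptionKey m.d, st) else pure (.refused, st)
        | none => pure (.refused, st)
      | none => pure (.refused, st)
    | _, _ => pure (.refused, st)
  | .test R π ℓ =>
    match st.groups[π]? with
    | some gr =>
      match gr.sessions[ℓ]? with
      | some S =>
        if st.tested = false ∧ R ⊆ U ∧ ∀ v ∈ R, S.HasMember v then do
          let ρ ← PMF.uniformOfFintype (ZMod q)ˣ
          let k₁ ← PMF.uniformOfFintype GT
          let c := encrypt B P gr.γ S R ρ
          pure (.challenge c.1 c.2.1 (if b = false then c.2.2 else k₁), { st with tested := true })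
        else pure (.refused, st)
      | none => pure (.refused, st)
    | none => pure (.refused, st)

/-- The query phase with `m` queries (an adversary that needs fewer pads with queries that are
refused), followed by the adversary's guess. -/
noncomputable def queryPhase [Fintype GT] (B : BilinearGroups q G GT) (N L : ℕ)
    (A : Adversary users n tuples G GT) (P : SysParams n tuples G) (b : Bool)
    (U : Finset (Fin users)) : ℕ → ChallengerState users n tuples G → A.σ → PMF Bool
  | 0, _, s => A.guess s
  | m + 1, st, s => do
    let x ← A.query s
    let y ← respond B N L P b U st x.1
    let s' ← A.receive x.2 y.1
    queryPhase B N L A P b U m y.2 s'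

/-- The game with challenge bit `b`; the result is the adversary's guess. -/
noncomputable def game [Fintype G] [Fintype GT] (B : BilinearGroups q G GT) (N L m : ℕ)
    (A : Adversary users n tuples G GT) (b : Bool) : PMF Bool := do
  let P ← globeSetup B n tuples
  let x ← A.start P.pub
  queryPhase B N L A P b x.1 m ⟨fun _ => none, [], false⟩ x.2

/-- Whether the adversary's guess equals the challenge bit. -/
noncomputable def gameWin [Fintype G] [Fintype GT] (B : BilinearGroups q G GT) (N L m : ℕ)
    (A : Adversary users n tuples G GT) : PMF Bool := do
  let b ← PMF.uniformOfFintype Bool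
  let b' ← game B N L m A b
  pure (b' == b)

/-- The advantage `|2 Pr[b' = b] - 1|`. -/
noncomputable def Adversary.advantage [Fintype G] [Fintype GT] (B : BilinearGroups q G GT)
    (N L m : ℕ) (A : Adversary users n tuples G GT) : ℝ :=
  |2 * (gameWin B N L m A true).toReal - 1|

end Game

/-! ### Algorithms with a step count -/

/-- Probabilistic computation trees over three banks of registers, which hold elements of `G`, of
`GT` and of `ℤ_q`, with an adversary as a subroutine. Every instruction is one step. A program sees
neither group elements nor scalars: it can combine them by the instructions below, test two group
elements for equality, and hand the contents of registers to the adversary. The adversary can be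
started (afresh each time) and then be asked for its queries, given answers, and asked for its
guess; its inner state is not accessible. -/
inductive Program (users n tuples : ℕ) : Type
  | output (b : Bool)
  | coin (f : Bool → Program users n tuples)
  /-- register `d` of the scalars becomes uniform in `ℤ_q` -/
  | sample (d : ℕ) (p : Program users n tuples)
  /-- register `d` of the scalars becomes uniform in `ℤ_q^*` -/
  | sampleUnit (d : ℕ) (p : Program users n tuples)
  | addS (d a b : ℕ) (p : Program users n tuples)
  | mulS (d a b : ℕ) (p : Program users n tuples)
  | mul (d a b : ℕ) (p : Program users n tuples)
  | inv (d a : ℕ) (p : Program users n tuples)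
  | pow (d a s : ℕ) (p : Program users n tuples)
  | mulT (d a b : ℕ) (p : Program users n tuples)
  | invT (d a : ℕ) (p : Program users n tuples)
  | powT (d a s : ℕ) (p : Program users n tuples)
  | pair (d a b : ℕ) (p : Program users n tuples)
  | eq (a b : ℕ) (f : Bool → Program users n tuples)
  | eqT (a b : ℕ) (f : Bool → Program users n tuples)
  | start (P : PubParams n tuples ℕ) (f : Finset (Fin users) → Program users n tuples)
  | query (f : Query users n tuples → Program users n tuples)
  | reply (ans : Answer users n ℕ ℕ) (p : Program users n tuples)
  | guess (f : Bool → Program users n tuples)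

/-- On every path the program outputs a bit after at most the given number of steps. -/
def Program.HaltsWithin {users n tuples : ℕ} : Program users n tuples → ℕ → Prop
  | .output _, _ => True
  | _, 0 => False
  | .coin f, t + 1 => ∀ b, (f b).HaltsWithin t
  | .sample _ p, t + 1 => p.HaltsWithin t
  | .sampleUnit _ p, t + 1 => p.HaltsWithin t
  | .addS _ _ _ p, t + 1 => p.HaltsWithin t
  | .mulS _ _ _ p, t + 1 => p.HaltsWithin t
  | .mul _ _ _ p, t + 1 => p.HaltsWithin t
  | .inv _ _ p, t + 1 => p.HaltsWithin t
  | .pow _ _ _ p, t + 1 => p.HaltsWithin t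
  | .mulT _ _ _ p, t + 1 => p.HaltsWithin t
  | .invT _ _ p, t + 1 => p.HaltsWithin t
  | .powT _ _ _ p, t + 1 => p.HaltsWithin t
  | .pair _ _ _ p, t + 1 => p.HaltsWithin t
  | .eq _ _ f, t + 1 => ∀ b, (f b).HaltsWithin t
  | .eqT _ _ f, t + 1 => ∀ b, (f b).HaltsWithin t
  | .start _ f, t + 1 => ∀ U, (f U).HaltsWithin t
  | .query f, t + 1 => ∀ x, (f x).HaltsWithin t
  | .reply _ p, t + 1 => p.HaltsWithin t
  | .guess f, t + 1 => ∀ b, (f b).HaltsWithin t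

/-- The contents of the registers. -/
structure Registers (q : ℕ) (G GT : Type) where
  x : ℕ → G
  y : ℕ → GT
  s : ℕ → ZMod q

section Run

variable {q : ℕ} [Fact q.Prime] {G GT : Type} [CommGroup G] [CommGroup GT]
variable {users n tuples : ℕ}

def Registers.setX (r : Registers q G GT) (d : ℕ) (v : G) : Registers q G GT :=
  { r with x := Function.update r.x d v }

def Registers.setY (r : Registers q G GT) (d : ℕ) (v : GT) : Registers q G GT :=
  { r with y := Function.update r.y d v }

def Registers.setS (r : Registers q G GT) (d : ℕ) (v : ZMod q) : Registers q G GT :=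
  { r with s := Function.update r.s d v }

open Classical in
/-- The output of a program with the adversary `A` as subroutine, from given register contents and
a given state of `A` (`none` if it has not been started; an interaction with an adversary that has
not been started ends the run with output `0`). -/
noncomputable def Program.run (B : BilinearGroups q G GT) (A : Adversary users n tuples G GT) :
    Program users n tuples → Registers q G GT → Option A.σ → PMF Bool
  | .output b, _, _ => pure b
  | .coin f, r, s => do
    let b ← PMF.uniformOfFintype Bool
    (f b).run B A r s
  | .sample d p, r, s => do
    let a ← PMF.uniformOfFintype (ZMod q)
    p.run B A (r.setS d a) s
  | .sampleUnit d p, r, s => do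
    let a ← PMF.uniformOfFintype (ZMod q)ˣ
    p.run B A (r.setS d (a : ZMod q)) s
  | .addS d a b p, r, s => p.run B A (r.setS d (r.s a + r.s b)) s
  | .mulS d a b p, r, s => p.run B A (r.setS d (r.s a * r.s b)) s
  | .mul d a b p, r, s => p.run B A (r.setX d (r.x a * r.x b)) s
  | .inv d a p, r, s => p.run B A (r.setX d (r.x a)⁻¹) s
  | .pow d a c p, r, s => p.run B A (r.setX d (gexp (r.x a) (r.s c))) s
  | .mulT d a b p, r, s => p.run B A (r.setY d (r.y a * r.y b)) s
  | .invT d a p, r, s => p.run B A (r.setY d (r.y a)⁻¹) s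
  | .powT d a c p, r, s => p.run B A (r.setY d (gexp (r.y a) (r.s c))) s
  | .pair d a b p, r, s => p.run B A (r.setY d (B.e (r.x a) (r.x b))) s
  | .eq a b f, r, s => (f (decide (r.x a = r.x b))).run B A r s
  | .eqT a b f, r, s => (f (decide (r.y a = r.y b))).run B A r s
  | .start P f, r, _ => do
    let z ← A.start (P.map r.x)
    (f z.1).run B A r (some z.2)
  | .query f, r, some s => do
    let z ← A.query s
    (f z.1).run B A r (some z.2)
  | .query _, _, none => pure false
  | .reply ans p, r, some s => do
    let s' ← A.receive s (ans.map r.x r.y)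
    p.run B A r (some s')
  | .reply _ _, _, none => pure false
  | .guess f, r, some s => do
    let b ← A.guess s
    (f b).run B A r (some s)
  | .guess _, _, none => pure false

/-- The input registers for a `k`-BDHE instance: `g` in register `0`, `X i` in register `i`, `Q` in
register `2 * k + 1`, and `Z` in register `0` of the bank for `GT`. All other registers are
trivial. -/
def BDHEInstance.registers {k : ℕ} (I : BDHEInstance k G GT) : Registers q G GT where
  x i :=
    if i = 0 then I.g
    else if i = 2 * k + 1 then I.Q
    else if h : 1 ≤ i ∧ i ≤ 2 * k ∧ i ≠ k + 1 then I.X ⟨i, h⟩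
    else 1
  y i := if i = 0 then I.Z else 1
  s _ := 0

/-- The program with subroutine `A` as an algorithm for the decision `k`-BDHE problem. -/
noncomputable def Program.solver (B : BilinearGroups q G GT) (A : Adversary users n tuples G GT)
    (D : Program users n tuples) {k : ℕ} (I : BDHEInstance k G GT) : PMF Bool :=
  D.run B A I.registers none

end Run

set_option linter.unusedSectionVars false

/-! ### Uniform distributions -/

namespace PMF

/-! The instance is planted in the public data. With uniform masks `r`, `y j`, let u = g^(r+θ) and
h_j = g^(y_j+θ^j), positions being numbered from 0. A shifted row at position i has exponents a =
mask + `shiftA i`, b = mask + `shiftB i`, where `shiftA i` = θ^(k+1-i) for i ≠ 0, `shiftA 0` is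
minus the sum of these, `shiftB 0` = θ^k, and the other `shiftB i` are 0. In the entry h_j^a u^b
with j ≠ i the power θ^(k+1) does not occur: for i ≠ 0 the shift contributes θ^(k+1-i+j), and for i
= 0 the term -θ^(k+1) coming from position j cancels against θ·θ^k coming from u. Since n ≤ k, all
other powers are among the given ones (`evals_wordK`). Only the secret entry j = i needs θ^(k+1).

Over all positions the shifts add up to 0 and θ^k (`sum_shiftA`, `sum_shiftB`). If every position
contributes exactly one shift to an encryption with exponent ρ = h + c, where Q = g^h, then the
header involves only known exponents on Q g^c, and the session key is a computable element times
e(g^(θ^(k+1)), Q). Putting Z for the last factor multiplies the true key by ζ = Z / e(g^(θ^(k+1)),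
Q), which is 1 for a real instance and uniform for a random one (`run_challengeEmbed`).

The tuple rows are shifted, and users outside the submitted set U have known exponents, so all their
secrets can be given out. An excluded member contributes its own row and the tuple row, so its own
row must be unshifted, while a recipient's row must be shifted. For users in U this has to be fixed
at registration. It is enough to guess one bit per position (`requiredPattern`), because a user has
one position and a session has at most one member there. The simulation is perfect for every guess,
so a uniform guess is right with probability 2^(-n) whatever the adversary does
(`uniform_bind_symPhase`). The adversary is restarted up to 2^n times, which succeeds with
probability at least 1/2 (`half_le_success`) and costs a factor depending only on n. For L ≥ 2 this
beats 1/(NL). For L ≤ 1 no user of U can be seated, and one trial with the all-true pattern loses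
nothing.

Exactness needs care because exponents are drawn from the units, whereas a masked exponent may
vanish. If it does, its mask reveals the shift and hence the solution. A fresh row or a fresh ρ is
then drawn from the units, and the challenge is answered by honest encryption times Z over the
solution. The resulting law is exactly the required one (`PMF.uniformScalar_pair_resample`,
`PMF.uniform_zmod_add_resample`), so there is no error term in q.

To compare a program with the game, the game is rewritten in exponents: sessions depend only on
seating and keys (`respond_realize`, `game_map_some`), so program and challenger can share one
symbolic state. -/

theorem monad_bind_eq_bind {α β : Type} (p : PMF α) (f : α → PMF β) : p >>= f = p.bind f := rfl

theorem monad_pure_eq_pure {α : Type} (a : α) : (Pure.pure a : PMF α) = PMF.pure a := rfl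

theorem uniformOfFintype_bind_equiv {α β γ : Type} [Fintype α] [Nonempty α] [Fintype β]
    [Nonempty β] (e : α ≃ β) (f : β → PMF γ) :
    (uniformOfFintype β).bind f = (uniformOfFintype α).bind fun a => f (e a) := by
  ext c
  rw [bind_apply, bind_apply, ← e.tsum_eq]
  simp [Fintype.card_congr e]

theorem uniformOfFintype_prod_bind {α β γ : Type} [Fintype α] [Nonempty α] [Fintype β]
    [Nonempty β] (f : α × β → PMF γ) :
    (uniformOfFintype (α × β)).bind f =
      (uniformOfFintype α).bind fun a => (uniformOfFintype β).bind fun b => f (a, b) := by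
  ext c
  simp only [bind_apply, uniformOfFintype_apply, Fintype.card_prod, Nat.cast_mul,
    ENNReal.tsum_mul_left]
  rw [ENNReal.tsum_prod', ENNReal.mul_inv (by simp) (by simp), mul_assoc]

/-- Coordinates of a uniform function are independent, so overwriting one by a fresh uniform value
changes nothing. This compares a loop that fills registers one at a time with a single draw. -/
theorem uniformOfFintype_bind_update {ι α γ : Type} [Fintype ι] [DecidableEq ι] [Fintype α]
    [Nonempty α] (i : ι) (f : (ι → α) → PMF γ) :
    (uniformOfFintype (ι → α)).bind f =
      (uniformOfFintype α).bind fun x =>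
        (uniformOfFintype (ι → α)).bind fun φ => f (Function.update φ i x) := by
  let e := Equiv.funSplitAt i α
  rw [uniformOfFintype_bind_equiv e.symm, uniformOfFintype_prod_bind]
  refine congrArg _ (funext fun x => ?_)
  rw [uniformOfFintype_bind_equiv e.symm, uniformOfFintype_prod_bind]
  have h : ∀ (a : α) (φ : {j // j ≠ i} → α),
      Function.update (e.symm (a, φ)) i x = e.symm (x, φ) := by
    intro a φ
    funext j
    by_cases hj : j = i
    · subst hj; simp [e, Equiv.funSplitAt, Equiv.piSplitAt]
    · simp [e, Equiv.funSplitAt, Equiv.piSplitAt, hj]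
  simp only [h, bind_const]

/-- Sample the values of a function at the listed arguments, one after the other. -/
noncomputable def sampleList {ι α : Type} [DecidableEq ι] [Fintype α] [Nonempty α] :
    List ι → (ι → α) → PMF (ι → α)
  | [], φ => pure φ
  | i :: l, φ => (uniformOfFintype α).bind fun x => sampleList l (Function.update φ i x)

theorem sampleList_eq_bind {ι α : Type} [Fintype ι] [DecidableEq ι] [Fintype α]
    [Nonempty α] (l : List ι) (hl : l.Nodup) (φ : ι → α) :
    sampleList l φ =
      (uniformOfFintype (ι → α)).bind fun ψ => pure fun i => if i ∈ l then ψ i else φ i := by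
  induction l generalizing φ with
  | nil => simp [sampleList]
  | cons i l ih =>
    rw [List.nodup_cons] at hl
    rw [sampleList, uniformOfFintype_bind_update i]
    refine congrArg _ (funext fun x => ?_)
    rw [ih hl.2]
    refine congrArg _ (funext fun ψ => congrArg pure (funext fun j => ?_))
    by_cases hj : j = i
    · subst hj; simp [hl.1]
    · simp [hj]

/-- An exhaustive list overwrites every value, so the starting function is a mere placeholder. -/
theorem sampleList_eq_uniformOfFintype {ι α : Type} [Fintype ι] [DecidableEq ι] [Fintype α]
    [Nonempty α] (l : List ι) (hl : l.Nodup) (hl' : ∀ i, i ∈ l) (φ : ι → α) :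
    sampleList l φ = uniformOfFintype (ι → α) := by
  simp only [sampleList_eq_bind l hl, hl', if_true]
  exact bind_pure _

/-- Exchanging `a` and `b` preserves the uniform law. Applied with `b` the pattern that the
adversary's challenge asks for, this makes the chance of a right guess independent of the adversary.
-/
theorem uniformOfFintype_bind_ite_eq {α γ : Type} [Fintype α] [Nonempty α] [DecidableEq α]
    (a b : α) (x y : PMF γ) :
    ((uniformOfFintype α).bind fun c => if c = a then x else y) =
      (uniformOfFintype α).bind fun c => if c = b then x else y := by
  rw [uniformOfFintype_bind_equiv (Equiv.swap a b)]
  refine congrArg _ (funext fun c => ?_)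
  have : Equiv.swap a b c = a ↔ c = b := by
    rw [Equiv.swap_apply_eq_iff, Equiv.swap_apply_left]
  simp [this]

/-! ### Uniform scalars, uniform units and resampling -/

section Units

variable {q : ℕ} [Fact q.Prime] {γ : Type}

/-- Mixture form of the uniform law: the event `t = 0` has probability 1/q, and off it the law is
uniform on the q - 1 units. -/
theorem uniformOfFintype_zmod_eq :
    uniformOfFintype (ZMod q) = (uniformOfFintype (ZMod q)).bind fun t =>
      if t = 0 then pure 0 else (uniformOfFintype (ZMod q)ˣ).bind fun a => pure (a : ZMod q) := by
  have hq : (1 : ℕ) < q := (Fact.out : q.Prime).one_lt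
  ext y
  have key : ∀ t : ZMod q, (if t = 0 then (pure 0 : PMF (ZMod q)) else
      (uniformOfFintype (ZMod q)ˣ).bind fun a => pure (a : ZMod q)) y =
      if y = 0 then (if t = 0 then 1 else 0) else
        if t = 0 then 0 else ((q - 1 : ℕ) : ENNReal)⁻¹ := by
    intro t
    by_cases ht : t = 0
    · simp [ht, pure_apply]
    · simp only [ht, if_false, bind_apply, uniformOfFintype_apply, ZMod.card_units, pure_apply]
      by_cases hy : y = 0
      · simp [hy, eq_comm (a := (0 : ZMod q))]
      · rw [tsum_eq_single (Units.mk0 y hy)]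
        · simp [hy]
        · intro b hb
          have : y ≠ b := fun h => hb (Units.ext h.symm)
          simp [this]
  rw [bind_apply]
  simp only [key, uniformOfFintype_apply, ZMod.card, ENNReal.tsum_mul_left]
  by_cases hy : y = 0
  · simp [hy]
  · simp only [hy, if_false]
    rw [tsum_fintype, Finset.sum_ite]
    have : (Finset.univ.filter fun t : ZMod q => ¬ t = 0).card = q - 1 := by
      rw [Finset.filter_not, Finset.filter_eq', if_pos (Finset.mem_univ _),
        Finset.card_sdiff_of_subset (Finset.subset_univ _)]
      simp [ZMod.card]
    simp only [Finset.sum_const_zero, zero_add, Finset.sum_const, this, nsmul_eq_mul]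
    rw [ENNReal.mul_inv_cancel, mul_one]
    · exact Nat.cast_ne_zero.2 (by omega)
    · simp

/-- A uniform element of `ℤ_q`, translated by `c`, is a uniform unit unless it vanishes. -/
theorem uniform_zmod_add_bind (c : ZMod q) (f : (ZMod q)ˣ → PMF γ) (H : PMF γ) :
    ((uniformOfFintype (ZMod q)).bind fun x =>
        if h : x + c = 0 then H else f (Units.mk0 (x + c) h)) =
      (uniformOfFintype (ZMod q)).bind fun t =>
        if t = 0 then H else (uniformOfFintype (ZMod q)ˣ).bind f := by
  refine (uniformOfFintype_bind_equiv (Equiv.addRight c)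
    (fun x => if h : x = 0 then H else f (Units.mk0 x h))).symm.trans ?_
  conv_lhs => rw [uniformOfFintype_zmod_eq]
  rw [bind_bind]
  refine congrArg _ (funext fun t => ?_)
  by_cases ht : t = 0 <;> simp [ht]

/-- Both branches end in the same unit law, the bad one by drawing afresh. This is what makes the
encryption exponent of the challenge exact. -/
theorem uniform_zmod_add_resample (c : ZMod q) (f : (ZMod q)ˣ → PMF γ) :
    ((uniformOfFintype (ZMod q)).bind fun x =>
        if h : x + c = 0 then (uniformOfFintype (ZMod q)ˣ).bind f else f (Units.mk0 (x + c) h)) =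
      (uniformOfFintype (ZMod q)ˣ).bind f := by
  rw [uniform_zmod_add_bind]
  simp

/-- Uniform in `ℤ_q` if the flag is set and in `ℤ_q^*` otherwise. -/
noncomputable def uniformScalar (q : ℕ) [Fact q.Prime] (fl : Bool) : PMF (ZMod q) :=
  if fl then uniformOfFintype (ZMod q) else
    (uniformOfFintype (ZMod q)ˣ).bind fun a => pure (a : ZMod q)

/-- `τ` is the law of the event that the translate does not vanish; given that event, the translate
is a uniform unit. Without the flag the scalar is already a unit and the shift is 0, so the event is
certain. -/
theorem exists_uniformScalar_add_bind (fl : Bool) (c : ZMod q) (hc : fl = false → c = 0) :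
    ∃ τ : PMF Bool, ∀ (f : (ZMod q)ˣ → PMF γ) (H : PMF γ),
      ((uniformScalar q fl).bind fun x =>
        if h : x + c = 0 then H else f (Units.mk0 (x + c) h)) =
      τ.bind fun t => if t then (uniformOfFintype (ZMod q)ˣ).bind f else H := by
  cases fl with
  | false =>
    refine ⟨pure true, fun f H => ?_⟩
    simp [uniformScalar, hc rfl]
  | true =>
    refine ⟨(uniformOfFintype (ZMod q)).bind fun t => pure (decide (t ≠ 0)), fun f H => ?_⟩
    have := uniform_zmod_add_bind c f H
    rw [uniformScalar, if_pos rfl, this, bind_bind]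
    refine congrArg _ (funext fun t => ?_)
    by_cases ht : t = 0 <;> simp [ht]

theorem uniformScalar_bind_congr (fl : Bool) {F F' : ZMod q → PMF γ}
    (h : ∀ x, (fl = false → x ≠ 0) → F x = F' x) :
    (uniformScalar q fl).bind F = (uniformScalar q fl).bind F' := by
  cases fl with
  | false =>
    simp only [uniformScalar, Bool.false_eq_true, if_false, bind_bind, pure_bind]
    exact congrArg _ (funext fun a => h _ fun _ => a.ne_zero)
  | true => exact congrArg _ (funext fun x => h x (by simp))

/-- Resampling for the two exponents of a row at once: the fallback `H` redraws both, and the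
surviving branch has the same law, so the mixture is `H`. `F` is constrained only on values that the
flags allow, because a program need not behave well on impossible draws. -/
theorem uniformScalar_pair_resample (fa fb : Bool) (c d : ZMod q) (hc : fa = false → c = 0)
    (hd : fb = false → d = 0) (f : (ZMod q)ˣ → (ZMod q)ˣ → PMF γ) (H : PMF γ)
    (hH : H = (uniformOfFintype (ZMod q)ˣ).bind fun a => (uniformOfFintype (ZMod q)ˣ).bind (f a))
    (F : ZMod q → ZMod q → PMF γ)
    (hF : ∀ x y, (fa = false → x ≠ 0) → (fb = false → y ≠ 0) → F x y =
      if h : x + c = 0 then H else if h' : y + d = 0 then H else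
          f (Units.mk0 (x + c) h) (Units.mk0 (y + d) h')) :
    ((uniformScalar q fa).bind fun x => (uniformScalar q fb).bind (F x)) = H := by
  rw [uniformScalar_bind_congr fa fun x hx => uniformScalar_bind_congr fb fun y hy => hF x y hx hy]
  obtain ⟨τ, hτ⟩ := exists_uniformScalar_add_bind (γ := γ) fa c hc
  obtain ⟨τ', hτ'⟩ := exists_uniformScalar_add_bind (γ := γ) fb d hd
  have h1 : ∀ x : ZMod q, ((uniformScalar q fb).bind fun y =>
        if h : x + c = 0 then H else if h' : y + d = 0 then H else
          f (Units.mk0 (x + c) h) (Units.mk0 (y + d) h')) =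
      τ'.bind fun t => if h : x + c = 0 then H else
        if t then (uniformOfFintype (ZMod q)ˣ).bind (f (Units.mk0 (x + c) h)) else H := by
    intro x
    by_cases hx : x + c = 0
    · simp [hx]
    · simp only [hx, dif_neg, not_false_eq_true]
      exact hτ' _ H
  simp only [h1]
  -- Decide first whether the second exponent survives; each of the two outcomes then gives `H`.
  rw [bind_comm]
  have h2 : ∀ t : Bool, ((uniformScalar q fa).bind fun x => if h : x + c = 0 then H else
        if t then (uniformOfFintype (ZMod q)ˣ).bind (f (Units.mk0 (x + c) h)) else H) = H := by
    intro t
    cases t with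
    | false => simp
    | true =>
      simp only [if_true]
      rw [hτ (fun a => (uniformOfFintype (ZMod q)ˣ).bind (f a)) H, ← hH]
      simp
  simp [h2]

end Units

end PMF

/-! ### Exponents -/

section Exponents

variable {q : ℕ} [Fact q.Prime]

/-- In a group of order q an exponent matters only mod q, so the representative chosen by `ZMod.val`
is harmless. -/
theorem gexp_eq_pow {H : Type} [CommGroup H] (hH : Nat.card H = q) (x : H) (a : ℕ) :
    gexp x (a : ZMod q) = x ^ a := by
  rw [gexp, ZMod.val_natCast, ← pow_mod_natCard x a, hH]

theorem gexp_add {H : Type} [CommGroup H] (hH : Nat.card H = q) (x : H) (a b : ZMod q) :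
    gexp x (a + b) = gexp x a * gexp x b := by
  have h := gexp_eq_pow hH x (a.val + b.val)
  rw [Nat.cast_add, ZMod.natCast_zmod_val, ZMod.natCast_zmod_val] at h
  rw [h, pow_add, gexp, gexp]

theorem gexp_mul {H : Type} [CommGroup H] (hH : Nat.card H = q) (x : H) (a b : ZMod q) :
    gexp x (a * b) = gexp (gexp x a) b := by
  have h := gexp_eq_pow hH x (a.val * b.val)
  rw [Nat.cast_mul, ZMod.natCast_zmod_val, ZMod.natCast_zmod_val] at h
  rw [h, pow_mul, gexp, gexp]

theorem gexp_zero {H : Type} [CommGroup H] (x : H) : gexp x (0 : ZMod q) = 1 := by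
  simp [gexp]

theorem gexp_neg {H : Type} [CommGroup H] (hH : Nat.card H = q) (x : H) (a : ZMod q) :
    gexp x (-a) = (gexp x a)⁻¹ := by
  rw [eq_inv_iff_mul_eq_one, ← gexp_add hH, neg_add_cancel, gexp_zero]

end Exponents

namespace BilinearGroups

variable {q : ℕ} [Fact q.Prime] {G GT : Type} [CommGroup G] [CommGroup GT]

/-- The element `g ^ x`. -/
def exp (B : BilinearGroups q G GT) (x : ZMod q) : G := gexp B.g x

/-- The element `e(g, g) ^ x`. -/
def expT (B : BilinearGroups q G GT) (x : ZMod q) : GT := gexp (B.e B.g B.g) x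

variable (B : BilinearGroups q G GT)

theorem exp_add (x y : ZMod q) : B.exp (x + y) = B.exp x * B.exp y := gexp_add B.card_G _ x y

theorem exp_zero : B.exp 0 = 1 := gexp_zero _

theorem exp_neg (x : ZMod q) : B.exp (-x) = (B.exp x)⁻¹ := gexp_neg B.card_G _ x

theorem gexp_exp (x y : ZMod q) : gexp (B.exp x) y = B.exp (x * y) :=
  (gexp_mul B.card_G _ x y).symm

theorem exp_one : B.exp 1 = B.g := by
  have := gexp_eq_pow (q := q) B.card_G B.g 1
  simpa [exp] using this

theorem expT_add (x y : ZMod q) : B.expT (x + y) = B.expT x * B.expT y :=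
  gexp_add B.card_GT _ x y

theorem expT_neg (x : ZMod q) : B.expT (-x) = (B.expT x)⁻¹ := gexp_neg B.card_GT _ x

theorem e_exp (x y : ZMod q) : B.e (B.exp x) (B.exp y) = B.expT (x * y) := by
  rw [expT, gexp_mul B.card_GT]
  simp [exp, gexp, ← pow_mul, mul_comm]

theorem exp_sum {ι : Type} (s : Finset ι) (f : ι → ZMod q) :
    B.exp (∑ i ∈ s, f i) = ∏ i ∈ s, B.exp (f i) := by
  classical
  induction s using Finset.induction_on with
  | empty => simp [exp_zero]
  | insert i s hi ih => rw [Finset.sum_insert hi, Finset.prod_insert hi, exp_add, ih]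

theorem exp_surjective : Function.Surjective B.exp := by
  intro x
  have hg : B.g ^ q = 1 := by simpa [B.card_G] using pow_card_eq_one' (x := B.g)
  obtain ⟨m, hm⟩ := ((isOfFinOrder_iff_pow_eq_one.2
    ⟨q, (Fact.out : q.Prime).pos, hg⟩ :
      IsOfFinOrder B.g).mem_powers_iff_mem_zpowers.2 (B.generates x))
  exact ⟨(m : ZMod q), (gexp_eq_pow B.card_G B.g m).trans hm⟩

theorem exp_bijective : Function.Bijective B.exp := by
  have : Finite G := Nat.finite_of_card_ne_zero (by rw [B.card_G]; exact (Fact.out : q.Prime).ne_zero)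
  refine (Nat.bijective_iff_surjective_and_card _).2 ⟨B.exp_surjective, ?_⟩
  rw [B.card_G, Nat.card_zmod]

theorem exp_eq_one_iff (x : ZMod q) : B.exp x = 1 ↔ x = 0 := by
  rw [← B.exp_zero, B.exp_bijective.1.eq_iff]

/-- The bijection `x ↦ g ^ x`. -/
noncomputable def expEquiv : ZMod q ≃ G := Equiv.ofBijective B.exp B.exp_bijective

end BilinearGroups

/-! ### The game in terms of exponents -/

/-- The exponents that determine the system parameters: `u = g ^ μ`, `h i = g ^ (η i)`, and the
pairs of exponents of the rows of the tuples. -/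
structure Exponents (q n tuples : ℕ) where
  μ : ZMod q
  η : Fin n → ZMod q
  t : Fin tuples → Fin n → (ZMod q)ˣ × (ZMod q)ˣ

/-- The part of the challenger's state that a program can see: the positions of the registered
users, the seating in the sessions of every group, and whether Test has been answered. -/
structure SymState (users n tuples : ℕ) where
  pos : Fin users → Option (Fin n)
  groups : List (Fin tuples × List (Fin n → Option (Fin users)))
  tested : Bool

/-- What the challenger does on a query. -/
inductive Act (users n tuples : ℕ) : Type
  | refuse
  | showKey (v : Fin users) (i : Fin n)
  | newKey (v : Fin users) (i : Fin n)
  | privateKey (v : Fin users) (i : Fin n)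
  | form (π : ℕ) (γ : Fin tuples) (i : Fin n) (seats : Fin n → Option (Fin users))
  | update (π ℓ : ℕ) (γ : Fin tuples) (seats : Fin n → Option (Fin users))
  | decryptionKey (γ : Fin tuples) (seats : Fin n → Option (Fin users)) (i : Fin n)
  | challenge (R : Finset (Fin users)) (γ : Fin tuples) (seats : Fin n → Option (Fin users))

section Symbolic

variable {q : ℕ} [Fact q.Prime] {G GT : Type} [CommGroup G] [CommGroup GT]
variable {users n tuples : ℕ}

def SymState.addSession (st : SymState users n tuples) (π : ℕ)
    (seats : Fin n → Option (Fin users)) : SymState users n tuples :=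
  { st with groups := st.groups.modify π fun gr => (gr.1, gr.2 ++ [seats]) }

open Classical in
/-- The action on a query and the next symbolic state. -/
noncomputable def SymState.plan (N L : ℕ) (U : Finset (Fin users))
    (st : SymState users n tuples) :
    Query users n tuples → Act users n tuples × SymState users n tuples
  | .register _ v i =>
    match st.pos v with
    | some i' => (.showKey v i', st)
    | none => (.newKey v i, { st with pos := Function.update st.pos v (some i) })
  | .extract v =>
    match st.pos v with
    | some i => if v ∈ U then (.refuse, st) else (.privateKey v i, st)
    | none => (.refuse, st)
  | .execute γ i seats =>
    if st.groups.length < N ∧ (seats i).isSome ∧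
        ∀ j v, seats j = some v → st.pos v = some j ∧ v ∉ U then
      (.form st.groups.length γ i seats, { st with groups := st.groups ++ [(γ, [seats])] })
    else (.refuse, st)
  | .join v π =>
    match st.groups[π]?, st.pos v with
    | some gr, some I =>
      match gr.2.getLast? with
      | some seats =>
        if seats I = none ∧ gr.2.length < L then
          (.update π gr.2.length gr.1 (Function.update seats I (some v)),
            st.addSession π (Function.update seats I (some v)))
        else (.refuse, st)
      | none => (.refuse, st)
    | _, _ => (.refuse, st)
  | .leave π J =>
    match st.groups[π]? with
    | some gr =>
      match gr.2.getLast? with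
      | some seats =>
        if (seats J).isSome ∧ gr.2.length < L then
          (.update π gr.2.length gr.1 (Function.update seats J none),
            st.addSession π (Function.update seats J none))
        else (.refuse, st)
      | none => (.refuse, st)
    | none => (.refuse, st)
  | .reveal v π ℓ =>
    match st.groups[π]?, st.pos v with
    | some gr, some i =>
      match gr.2[ℓ]? with
      | some seats =>
        if seats i = some v ∧ v ∉ U then (.decryptionKey gr.1 seats i, st) else (.refuse, st)
      | none => (.refuse, st)
    | _, _ => (.refuse, st)
  | .test R π ℓ =>
    match st.groups[π]? with
    | some gr =>
      match gr.2[ℓ]? with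
      | some seats =>
        if st.tested = false ∧ R ⊆ U ∧ ∀ v ∈ R, ∃ i, seats i = some v then
          (.challenge R gr.1 seats, { st with tested := true })
        else (.refuse, st)
      | none => (.refuse, st)
    | none => (.refuse, st)

namespace Exponents

/-- The row with exponents `x`. -/
def row (X : Exponents q n tuples) (B : BilinearGroups q G GT) (x : (ZMod q)ˣ × (ZMod q)ˣ) :
    Row n G where
  A := B.exp x.1
  B := B.exp x.2
  K j := B.exp (X.η j * x.1 + X.μ * x.2)

/-- The system parameters with the given exponents. -/
def sys (X : Exponents q n tuples) (B : BilinearGroups q G GT) : SysParams n tuples G where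
  u := B.exp X.μ
  h j := B.exp (X.η j)
  tuple γ i := X.row B (X.t γ i)

/-- The exponents of the row used at position `j`. -/
def seat (X : Exponents q n tuples) (keys : Fin users → (ZMod q)ˣ × (ZMod q)ˣ) (γ : Fin tuples)
    (seats : Fin n → Option (Fin users)) (j : Fin n) : (ZMod q)ˣ × (ZMod q)ˣ :=
  match seats j with
  | none => X.t γ j
  | some v => keys v

/-- The exponent of the contribution of position `j` to the header of an encryption for `R` (for
the projection `f` to the first component) or to its session key (second component). -/
def share (X : Exponents q n tuples) (keys : Fin users → (ZMod q)ˣ × (ZMod q)ˣ) (γ : Fin tuples)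
    (seats : Fin n → Option (Fin users)) (R : Finset (Fin users))
    (f : (ZMod q)ˣ × (ZMod q)ˣ → (ZMod q)ˣ) (j : Fin n) : ZMod q :=
  match seats j with
  | none => f (X.t γ j)
  | some v => if v ∈ R then f (keys v) else f (keys v) + f (X.t γ j)

/-- The exponent of the decryption key of position `i`. -/
def dec (X : Exponents q n tuples) (keys : Fin users → (ZMod q)ˣ × (ZMod q)ˣ) (γ : Fin tuples)
    (seats : Fin n → Option (Fin users)) (i : Fin n) : ZMod q :=
  ∑ j, (X.η i * (X.seat keys γ seats j).1 + X.μ * (X.seat keys γ seats j).2)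

def info (X : Exponents q n tuples) (B : BilinearGroups q G GT)
    (keys : Fin users → (ZMod q)ˣ × (ZMod q)ˣ) (π ℓ : ℕ) (γ : Fin tuples)
    (seats : Fin n → Option (Fin users)) : GroupInfo users n G :=
  ⟨π, ℓ, seats, B.exp (∑ j, ((X.seat keys γ seats j).1 : ZMod q)),
    B.exp (∑ j, ((X.seat keys γ seats j).2 : ZMod q))⟩

/-- The challenger's answer if it takes the given action, where the session key of the challenge is
multiplied by `ζ`, and the exponents of the users' long-term keys thereafter. -/
noncomputable def respond (X : Exponents q n tuples) (B : BilinearGroups q G GT) (ζ : GT)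
    (keys : Fin users → (ZMod q)ˣ × (ZMod q)ˣ) : Act users n tuples →
    PMF (Answer users n G GT × (Fin users → (ZMod q)ˣ × (ZMod q)ˣ))
  | .refuse => PMF.pure (.refused, keys)
  | .showKey v i => PMF.pure (.publicKey i ((X.row B (keys v)).pub i), keys)
  | .newKey v i =>
    (PMF.uniformOfFintype (ZMod q)ˣ).bind fun a => (PMF.uniformOfFintype (ZMod q)ˣ).bind fun b =>
      PMF.pure (.publicKey i ((X.row B (a, b)).pub i), Function.update keys v (a, b))
  | .privateKey v i => PMF.pure (.privateKey ((X.row B (keys v)).K i), keys)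
  | .form π γ i seats =>
    PMF.pure (.formed (X.info B keys π 0 γ seats) (B.exp (X.dec keys γ seats i)), keys)
  | .update π ℓ γ seats => PMF.pure (.updated (X.info B keys π ℓ γ seats), keys)
  | .decryptionKey γ seats i => PMF.pure (.decryptionKey (B.exp (X.dec keys γ seats i)), keys)
  | .challenge R γ seats =>
    (PMF.uniformOfFintype (ZMod q)ˣ).bind fun ρ =>
      PMF.pure (.challenge (B.exp ρ) (B.exp ((∑ j, X.share keys γ seats R Prod.fst j) * ρ))
        (B.expT (X.μ * ρ * ∑ j, X.share keys γ seats R Prod.snd j) * ζ), keys)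

end Exponents

/-- Whether a challenge passes the test `chk`; all other actions pass. -/
def Act.passes (chk : Finset (Fin users) → (Fin n → Option (Fin users)) → Bool) :
    Act users n tuples → Bool
  | .challenge R _ seats => chk R seats
  | _ => true

/-- The query phase in terms of exponents. The result is `none` if a challenge does not pass `chk`,
or if there is no challenge and `fin` is false. -/
noncomputable def symPhase (B : BilinearGroups q G GT) (N L : ℕ) (A : Adversary users n tuples G GT)
    (X : Exponents q n tuples) (ζ : GT) (U : Finset (Fin users))
    (chk : Finset (Fin users) → (Fin n → Option (Fin users)) → Bool) (fin : Bool) :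
    ℕ → SymState users n tuples → (Fin users → (ZMod q)ˣ × (ZMod q)ˣ) → A.σ → PMF (Option Bool)
  | 0, st, _, s => if st.tested || fin then (A.guess s).map some else PMF.pure none
  | m + 1, st, keys, s =>
    (A.query s).bind fun x =>
      if (st.plan N L U x.1).1.passes chk then
        (X.respond B ζ keys (st.plan N L U x.1).1).bind fun y =>
          (A.receive x.2 y.1).bind fun s' =>
            symPhase B N L A X ζ U chk fin m (st.plan N L U x.1).2 y.2 s'
      else PMF.pure none

end Symbolic

/-! ### Transitions of the symbolic state -/

section Plan

variable {users n tuples : ℕ}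

/-- Seated users are registered for their positions. -/
def SymState.Seated (st : SymState users n tuples) : Prop :=
  ∀ gr ∈ st.groups, ∀ seats ∈ gr.2, ∀ j v, seats j = some v → st.pos v = some j

theorem SymState.mem_addSession {st : SymState users n tuples} {π : ℕ}
    {seats : Fin n → Option (Fin users)}
    {gr : Fin tuples × List (Fin n → Option (Fin users))}
    (h : gr ∈ (st.addSession π seats).groups) :
    gr ∈ st.groups ∨ ∃ gr', st.groups[π]? = some gr' ∧ gr = (gr'.1, gr'.2 ++ [seats]) := by
  obtain ⟨l, hl⟩ := List.mem_iff_getElem?.1 h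
  simp only [SymState.addSession, List.getElem?_modify] at hl
  by_cases hπ : π = l
  · subst hπ
    obtain ⟨gr', h1, h2⟩ := Option.map_eq_some_iff.1 hl
    exact Or.inr ⟨gr', h1, by simpa using h2.symm⟩
  · obtain ⟨gr', h1, h2⟩ := Option.map_eq_some_iff.1 hl
    simp only [hπ, if_false] at h2
    exact Or.inl (List.mem_iff_getElem?.2 ⟨l, by rw [h1]; exact congrArg some h2⟩)

theorem SymState.Seated.plan {st : SymState users n tuples} (hst : st.Seated) (N L : ℕ)
    (U : Finset (Fin users)) (x : Query users n tuples) : (st.plan N L U x).2.Seated := by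
  cases x with
  | register γ v i =>
    simp only [SymState.plan]
    split
    · exact hst
    · rename_i hv
      intro gr hgr seats hs j w hw
      have := hst gr hgr seats hs j w hw
      -- A newly registered user was unregistered, hence seated nowhere.
      have hne : w ≠ v := by rintro rfl; simp [hv] at this
      simpa [hne] using this
  | extract v =>
    simp only [SymState.plan]
    split
    · split <;> exact hst
    · exact hst
  | execute γ i seats =>
    simp only [SymState.plan]
    split
    · rename_i h
      intro gr hgr seats' hs j w hw
      rcases List.mem_append.1 hgr with hgr | hgr
      · exact hst gr hgr seats' hs j w hw
      · obtain rfl := List.mem_singleton.1 hgr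
        obtain rfl := List.mem_singleton.1 hs
        exact (h.2.2 j w hw).1
    · exact hst
  | join v π =>
    simp only [SymState.plan]
    split
    · rename_i gr I hgr hv
      split
      · rename_i seats hs
        split
        · intro gr' hgr' seats' hs' j w hw
          rcases SymState.mem_addSession hgr' with h | ⟨gr₁, h1, rfl⟩
          · exact hst gr' h seats' hs' j w hw
          · rw [hgr] at h1
            obtain rfl := Option.some.inj h1
            have hmem := List.mem_of_getElem? hgr
            rcases List.mem_append.1 hs' with h | h
            · exact hst gr hmem seats' h j w hw
            · obtain rfl := List.mem_singleton.1 h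
              by_cases hj : j = I
              · subst hj
                have : v = w := by simpa using hw
                exact this ▸ hv
              · exact hst gr hmem seats (List.mem_of_getLast? hs) j w (by simpa [hj] using hw)
        · exact hst
      · exact hst
    · exact hst
  | leave π J =>
    simp only [SymState.plan]
    split
    · rename_i gr hgr
      split
      · rename_i seats hs
        split
        · intro gr' hgr' seats' hs' j w hw
          rcases SymState.mem_addSession hgr' with h | ⟨gr₁, h1, rfl⟩
          · exact hst gr' h seats' hs' j w hw
          · rw [hgr] at h1
            obtain rfl := Option.some.inj h1
            have hmem := List.mem_of_getElem? hgr
            rcases List.mem_append.1 hs' with h | h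
            · exact hst gr hmem seats' h j w hw
            · obtain rfl := List.mem_singleton.1 h
              by_cases hj : j = J
              · subst hj
                simp at hw
              · exact hst gr hmem seats (List.mem_of_getLast? hs) j w (by simpa [hj] using hw)
        · exact hst
      · exact hst
    · exact hst
  | reveal v π ℓ =>
    simp only [SymState.plan]
    repeat' split
    all_goals exact hst
  | test R π ℓ =>
    simp only [SymState.plan]
    repeat' split
    all_goals exact hst

/-- The action is an answered Test query. -/
def Act.IsChallenge (a : Act users n tuples) : Prop :=
  ∃ R γ seats, a = .challenge R γ seats

theorem Act.passes_of_not_isChallenge {a : Act users n tuples} (ha : ¬ a.IsChallenge)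
    (chk : Finset (Fin users) → (Fin n → Option (Fin users)) → Bool) : a.passes chk = true := by
  cases a <;> first | rfl | exact absurd ⟨_, _, _, rfl⟩ ha

/-- Collects what an answered Test guarantees; in particular `tested` was false before and is true
afterwards, so there is at most one challenge. -/
theorem SymState.plan_challenge {st : SymState users n tuples} {N L : ℕ} {U : Finset (Fin users)}
    {x : Query users n tuples} {R : Finset (Fin users)} {γ : Fin tuples}
    {seats : Fin n → Option (Fin users)} (h : (st.plan N L U x).1 = .challenge R γ seats) :
    st.tested = false ∧ R ⊆ U ∧ (∀ v ∈ R, ∃ i, seats i = some v) ∧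
      (st.plan N L U x).2.tested = true ∧ ∃ gr ∈ st.groups, gr.1 = γ ∧ seats ∈ gr.2 := by
  cases x with
  | test R' π ℓ =>
    revert h
    simp only [SymState.plan]
    split
    · rename_i gr hgr
      split
      · rename_i seats' hs
        split
        · rename_i hc
          intro h
          simp only [Act.challenge.injEq] at h
          obtain ⟨rfl, rfl, rfl⟩ := h
          exact ⟨hc.1, hc.2.1, hc.2.2, rfl, gr, List.mem_of_getElem? hgr, rfl,
            List.mem_of_getElem? hs⟩
        · simp
      · simp
    · simp
  | _ =>
    exfalso
    revert h
    simp only [SymState.plan]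
    repeat' split
    all_goals simp

theorem SymState.plan_tested {st : SymState users n tuples} {N L : ℕ} {U : Finset (Fin users)}
    {x : Query users n tuples} (h : ¬ (st.plan N L U x).1.IsChallenge) :
    (st.plan N L U x).2.tested = st.tested := by
  cases x with
  | test R' π ℓ =>
    revert h
    simp only [SymState.plan]
    split
    · split
      · split
        · intro h
          exact absurd ⟨_, _, _, rfl⟩ h
        · simp
      · simp
    · simp
  | _ =>
    simp only [SymState.plan]
    repeat' split
    all_goals rfl

end Plan

/-! ### The chance of a right guess does not depend on the adversary -/

section Phase

variable {q : ℕ} [Fact q.Prime] {G GT : Type} [CommGroup G] [CommGroup GT]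
variable {users n tuples : ℕ}

theorem Exponents.respond_of_not_isChallenge (X : Exponents q n tuples)
    (B : BilinearGroups q G GT) {a : Act users n tuples} (ha : ¬ a.IsChallenge) (ζ ζ' : GT)
    (keys : Fin users → (ZMod q)ˣ × (ZMod q)ˣ) : X.respond B ζ keys a = X.respond B ζ' keys a := by
  cases a <;> first | rfl | exact absurd ⟨_, _, _, rfl⟩ ha

/-- After the challenge, neither `ζ` nor `chk` nor `fin` matters. -/
theorem symPhase_of_tested (B : BilinearGroups q G GT) (N L : ℕ)
    (A : Adversary users n tuples G GT) (X : Exponents q n tuples) (ζ ζ' : GT)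
    (U : Finset (Fin users)) (chk chk' : Finset (Fin users) → (Fin n → Option (Fin users)) → Bool)
    (fin fin' : Bool) (m : ℕ) (st : SymState users n tuples) (hst : st.tested = true)
    (keys : Fin users → (ZMod q)ˣ × (ZMod q)ˣ) (s : A.σ) :
    symPhase B N L A X ζ U chk fin m st keys s = symPhase B N L A X ζ' U chk' fin' m st keys s := by
  induction m generalizing st keys s with
  | zero => simp [symPhase, hst]
  | succ m ih =>
    simp only [symPhase]
    refine congrArg _ (funext fun x => ?_)
    -- A second challenge is impossible, and only a challenge reads `ζ` or `chk`.
    have hx : ¬ (st.plan N L U x.1).1.IsChallenge := by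
      rintro ⟨R, γ, seats, h⟩
      exact absurd (SymState.plan_challenge h).1 (by simp [hst])
    rw [if_pos (Act.passes_of_not_isChallenge hx _), if_pos (Act.passes_of_not_isChallenge hx _),
      X.respond_of_not_isChallenge B hx ζ ζ']
    refine congrArg _ (funext fun y => congrArg _ (funext fun s' => ?_))
    exact ih _ ((SymState.plan_tested hx).trans hst) _ _

/-- The pattern of positions that answers a challenge for `R`: a position is off if it is held by a
user of `U` outside `R`. -/
noncomputable def requiredPattern (U R : Finset (Fin users)) (seats : Fin n → Option (Fin users))
    (i : Fin n) : Bool :=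
  match seats i with
  | none => true
  | some v => decide (v ∈ U → v ∈ R)

/-- For a uniformly random pattern, the phase that insists on the required pattern succeeds with
the same probability whatever happens. -/
theorem uniform_bind_symPhase (B : BilinearGroups q G GT) (N L : ℕ)
    (A : Adversary users n tuples G GT) (X : Exponents q n tuples) (ζ : GT)
    (U : Finset (Fin users)) (m : ℕ) (st : SymState users n tuples) (hst : st.tested = false)
    (keys : Fin users → (ZMod q)ˣ × (ZMod q)ˣ) (s : A.σ) :
    ((PMF.uniformOfFintype (Fin n → Bool)).bind fun e =>
      symPhase B N L A X ζ U (fun R seats => decide (e = requiredPattern U R seats))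
        (decide (e = fun _ => true)) m st keys s) =
    (PMF.uniformOfFintype (Fin n → Bool)).bind fun e => if e = fun _ => true then
      symPhase B N L A X ζ U (fun _ _ => true) true m st keys s else PMF.pure none := by
  induction m generalizing st keys s with
  | zero =>
    refine congrArg _ (funext fun e => ?_)
    -- A run without challenge requires no pattern. The flag `fin` makes it succeed exactly for the
    -- all-true pattern, so that it has the same success probability as the other runs.
    simp [symPhase, hst]
  | succ m ih =>
    simp only [symPhase]
    rw [PMF.bind_comm]
    have hpull : ∀ (e : Fin n → Bool) {α : Type} (p : PMF α) (f : α → PMF (Option Bool)),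
        (if e = (fun _ => true) then p.bind f else PMF.pure none) =
          p.bind fun a => if e = (fun _ => true) then f a else PMF.pure none := by
      intro e α p f
      split <;> simp
    simp only [hpull]
    conv_rhs => rw [PMF.bind_comm]
    refine congrArg _ (funext fun x => ?_)
    by_cases hx : (st.plan N L U x.1).1.IsChallenge
    · obtain ⟨R, γ, seats, h⟩ := hx
      simp only [h, Act.passes, decide_eq_true_eq, if_true]
      -- Up to this moment the phase has not depended on `e`, so the pattern required by this
      -- challenge may be exchanged with the all-true one.
      rw [PMF.uniformOfFintype_bind_ite_eq (fun _ => true) (requiredPattern U R seats)]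
      refine congrArg _ (funext fun e => ?_)
      split
      · refine congrArg _ (funext fun y => congrArg _ (funext fun s' => ?_))
        exact symPhase_of_tested _ _ _ _ _ _ _ _ _ _ _ _ _ _ (SymState.plan_challenge h).2.2.2.1 _ _
      · rfl
    · simp only [Act.passes_of_not_isChallenge hx, if_true]
      rw [PMF.bind_comm]
      simp only [hpull]
      conv_rhs => rw [PMF.bind_comm]
      refine congrArg _ (funext fun y => ?_)
      rw [PMF.bind_comm]
      conv_rhs => rw [PMF.bind_comm]
      refine congrArg _ (funext fun s' => ?_)
      exact ih _ ((SymState.plan_tested hx).trans hst) _ _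

end Phase

/-! ### Degenerate cases: one session per group, or no positions -/

section Phase

variable {q : ℕ} [Fact q.Prime] {G GT : Type} [CommGroup G] [CommGroup GT]
variable {users n tuples : ℕ}

/-- Every group has a session, and no user of `U` is seated. -/
def SymState.Avoids (st : SymState users n tuples) (U : Finset (Fin users)) : Prop :=
  ∀ gr ∈ st.groups, gr.2 ≠ [] ∧ ∀ seats ∈ gr.2, ∀ j v, seats j = some v → v ∉ U

theorem SymState.Avoids.plan {st : SymState users n tuples} {N L : ℕ} (hL : L ≤ 1)
    {U : Finset (Fin users)} (hst : st.Avoids U) (x : Query users n tuples) :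
    (st.plan N L U x).2.Avoids U := by
  cases x with
  | execute γ i seats =>
    simp only [SymState.plan]
    split
    · rename_i h
      intro gr hgr
      rcases List.mem_append.1 hgr with hgr | hgr
      · exact hst gr hgr
      · obtain rfl := List.mem_singleton.1 hgr
        refine ⟨by simp, fun seats' hs j w hw => ?_⟩
        obtain rfl := List.mem_singleton.1 hs
        exact (h.2.2 j w hw).2
    · exact hst
  | join v π =>
    simp only [SymState.plan]
    split
    · rename_i gr I hgr hv
      split
      · split
        · rename_i h
          -- With `L ≤ 1` a Join would need a group without sessions, but Execute always creates the
          -- first one.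
          exact absurd (List.length_eq_zero_iff.1 (by omega)) (hst gr (List.mem_of_getElem? hgr)).1
        · exact hst
      · exact hst
    · exact hst
  | leave π J =>
    simp only [SymState.plan]
    split
    · rename_i gr hgr
      split
      · split
        · rename_i h
          exact absurd (List.length_eq_zero_iff.1 (by omega)) (hst gr (List.mem_of_getElem? hgr)).1
        · exact hst
      · exact hst
    · exact hst
  | _ =>
    simp only [SymState.plan]
    repeat' split
    all_goals exact hst

/-- If groups have only one session then no user of `U` is ever seated, and the pattern without
off positions answers every challenge. -/
theorem symPhase_of_le_one (B : BilinearGroups q G GT) (N : ℕ) {L : ℕ} (hL : L ≤ 1)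
    (A : Adversary users n tuples G GT) (X : Exponents q n tuples) (ζ : GT)
    (U : Finset (Fin users)) (m : ℕ) (st : SymState users n tuples) (hst : st.Avoids U)
    (keys : Fin users → (ZMod q)ˣ × (ZMod q)ˣ) (s : A.σ) :
    symPhase B N L A X ζ U (fun R seats => decide ((fun _ => true) = requiredPattern U R seats))
        true m st keys s =
      symPhase B N L A X ζ U (fun _ _ => true) true m st keys s := by
  induction m generalizing st keys s with
  | zero => rfl
  | succ m ih =>
    simp only [symPhase]
    refine congrArg _ (funext fun x => ?_)
    have hp : (st.plan N L U x.1).1.passes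
        (fun R seats => decide ((fun _ => true) = requiredPattern U R seats)) = true := by
      by_cases hx : (st.plan N L U x.1).1.IsChallenge
      · obtain ⟨R, γ, seats, h⟩ := hx
        obtain ⟨-, -, -, -, gr, hgr, -, hs⟩ := SymState.plan_challenge h
        rw [h]
        refine decide_eq_true (funext fun i => ?_)
        unfold requiredPattern
        split
        · rfl
        · rename_i v hv
          have := (hst gr hgr).2 seats hs i v hv
          simp [this]
      · exact Act.passes_of_not_isChallenge hx _
    have hp' : (st.plan N L U x.1).1.passes (fun _ _ => true) = true := by
      cases (st.plan N L U x.1).1 <;> rfl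
    rw [if_pos hp, if_pos hp']
    refine congrArg _ (funext fun y => congrArg _ (funext fun s' => ?_))
    exact ih _ (hst.plan hL x.1) _ _

/-- Without positions no group can be formed, so that there is no challenge. -/
theorem symPhase_of_isEmpty [IsEmpty (Fin n)] (B : BilinearGroups q G GT) (N L : ℕ)
    (A : Adversary users n tuples G GT) (X : Exponents q n tuples) (ζ ζ' : GT)
    (U : Finset (Fin users)) (chk : Finset (Fin users) → (Fin n → Option (Fin users)) → Bool)
    (fin : Bool) (m : ℕ) (st : SymState users n tuples) (hst : st.groups = [])
    (keys : Fin users → (ZMod q)ˣ × (ZMod q)ˣ) (s : A.σ) :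
    symPhase B N L A X ζ U chk fin m st keys s = symPhase B N L A X ζ' U chk fin m st keys s := by
  induction m generalizing st keys s with
  | zero => rfl
  | succ m ih =>
    simp only [symPhase]
    refine congrArg _ (funext fun x => ?_)
    have hx : ¬ (st.plan N L U x.1).1.IsChallenge := by
      rintro ⟨R, γ, seats, h⟩
      obtain ⟨-, -, -, -, gr, hgr, -⟩ := SymState.plan_challenge h
      simp [hst] at hgr
    have hg : (st.plan N L U x.1).2.groups = [] := by
      cases x.1 with
      -- Execute has to name a member's position, and there is none.
      | execute γ i seats => exact isEmptyElim i
      | _ =>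
        simp only [SymState.plan]
        repeat' split
        all_goals simp_all
    rw [if_pos (Act.passes_of_not_isChallenge hx _), if_pos (Act.passes_of_not_isChallenge hx _),
      X.respond_of_not_isChallenge B hx ζ ζ']
    refine congrArg _ (funext fun y => congrArg _ (funext fun s' => ?_))
    exact ih _ hg _ _

end Phase

/-! ### The game and its form in terms of exponents agree -/

section Canonical

variable {q : ℕ} [Fact q.Prime] {G GT : Type} [CommGroup G] [CommGroup GT]
variable {users n tuples : ℕ}

theorem mkRow_eq_row (X : Exponents q n tuples) (B : BilinearGroups q G GT) (a b : (ZMod q)ˣ) :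
    mkRow B (B.exp X.μ) (fun j => B.exp (X.η j)) a b = X.row B (a, b) := by
  simp only [mkRow, Exponents.row, B.gexp_exp, ← B.exp_add]
  rfl

theorem sum_update_add {ι M : Type} [DecidableEq ι] [AddCommGroup M] (s : Finset ι) {i : ι}
    (hi : i ∈ s) (f : ι → M) (b : M) :
    ∑ j ∈ s, Function.update f i b j = ∑ j ∈ s, f j + b - f i := by
  rw [Finset.sum_update_of_mem hi, ← Finset.add_sum_erase s f hi, Finset.sdiff_singleton_eq_erase]
  abel

namespace Exponents

/-- The session with the given seating. -/
def session (X : Exponents q n tuples) (B : BilinearGroups q G GT)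
    (keys : Fin users → (ZMod q)ˣ × (ZMod q)ˣ) (γ : Fin tuples)
    (seats : Fin n → Option (Fin users)) : Session users n G where
  members i := (seats i).map fun v => ⟨v, X.row B (keys v), B.exp (X.dec keys γ seats i)⟩
  Y₁ := B.exp (∑ j, ((X.seat keys γ seats j).1 : ZMod q))
  Y₂ := B.exp (∑ j, ((X.seat keys γ seats j).2 : ZMod q))
  dk i := B.exp (∑ j ∈ Finset.univ.erase i,
    (X.η i * (X.seat keys γ seats j).1 + X.μ * (X.seat keys γ seats j).2))

variable (X : Exponents q n tuples) (B : BilinearGroups q G GT)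
  (keys : Fin users → (ZMod q)ˣ × (ZMod q)ˣ) (γ : Fin tuples) (seats : Fin n → Option (Fin users))

/-- The member's key is the product over the other positions times its own secret entry, that is,
the sum over all positions in the exponent. -/
theorem keyDerive_eq_session :
    keyDerive (X.sys B) γ (fun j => (seats j).map fun v => (v, X.row B (keys v))) =
      X.session B keys γ seats := by
  have hrow : ∀ j, (((((seats j).map fun v => (v, X.row B (keys v))).map Prod.snd).getD
      ((X.sys B).tuple γ j)) : Row n G) = X.row B (X.seat keys γ seats j) := by
    intro j
    unfold seat
    cases seats j <;> rfl
  unfold keyDerive session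
  simp only [hrow]
  simp only [row, ← B.exp_sum]
  congr 1
  funext i
  rw [Option.map_map]
  cases hi : seats i with
  | none => rfl
  | some v =>
    simp only [Option.map_some, Function.comp_apply, ← B.exp_add, dec]
    rw [← Finset.sum_erase_add _ _ (Finset.mem_univ i)]
    simp only [seat, hi]

theorem seat_update_some (I : Fin n) (v : Fin users) :
    X.seat keys γ (Function.update seats I (some v)) =
      Function.update (X.seat keys γ seats) I (keys v) := by
  funext j
  by_cases hj : j = I
  · subst hj; simp [seat]
  · simp [seat, hj]

theorem seat_update_none (I : Fin n) :
    X.seat keys γ (Function.update seats I none) =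
      Function.update (X.seat keys γ seats) I (X.t γ I) := by
  funext j
  by_cases hj : j = I
  · subst hj; simp [seat]
  · simp [seat, hj]

theorem sum_comp_update {α ι M : Type} [DecidableEq ι] [AddCommGroup M] (s : Finset ι) {i : ι}
    (hi : i ∈ s) (f : ι → α) (b : α) (F : α → M) :
    ∑ j ∈ s, F (Function.update f i b j) = ∑ j ∈ s, F (f j) + F b - F (f i) := by
  rw [← sum_update_add s hi (fun j => F (f j)) (F b)]
  refine Finset.sum_congr rfl fun j _ => ?_
  by_cases hj : j = i
  · subst hj; simp
  · simp [hj]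

theorem sum_comp_update_of_notMem {α ι M : Type} [DecidableEq ι] [AddCommGroup M] (s : Finset ι)
    {i : ι} (hi : i ∉ s) (f : ι → α) (b : α) (F : α → M) :
    ∑ j ∈ s, F (Function.update f i b j) = ∑ j ∈ s, F (f j) := by
  refine Finset.sum_congr rfl fun j hj => ?_
  have hne : j ≠ i := fun h => hi (h ▸ hj)
  rw [Function.update_of_ne hne]

/-- Key updates exchange one row for another in every product, so a session depends only on its
current seating and not on its history. This is why a symbolic state suffices. -/
theorem keyJoin_eq_session (v : Fin users) (I : Fin n) (hI : seats I = none) :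
    keyJoin (X.sys B) γ (X.session B keys γ seats) v I (X.row B (keys v)) =
      X.session B keys γ (Function.update seats I (some v)) := by
  have hs : X.seat keys γ seats I = X.t γ I := by simp [seat, hI]
  unfold keyJoin session
  simp only [seat_update_some, dec, sys, row, ← B.exp_neg, ← B.exp_add]
  congr 1
  · funext j
    by_cases hj : j = I
    · subst hj
      simp only [if_true, Function.update_self, Option.map_some]
      -- At the newcomer's own position the public part omits that position's row, so nothing has to
      -- be divided out and only the secret entry is multiplied in.
      rw [sum_comp_update Finset.univ (Finset.mem_univ _) _ _
        (fun x : (ZMod q)ˣ × (ZMod q)ˣ => X.η j * (x.1 : ZMod q) + X.μ * x.2),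
        Finset.sum_erase_eq_sub (Finset.mem_univ j), sub_add_eq_add_sub]
    · simp only [hj, if_false]
      rw [Function.update_of_ne hj, Option.map_map]
      refine congrArg (fun f => Option.map f (seats j)) (funext fun w => ?_)
      simp only [Function.comp_apply, ← B.exp_add]
      rw [sum_comp_update Finset.univ (Finset.mem_univ _) _ _
        (fun x : (ZMod q)ˣ × (ZMod q)ˣ => X.η j * (x.1 : ZMod q) + X.μ * x.2), hs, sub_eq_add_neg]
  · rw [sum_comp_update Finset.univ (Finset.mem_univ _) _ _
      (fun x : (ZMod q)ˣ × (ZMod q)ˣ => (x.1 : ZMod q)), hs, sub_eq_add_neg]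
  · rw [sum_comp_update Finset.univ (Finset.mem_univ _) _ _
      (fun x : (ZMod q)ˣ × (ZMod q)ˣ => (x.2 : ZMod q)), hs, sub_eq_add_neg]
  · funext l
    by_cases hl : l = I
    · subst hl
      rw [if_pos rfl, sum_comp_update_of_notMem _ (by simp) _ _
        (fun x : (ZMod q)ˣ × (ZMod q)ˣ => X.η l * (x.1 : ZMod q) + X.μ * x.2)]
    · rw [if_neg hl, sum_comp_update _ (by simp [Ne.symm hl]) _ _
        (fun x : (ZMod q)ˣ × (ZMod q)ˣ => X.η l * (x.1 : ZMod q) + X.μ * x.2), hs, sub_eq_add_neg]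

/-- Inverse exchange: the tuple row returns to the vacated position. The departing member's stored
row equals its long-term key, so the factors cancel. -/
theorem keyLeave_eq_session (v : Fin users) (J : Fin n) (hJ : seats J = some v) :
    keyLeave (X.sys B) γ (X.session B keys γ seats) J (X.row B (keys v)) =
      X.session B keys γ (Function.update seats J none) := by
  have hs : X.seat keys γ seats J = keys v := by simp [seat, hJ]
  unfold keyLeave session
  simp only [seat_update_none, dec, sys, row, ← B.exp_neg, ← B.exp_add]
  congr 1
  · funext j
    by_cases hj : j = J
    · subst hj
      simp
    · simp only [hj, if_false]
      rw [Function.update_of_ne hj, Option.map_map]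
      refine congrArg (fun f => Option.map f (seats j)) (funext fun w => ?_)
      simp only [Function.comp_apply, ← B.exp_add]
      rw [sum_comp_update Finset.univ (Finset.mem_univ _) _ _
        (fun x : (ZMod q)ˣ × (ZMod q)ˣ => X.η j * (x.1 : ZMod q) + X.μ * x.2), hs]
      congr 2
      ring
  · rw [sum_comp_update Finset.univ (Finset.mem_univ _) _ _
      (fun x : (ZMod q)ˣ × (ZMod q)ˣ => (x.1 : ZMod q)), hs]
    congr 1
    ring
  · rw [sum_comp_update Finset.univ (Finset.mem_univ _) _ _
      (fun x : (ZMod q)ˣ × (ZMod q)ˣ => (x.2 : ZMod q)), hs]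
    congr 1
    ring
  · funext l
    by_cases hl : l = J
    · subst hl
      rw [if_pos rfl, sum_comp_update_of_notMem _ (by simp) _ _
        (fun x : (ZMod q)ˣ × (ZMod q)ˣ => X.η l * (x.1 : ZMod q) + X.μ * x.2)]
    · rw [if_neg hl, sum_comp_update _ (by simp [Ne.symm hl]) _ _
        (fun x : (ZMod q)ˣ × (ZMod q)ˣ => X.η l * (x.1 : ZMod q) + X.μ * x.2), hs, sub_eq_add_neg]

/-- Both sides have the exponent Σ_j (η_i a_j + μ b_j). Honest sessions are therefore always
accepted, and the acceptance test disappears from the symbolic game. -/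
theorem session_accepted : (X.session B keys γ seats).Accepted B (X.sys B) := by
  intro i m hm
  obtain ⟨v, -, rfl⟩ := Option.map_eq_some_iff.1 hm
  simp only [session, sys]
  conv_lhs => rw [← B.exp_one]
  simp only [B.e_exp, ← B.expT_add, dec, Finset.sum_add_distrib, Finset.mul_sum, mul_one]

-- In the exponent every position contributes independently: its current row, plus the tuple row if
-- its member is excluded. Header and session key use the same rule with the two components of the
-- rows.
open Classical in
theorem encrypt_session (R : Finset (Fin users)) (ρ : (ZMod q)ˣ) :
    encrypt B (X.sys B) γ (X.session B keys γ seats) R ρ =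
      (B.exp ρ, B.exp ((∑ j, X.share keys γ seats R Prod.fst j) * ρ),
        B.expT (X.μ * ρ * ∑ j, X.share keys γ seats R Prod.snd j)) := by
  have hex : ∀ i, (∃ m, (X.session B keys γ seats).members i = some m ∧ m.user ∉ R) ↔
      ∃ v, seats i = some v ∧ v ∉ R := by
    intro i
    simp only [session, Option.map_eq_some_iff]
    constructor
    · rintro ⟨m, ⟨v, hv, rfl⟩, h⟩
      exact ⟨v, hv, h⟩
    · rintro ⟨v, hv, h⟩
      exact ⟨_, ⟨v, hv, rfl⟩, h⟩
  unfold encrypt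
  simp only [hex]
  have hocc : ∀ i, ((X.session B keys γ seats).members i).isSome = (seats i).isSome := by
    intro i
    simp [session]
  simp only [hocc]
  refine Prod.ext rfl (Prod.ext ?_ ?_)
  · simp only [session, sys, row]
    rw [← B.exp_sum, ← B.exp_add, B.gexp_exp, Finset.sum_filter, ← Finset.sum_add_distrib]
    congr 2
    refine Finset.sum_congr rfl fun j _ => ?_
    cases hj : seats j with
    | none => simp [seat, share, hj]
    | some v => by_cases hv : v ∈ R <;> simp [seat, share, hj, hv]
  · have hcompl : (Finset.univ.filter fun i => (seats i).isSome = true)ᶜ =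
        Finset.univ.filter fun i => ¬ (seats i).isSome = true := by
      ext i; simp
    simp only [hcompl, Finset.prod_filter, ← Finset.prod_mul_distrib]
    rw [show (X.sys B).u = B.exp X.μ from rfl, B.gexp_exp, ← B.e_exp, B.exp_sum]
    congr 1
    refine Finset.prod_congr rfl fun j _ => ?_
    cases hj : seats j with
    | none => simp [share, hj, sys, row]
    | some v =>
      by_cases hv : v ∈ R <;> simp [session, share, hj, hv, sys, row, B.exp_add]

end Exponents

end Canonical

/-! ### Replacing the challenger by its symbolic form -/

section Link

variable {q : ℕ} [Fact q.Prime] {G GT : Type} [CommGroup G] [CommGroup GT]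
variable {users n tuples : ℕ}

/-- The challenger's state with the given symbolic part and exponents. -/
def SymState.realize (st : SymState users n tuples) (X : Exponents q n tuples)
    (B : BilinearGroups q G GT) (keys : Fin users → (ZMod q)ˣ × (ZMod q)ˣ) :
    ChallengerState users n tuples G where
  keys v := (st.pos v).map fun i => (i, X.row B (keys v))
  groups := st.groups.map fun gr => ⟨gr.1, gr.2.map (X.session B keys gr.1)⟩
  tested := st.tested

theorem Exponents.session_congr (X : Exponents q n tuples) (B : BilinearGroups q G GT)
    {keys keys' : Fin users → (ZMod q)ˣ × (ZMod q)ˣ} {γ : Fin tuples}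
    {seats : Fin n → Option (Fin users)}
    (h : ∀ j v, seats j = some v → keys v = keys' v) :
    X.session B keys γ seats = X.session B keys' γ seats := by
  have hs : X.seat keys γ seats = X.seat keys' γ seats := by
    funext j
    cases hj : seats j with
    | none => simp [seat, hj]
    | some v => simp [seat, hj, h j v hj]
  unfold session dec
  rw [hs]
  congr 1
  funext i
  cases hi : seats i with
  | none => rfl
  | some v => simp [h i v hi]

/-- Registration may overwrite the placeholder exponents of `v` without disturbing existing
sessions, because an unregistered user is seated in none of them. -/
theorem SymState.realize_newKey {st : SymState users n tuples} (hst : st.Seated)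
    (X : Exponents q n tuples) (B : BilinearGroups q G GT)
    (keys : Fin users → (ZMod q)ˣ × (ZMod q)ˣ) {v : Fin users} (hv : st.pos v = none)
    (i : Fin n) (x : (ZMod q)ˣ × (ZMod q)ˣ) :
    SymState.realize { st with pos := Function.update st.pos v (some i) } X B
        (Function.update keys v x) =
      { st.realize X B keys with
        keys := Function.update (st.realize X B keys).keys v (some (i, X.row B x)) } := by
  unfold SymState.realize
  congr 1
  · funext w
    by_cases hw : w = v
    · subst hw; simp
    · simp [hw]
  · refine List.map_congr_left fun gr hgr => ?_
    congr 1
    refine List.map_congr_left fun seats hs => X.session_congr B fun j w hw => ?_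
    have := hst gr hgr seats hs j w hw
    have hne : w ≠ v := by rintro rfl; simp [hv] at this
    simp [hne]

theorem SymState.realize_addSession (st : SymState users n tuples) (X : Exponents q n tuples)
    (B : BilinearGroups q G GT) (keys : Fin users → (ZMod q)ˣ × (ZMod q)ˣ) (π : ℕ)
    {gr : Fin tuples × List (Fin n → Option (Fin users))} (hgr : st.groups[π]? = some gr)
    (seats : Fin n → Option (Fin users)) :
    (st.addSession π seats).realize X B keys =
      (st.realize X B keys).addSession π (X.session B keys gr.1 seats) := by
  unfold SymState.realize SymState.addSession ChallengerState.addSession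
  congr 1
  refine List.ext_getElem? fun l => ?_
  simp only [List.getElem?_map, List.getElem?_modify]
  by_cases hl : π = l
  · subst hl
    simp [hgr]
  · simp [hl]

/-- The factor of the challenge key in the game with challenge bit `b`. -/
noncomputable def keyMask (GT : Type) [CommGroup GT] [Fintype GT] (b : Bool) : PMF GT :=
  if b then PMF.uniformOfFintype GT else PMF.pure 1

theorem Exponents.session_hasMember (X : Exponents q n tuples) (B : BilinearGroups q G GT)
    (keys : Fin users → (ZMod q)ˣ × (ZMod q)ˣ) (γ : Fin tuples)
    (seats : Fin n → Option (Fin users)) (v : Fin users) :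
    (X.session B keys γ seats).HasMember v ↔ ∃ i, seats i = some v := by
  constructor
  · rintro ⟨i, m, hm, rfl⟩
    obtain ⟨w, hw, rfl⟩ := Option.map_eq_some_iff.1 hm
    exact ⟨i, hw⟩
  · rintro ⟨i, hi⟩
    exact ⟨i, _, Option.map_eq_some_iff.2 ⟨v, hi, rfl⟩, rfl⟩

theorem Exponents.session_info (X : Exponents q n tuples) (B : BilinearGroups q G GT)
    (keys : Fin users → (ZMod q)ˣ × (ZMod q)ˣ) (π ℓ : ℕ) (γ : Fin tuples)
    (seats : Fin n → Option (Fin users)) :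
    (X.session B keys γ seats).info π ℓ = X.info B keys π ℓ γ seats := by
  simp only [Session.info, session, info, Option.map_map]
  congr 1
  funext i
  cases seats i <;> rfl

theorem SymState.realize_canExecute (st : SymState users n tuples) (X : Exponents q n tuples)
    (B : BilinearGroups q G GT) (keys : Fin users → (ZMod q)ˣ × (ZMod q)ˣ) (N : ℕ)
    (U : Finset (Fin users)) (i : Fin n) (seats : Fin n → Option (Fin users)) :
    (st.realize X B keys).CanExecute N U i seats ↔
      st.groups.length < N ∧ (seats i).isSome ∧
        ∀ j v, seats j = some v → st.pos v = some j ∧ v ∉ U := by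
  have hk : ∀ v j, ((st.realize X B keys).keyAt v j).isSome ↔ st.pos v = some j := by
    intro v j
    simp only [ChallengerState.keyAt, SymState.realize]
    cases st.pos v with
    | none => simp
    | some l => by_cases hl : l = j <;> simp [hl]
  simp only [ChallengerState.CanExecute, hk]
  simp [SymState.realize]

-- The challenge bit enters only through the law of a factor `ζ` of the session key: the constant 1
-- gives the true key and a uniform `ζ` gives a uniform key. Other answers ignore `ζ`.
open Classical in
theorem respond_realize [Fintype GT] (B : BilinearGroups q G GT) (N L : ℕ)
    (X : Exponents q n tuples) (b : Bool) (U : Finset (Fin users)) (st : SymState users n tuples)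
    (hst : st.Seated) (keys : Fin users → (ZMod q)ˣ × (ZMod q)ˣ) (x : Query users n tuples) :
    respond B N L (X.sys B) b U (st.realize X B keys) x =
      (keyMask GT b).bind fun ζ => (X.respond B ζ keys (st.plan N L U x).1).bind fun y =>
        PMF.pure (y.1, (st.plan N L U x).2.realize X B y.2) := by
  cases x with
  | register γ v i =>
    cases hv : st.pos v with
    | some i' => simp [respond, SymState.plan, SymState.realize, hv, Exponents.respond]; rfl
    | none =>
      simp only [SymState.plan, hv, Exponents.respond, PMF.bind_bind, PMF.pure_bind,
        PMF.bind_const, SymState.realize_newKey hst X B keys hv]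
      simp only [respond, keyRegis, Exponents.sys, mkRow_eq_row]
      simp [SymState.realize, hv]
      rfl
  | extract v =>
    cases hv : st.pos v with
    | some i =>
      by_cases hU : v ∈ U <;>
        simp [respond, SymState.plan, SymState.realize, hv, Exponents.respond, hU] <;> rfl
    | none => simp [respond, SymState.plan, SymState.realize, hv, Exponents.respond]; rfl
  | execute γ i seats =>
    simp only [SymState.plan, respond, ← st.realize_canExecute X B keys]
    by_cases hc : (st.realize X B keys).CanExecute N U i seats
    · have hseats : (fun j => (seats j).bind fun v =>
          ((st.realize X B keys).keyAt v j).map fun r => (v, r)) =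
          fun j => (seats j).map fun v => (v, X.row B (keys v)) := by
        funext j
        cases hj : seats j with
        | none => rfl
        | some v =>
          have := (((st.realize_canExecute X B keys N U i seats).1 hc).2.2 j v hj).1
          simp [ChallengerState.keyAt, SymState.realize, this]
      rw [hseats, X.keyDerive_eq_session]
      obtain ⟨v, hv⟩ := Option.isSome_iff_exists.1 hc.2.1
      simp only [hc, X.session_accepted, and_self, if_true, Exponents.respond, PMF.pure_bind,
        PMF.bind_const]
      have hm : (X.session B keys γ seats).members i =
          some ⟨v, X.row B (keys v), B.exp (X.dec keys γ seats i)⟩ := by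
        simp [Exponents.session, hv]
      rw [hm]
      simp [SymState.realize, X.session_info]
      rfl
    · simp only [hc, false_and, if_false, Exponents.respond, PMF.pure_bind, PMF.bind_const]
      split <;> rfl
  | join v π =>
    simp only [SymState.plan, respond]
    cases hgr : st.groups[π]? with
    | none => simp [SymState.realize, hgr, Exponents.respond]; rfl
    | some gr =>
      cases hv : st.pos v with
      | none => simp [SymState.realize, hgr, hv, Exponents.respond]; rfl
      | some I =>
        have h1 : (st.realize X B keys).groups[π]? =
            some ⟨gr.1, gr.2.map (X.session B keys gr.1)⟩ := by simp [SymState.realize, hgr]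
        have h2 : (st.realize X B keys).keys v = some (I, X.row B (keys v)) := by
          simp [SymState.realize, hv]
        simp only [h1, h2, List.getLast?_map, List.length_map]
        cases hl : gr.2.getLast? with
        | none => simp [Exponents.respond]; rfl
        | some seats =>
          simp only [Option.map_some]
          have h3 : (X.session B keys gr.1 seats).members I = none ↔ seats I = none := by
            simp [Exponents.session]
          simp only [h3]
          by_cases hI : seats I = none
          · simp only [X.keyJoin_eq_session B keys gr.1 seats v I hI, X.session_accepted, hI,
              true_and, and_true]
            by_cases hL : gr.2.length < L
            · simp only [hL, if_true, Exponents.respond, PMF.pure_bind, PMF.bind_const,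
                st.realize_addSession X B keys π hgr]
              rw [X.session_info]
              rfl
            · simp [hL, Exponents.respond]; rfl
          · simp [hI, Exponents.respond]; rfl
  | leave π J =>
    simp only [SymState.plan, respond]
    cases hgr : st.groups[π]? with
    | none => simp [SymState.realize, hgr, Exponents.respond]; rfl
    | some gr =>
      have h1 : (st.realize X B keys).groups[π]? =
          some ⟨gr.1, gr.2.map (X.session B keys gr.1)⟩ := by simp [SymState.realize, hgr]
      simp only [h1, List.getLast?_map, List.length_map]
      cases hl : gr.2.getLast? with
      | none => simp [Exponents.respond]; rfl
      | some seats =>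
        simp only [Option.map_some]
        cases hJ : seats J with
        | none =>
          have h3 : (X.session B keys gr.1 seats).members J = none := by
            simp [Exponents.session, hJ]
          simp [h3, Exponents.respond]; rfl
        | some v =>
          have h3 : (X.session B keys gr.1 seats).members J =
              some ⟨v, X.row B (keys v), B.exp (X.dec keys gr.1 seats J)⟩ := by
            simp [Exponents.session, hJ]
          simp only [h3, X.keyLeave_eq_session B keys gr.1 seats v J hJ, X.session_accepted,
            and_true, Option.isSome_some, true_and]
          by_cases hL : gr.2.length < L
          · simp only [hL, if_true, Exponents.respond, PMF.pure_bind, PMF.bind_const,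
              st.realize_addSession X B keys π hgr]
            rw [X.session_info]
            rfl
          · simp [hL, Exponents.respond]; rfl
  | reveal v π ℓ =>
    simp only [SymState.plan, respond]
    cases hgr : st.groups[π]? with
    | none => simp [SymState.realize, hgr, Exponents.respond]; rfl
    | some gr =>
      cases hv : st.pos v with
      | none => simp [SymState.realize, hgr, hv, Exponents.respond]; rfl
      | some i =>
        have h1 : (st.realize X B keys).groups[π]? =
            some ⟨gr.1, gr.2.map (X.session B keys gr.1)⟩ := by simp [SymState.realize, hgr]
        have h2 : (st.realize X B keys).keys v = some (i, X.row B (keys v)) := by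
          simp [SymState.realize, hv]
        simp only [h1, h2, List.getElem?_map]
        cases hl : gr.2[ℓ]? with
        | none => simp [Exponents.respond]; rfl
        | some seats =>
          simp only [Option.map_some]
          cases hi : seats i with
          | none =>
            have h3 : (X.session B keys gr.1 seats).members i = none := by
              simp [Exponents.session, hi]
            simp [h3, Exponents.respond]; rfl
          | some w =>
            have h3 : (X.session B keys gr.1 seats).members i =
                some ⟨w, X.row B (keys w), B.exp (X.dec keys gr.1 seats i)⟩ := by
              simp [Exponents.session, hi]
            simp only [h3, Option.some.injEq]
            by_cases hc : w = v ∧ v ∉ U <;> simp [hc, Exponents.respond] <;> rfl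
  | test R π ℓ =>
    simp only [SymState.plan, respond]
    cases hgr : st.groups[π]? with
    | none => simp [SymState.realize, hgr, Exponents.respond]; rfl
    | some gr =>
      have h1 : (st.realize X B keys).groups[π]? =
          some ⟨gr.1, gr.2.map (X.session B keys gr.1)⟩ := by simp [SymState.realize, hgr]
      simp only [h1, List.getElem?_map]
      cases hl : gr.2[ℓ]? with
      | none => simp [Exponents.respond]; rfl
      | some seats =>
        simp only [Option.map_some, X.session_hasMember, X.encrypt_session]
        rw [show (st.realize X B keys).tested = st.tested from rfl]
        by_cases hc : st.tested = false ∧ R ⊆ U ∧ ∀ v ∈ R, ∃ i, seats i = some v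
        · rw [if_pos hc, if_pos hc]
          simp only [Exponents.respond, PMF.bind_bind, PMF.pure_bind]
          rw [PMF.bind_comm]
          refine congrArg (PMF.bind _) (funext fun ρ => ?_)
          cases b with
          | false =>
            simp only [keyMask, if_true, PMF.monad_bind_eq_bind, PMF.bind_const]
            simp
            rfl
          | true =>
            simp only [keyMask, if_true]
            -- The uniform key `k₁` is written as the true key times `ζ`; translation preserves the
            -- uniform law.
            rw [PMF.uniformOfFintype_bind_equiv (Equiv.mulLeft
              (B.expT (X.μ * ρ * ∑ j, X.share keys gr.1 seats R Prod.snd j))⁻¹)]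
            simp
            rfl
        · simp only [hc, if_false, Exponents.respond, PMF.pure_bind, PMF.bind_const]; rfl

/-- The query phase of the game, as a phase in terms of exponents with a masked challenge key. -/
theorem queryPhase_realize [Fintype GT] (B : BilinearGroups q G GT) (N L : ℕ)
    (A : Adversary users n tuples G GT) (X : Exponents q n tuples) (b : Bool)
    (U : Finset (Fin users)) (m : ℕ) (st : SymState users n tuples) (hst : st.Seated)
    (keys : Fin users → (ZMod q)ˣ × (ZMod q)ˣ) (s : A.σ) :
    (queryPhase B N L A (X.sys B) b U m (st.realize X B keys) s).map some =
      (keyMask GT b).bind fun ζ =>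
        symPhase B N L A X ζ U (fun _ _ => true) true m st keys s := by
  induction m generalizing st keys s with
  | zero => simp [queryPhase, symPhase]
  | succ m ih =>
    have hp : ∀ a : Act users n tuples, a.passes (fun _ _ => true) = true := fun a => by
      cases a <;> rfl
    simp only [queryPhase, symPhase, hp, if_true, PMF.monad_bind_eq_bind, PMF.map_bind,
      respond_realize B N L X b U st hst keys, PMF.bind_bind, PMF.pure_bind]
    rw [PMF.bind_comm (keyMask GT b)]
    refine congrArg _ (funext fun x => ?_)
    simp only [ih _ (hst.plan N L U x.1)]
    -- On the left this answer and the later phase use independent masks, on the right a shared one.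
    -- As there is at most one challenge, one of the two uses is vacuous: the later phase ignores
    -- its mask after a challenge, and any other answer ignores its own.
    by_cases hx : (st.plan N L U x.1).1.IsChallenge
    · obtain ⟨R, γ, seats, h⟩ := hx
      have ht := (SymState.plan_challenge h).2.2.2.1
      refine congrArg _ (funext fun ζ => congrArg _ (funext fun y =>
        congrArg _ (funext fun s' => ?_)))
      rw [show (fun ζ' => symPhase B N L A X ζ' U (fun _ _ => true) true m
        (st.plan N L U x.1).2 y.2 s') = fun _ => symPhase B N L A X ζ U (fun _ _ => true) true m
        (st.plan N L U x.1).2 y.2 s' from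
          funext fun ζ' => symPhase_of_tested _ _ _ _ _ _ _ _ _ _ _ _ _ _ ht _ _, PMF.bind_const]
    · simp only [X.respond_of_not_isChallenge B hx _ 1]
      rw [PMF.bind_const, PMF.bind_comm (keyMask GT b)]
      refine congrArg _ (funext fun y => ?_)
      rw [PMF.bind_comm (keyMask GT b)]

/-- The start of the game. -/
def SymState.init (users n tuples : ℕ) : SymState users n tuples := ⟨fun _ => none, [], false⟩

/-- The game in terms of exponents, with the key of the challenge multiplied by `ζ`. -/
noncomputable def symGame (B : BilinearGroups q G GT) (N L m : ℕ)
    (A : Adversary users n tuples G GT) (ζ : GT)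
    (chk : Finset (Fin users) → Finset (Fin users) → (Fin n → Option (Fin users)) → Bool)
    (fin : Bool) : PMF (Option Bool) :=
  (PMF.uniformOfFintype (ZMod q)).bind fun μ =>
    (PMF.uniformOfFintype (Fin n → ZMod q)).bind fun η =>
      (PMF.uniformOfFintype (Fin tuples × Fin n → (ZMod q)ˣ × (ZMod q)ˣ)).bind fun t =>
        (A.start (Exponents.sys ⟨μ, η, fun γ i => t (γ, i)⟩ B).pub).bind fun x =>
          symPhase B N L A ⟨μ, η, fun γ i => t (γ, i)⟩ ζ x.1 (chk x.1) fin m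
            (SymState.init users n tuples) (fun _ => (1, 1)) x.2

/-- The map x ↦ g^x is a bijection, so uniform group elements amount to uniform exponents; currying
and pairing arrange the tuple exponents as one function. -/
theorem globeSetup_bind [Fintype G] (B : BilinearGroups q G GT) {γ : Type}
    (f : SysParams n tuples G → PMF γ) :
    (globeSetup B n tuples).bind f =
      (PMF.uniformOfFintype (ZMod q)).bind fun μ =>
        (PMF.uniformOfFintype (Fin n → ZMod q)).bind fun η =>
          (PMF.uniformOfFintype (Fin tuples × Fin n → (ZMod q)ˣ × (ZMod q)ˣ)).bind fun t =>
            f (Exponents.sys ⟨μ, η, fun γ i => t (γ, i)⟩ B) := by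
  simp only [globeSetup, PMF.monad_bind_eq_bind, PMF.bind_bind, PMF.monad_pure_eq_pure,
    PMF.pure_bind]
  rw [PMF.uniformOfFintype_bind_equiv B.expEquiv]
  refine congrArg _ (funext fun μ => ?_)
  rw [PMF.uniformOfFintype_bind_equiv (Equiv.arrowCongr (Equiv.refl (Fin n)) B.expEquiv)]
  refine congrArg _ (funext fun η => ?_)
  have h1 : B.expEquiv μ = B.exp μ := rfl
  have h2 : (Equiv.arrowCongr (Equiv.refl (Fin n)) B.expEquiv) η = fun j => B.exp (η j) := rfl
  have h3 : ∀ a b : (ZMod q)ˣ, mkRow B (B.exp μ) (fun j => B.exp (η j)) a b =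
      Exponents.row (tuples := tuples) ⟨μ, η, fun _ _ => (1, 1)⟩ B (a, b) :=
    fun a b => mkRow_eq_row (tuples := tuples) ⟨μ, η, fun _ _ => (1, 1)⟩ B a b
  simp only [h1, h2, h3]
  rw [← PMF.uniformOfFintype_prod_bind (fun x : (Fin tuples → Fin n → (ZMod q)ˣ) ×
      (Fin tuples → Fin n → (ZMod q)ˣ) => f ⟨B.exp μ, fun j => B.exp (η j), fun γ i =>
        Exponents.row (tuples := tuples) ⟨μ, η, fun _ _ => (1, 1)⟩ B (x.1 γ i, x.2 γ i)⟩),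
    PMF.uniformOfFintype_bind_equiv ((Equiv.arrowProdEquivProdArrow (Fin tuples × Fin n)
      (fun _ => (ZMod q)ˣ) (fun _ => (ZMod q)ˣ)).trans
        (Equiv.prodCongr (Equiv.curry _ _ _) (Equiv.curry _ _ _)))]
  rfl

theorem game_map_some [Fintype G] [Fintype GT] (B : BilinearGroups q G GT) (N L m : ℕ)
    (A : Adversary users n tuples G GT) (b : Bool) :
    (game B N L m A b).map some =
      (keyMask GT b).bind fun ζ => symGame B N L m A ζ (fun _ _ _ => true) true := by
  -- Nobody is registered yet, so the exponents `(1, 1)` of the long-term keys are placeholders.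
  have hinit : ∀ X : Exponents q n tuples, (⟨fun _ => none, [], false⟩ :
      ChallengerState users n tuples G) =
      (SymState.init users n tuples).realize X B (fun _ => (1, 1)) := fun X => rfl
  simp only [game, PMF.monad_bind_eq_bind, globeSetup_bind, PMF.map_bind, symGame]
  rw [PMF.bind_comm (keyMask GT b)]
  refine congrArg _ (funext fun μ => ?_)
  rw [PMF.bind_comm (keyMask GT b)]
  refine congrArg _ (funext fun η => ?_)
  rw [PMF.bind_comm (keyMask GT b)]
  refine congrArg _ (funext fun t => ?_)
  rw [PMF.bind_comm (keyMask GT b)]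
  refine congrArg _ (funext fun x => ?_)
  rw [hinit ⟨μ, η, fun γ i => t (γ, i)⟩]
  refine queryPhase_realize B N L A _ b x.1 m _ ?_ _ _
  intro gr hgr
  simp [SymState.init] at hgr

end Link

/-! ### Straight-line programs for products of powers -/

section Halting

variable {users n tuples : ℕ}

theorem Program.HaltsWithin.mono {p : Program users n tuples} {t t' : ℕ} (h : p.HaltsWithin t)
    (htt' : t ≤ t') : p.HaltsWithin t' := by
  induction p generalizing t t' with
  | output b => cases t' <;> trivial
  | _ =>
    rename_i ih
    cases t with
    | zero => exact h.elim
    | succ t =>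
      obtain ⟨t', rfl⟩ : ∃ u, t' = u + 1 := ⟨t' - 1, by omega⟩
      first
        | exact ih h (by omega)
        | exact fun b => ih b (h b) (by omega)

end Halting

section Registers

variable {q : ℕ} {G GT : Type} (R : Registers q G GT)

theorem Registers.setX_x (d a : ℕ) (v : G) : (R.setX d v).x a = if a = d then v else R.x a :=
  Function.update_apply _ _ _ _

theorem Registers.setY_y (d a : ℕ) (v : GT) : (R.setY d v).y a = if a = d then v else R.y a :=
  Function.update_apply _ _ _ _

theorem Registers.setS_s (d a : ℕ) (v : ZMod q) : (R.setS d v).s a = if a = d then v else R.s a :=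
  Function.update_apply _ _ _ _

end Registers

/-- Addresses of registers beyond the input registers, by a kind `t` and two indices. -/
def adr (k t i j : ℕ) : ℕ := 2 * k + 2 + Nat.pair t (Nat.pair i j)

theorem adr_inj {k t i j t' i' j' : ℕ} :
    adr k t i j = adr k t' i' j' ↔ t = t' ∧ i = i' ∧ j = j' := by
  simp [adr, Nat.pair_eq_pair]

/-- The kind of a register; input registers have kind `0`. -/
def kind (k a : ℕ) : ℕ := if a < 2 * k + 2 then 0 else (Nat.unpair (a - (2 * k + 2))).1 + 1

theorem kind_adr (k t i j : ℕ) : kind k (adr k t i j) = t + 1 := by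
  simp [kind, adr]

theorem kind_of_lt {k a : ℕ} (h : a < 2 * k + 2) : kind k a = 0 := by
  simp [kind, h]

/-- The register for intermediate results. -/
abbrev tmpReg (k : ℕ) : ℕ := adr k 20 0 0

/-- A factor of a product: a register, raised to the power in a scalar register if there is one, and
inverted if `neg` is set. -/
structure Letter where
  reg : ℕ
  exp : Option ℕ
  neg : Bool

section Words

variable {q : ℕ} {G GT : Type} [CommGroup G] [CommGroup GT] {users n tuples : ℕ}

/-- The value of a factor. -/
def Letter.val (R : Registers q G GT) (l : Letter) : G :=
  let x := match l.exp with
    | none => R.x l.reg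
    | some c => gexp (R.x l.reg) (R.s c)
  if l.neg then x⁻¹ else x

/-- The value of a product. -/
def wordVal (R : Registers q G GT) (w : List Letter) : G := (w.map (Letter.val R)).prod

/-- Multiply register `d` by a factor. -/
def Letter.comp (k d : ℕ) (p : Program users n tuples) : Letter → Program users n tuples
  | ⟨a, none, false⟩ => .mul d d a p
  | ⟨a, none, true⟩ => .inv (tmpReg k) a (.mul d d (tmpReg k) p)
  | ⟨a, some c, false⟩ => .pow (tmpReg k) a c (.mul d d (tmpReg k) p)
  | ⟨a, some c, true⟩ => .pow (tmpReg k) a c (.inv (tmpReg k) (tmpReg k) (.mul d d (tmpReg k) p))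

def compLetters (k d : ℕ) (p : Program users n tuples) : List Letter → Program users n tuples
  | [] => p
  | l :: w => l.comp k d (compLetters k d p w)

/-- Compute a product into register `d`. The register `k + 1` holds `1`. -/
def compWord (k d : ℕ) (w : List Letter) (p : Program users n tuples) : Program users n tuples :=
  .mul d (k + 1) (k + 1) (compLetters k d p w)

/-- Compute several products into the given registers. -/
def compMany (k : ℕ) :
    List (ℕ × List Letter) → Program users n tuples → Program users n tuples
  | [], p => p
  | dw :: l, p => compWord k dw.1 dw.2 (compMany k l p)

/-- A factor costs at most three instructions: power, inversion, multiplication. -/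
theorem compLetters_halts {k d t : ℕ} {p : Program users n tuples} (hp : p.HaltsWithin t)
    (w : List Letter) : (compLetters k d p w).HaltsWithin (t + 3 * w.length) := by
  induction w with
  | nil => exact hp
  | cons l w ih =>
    have h : t + 3 * (l :: w).length = t + 3 * w.length + 1 + 1 + 1 := by simp; ring
    rw [h]
    rcases l with ⟨a, _ | c, _ | _⟩
    · exact ih.mono (by omega)
    · exact ih.mono (by omega)
    · exact ih.mono (by omega)
    · exact ih

theorem compMany_halts {k t c : ℕ} {p : Program users n tuples} (hp : p.HaltsWithin t)
    (l : List (ℕ × List Letter)) (hl : ∀ dw ∈ l, dw.2.length ≤ c) :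
    (compMany k l p).HaltsWithin (t + l.length * (3 * c + 1)) := by
  induction l with
  | nil => simpa [compMany] using hp
  | cons dw l ih =>
    have h1 := compLetters_halts (k := k) (d := dw.1)
      (ih fun dw hdw => hl dw (List.mem_cons_of_mem _ hdw)) dw.2
    have h2 := hl dw List.mem_cons_self
    have h3 : (compMany k (dw :: l) p).HaltsWithin
        (t + l.length * (3 * c + 1) + 3 * dw.2.length + 1) := h1
    refine h3.mono ?_
    have h4 : (l.length + 1) * (3 * c + 1) = l.length * (3 * c + 1) + (3 * c + 1) := by ring
    rw [List.length_cons, h4]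
    omega

variable [Fact q.Prime]

/-- The final content of the scratch register is left existential, since no later computation reads
it before overwriting it. -/
theorem Letter.run_comp (B : BilinearGroups q G GT) (A : Adversary users n tuples G GT) (k d : ℕ)
    (hd : d ≠ tmpReg k) (p : Program users n tuples) (l : Letter) (hl : l.reg ≠ tmpReg k)
    (R : Registers q G GT) (s : Option A.σ) :
    ∃ c, (l.comp k d p).run B A R s =
      p.run B A ((R.setX (tmpReg k) c).setX d (R.x d * l.val R)) s := by
  rcases l with ⟨a, _ | e, _ | _⟩
  · refine ⟨R.x (tmpReg k), ?_⟩
    have : R.setX (tmpReg k) (R.x (tmpReg k)) = R := by simp [Registers.setX]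
    rw [this]
    rfl
  on_goal 1 => refine ⟨(R.x a)⁻¹, ?_⟩
  on_goal 2 => refine ⟨gexp (R.x a) (R.s e), ?_⟩
  on_goal 3 => refine ⟨(gexp (R.x a) (R.s e))⁻¹, ?_⟩
  all_goals
    simp only [Letter.comp, Program.run, Registers.setX_x, hd, if_true, if_false]
    simp only [Registers.setX, Function.update_idem]
    rfl

/-- The letters read neither the target nor the scratch register, so the whole word may be evaluated
in the initial registers. -/
theorem run_compLetters (B : BilinearGroups q G GT) (A : Adversary users n tuples G GT) (k d : ℕ)
    (hd : d ≠ tmpReg k) (p : Program users n tuples) (w : List Letter)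
    (hw : ∀ l ∈ w, l.reg ≠ tmpReg k ∧ l.reg ≠ d) (R : Registers q G GT) (s : Option A.σ) :
    ∃ c, (compLetters k d p w).run B A R s =
      p.run B A ((R.setX (tmpReg k) c).setX d (R.x d * wordVal R w)) s := by
  induction w generalizing R with
  | nil =>
    refine ⟨R.x (tmpReg k), ?_⟩
    simp [Registers.setX, compLetters, wordVal]
  | cons l w ih =>
    have hl := hw l List.mem_cons_self
    obtain ⟨c, hc⟩ := Letter.run_comp B A k d hd (compLetters k d p w) l hl.1 R s
    obtain ⟨c', hc'⟩ := ih (fun l' h' => hw l' (List.mem_cons_of_mem _ h'))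
      ((R.setX (tmpReg k) c).setX d (R.x d * l.val R))
    refine ⟨c', ?_⟩
    have hval : wordVal ((R.setX (tmpReg k) c).setX d (R.x d * l.val R)) w = wordVal R w := by
      unfold wordVal
      refine congrArg _ (List.map_congr_left fun l' h' => ?_)
      have h := hw l' (List.mem_cons_of_mem _ h')
      simp only [Letter.val, Registers.setX_x, h.1, h.2, if_false]
      rfl
    rw [compLetters, hc, hc', hval]
    congr 1
    simp only [Registers.setX, Function.update_self]
    congr 1
    funext a
    by_cases ha : a = d
    · subst ha
      simp [wordVal, mul_assoc]
    · simp only [Function.update_apply, ha, if_false]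
      split_ifs <;> rfl

theorem run_compWord (B : BilinearGroups q G GT) (A : Adversary users n tuples G GT) (k d : ℕ)
    (hd : d ≠ tmpReg k) (p : Program users n tuples) (w : List Letter)
    (hw : ∀ l ∈ w, l.reg ≠ tmpReg k ∧ l.reg ≠ d) (R : Registers q G GT) (hR : R.x (k + 1) = 1)
    (s : Option A.σ) :
    ∃ c, (compWord k d w p).run B A R s =
      p.run B A ((R.setX (tmpReg k) c).setX d (wordVal R w)) s := by
  obtain ⟨c, hc⟩ := run_compLetters B A k d hd p w hw (R.setX d (R.x (k + 1) * R.x (k + 1))) s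
  refine ⟨c, ?_⟩
  have hval : wordVal (R.setX d (R.x (k + 1) * R.x (k + 1))) w = wordVal R w := by
    unfold wordVal
    refine congrArg _ (List.map_congr_left fun l' h' => ?_)
    simp only [Letter.val, Registers.setX_x, (hw l' h').2, if_false]
    rfl
  rw [compWord, Program.run, hc, hval]
  congr 1
  simp only [Registers.setX, Function.update_self, hR, one_mul]
  congr 1
  rw [Function.update_comm hd, Function.update_idem]

/-- The threshold `T` separates sources from targets: letters read kinds below `T`, targets have
kind at least `T`, and the scratch register has kind 21. Hence no product disturbs another, and all
of them evaluate in the initial registers. -/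
theorem run_compMany (B : BilinearGroups q G GT) (A : Adversary users n tuples G GT) (k T : ℕ)
    (hT : 1 ≤ T) (hT' : T ≤ 21) (p : Program users n tuples) (L : List (ℕ × List Letter))
    (hL : (L.map Prod.fst).Nodup) (hd : ∀ dw ∈ L, T ≤ kind k dw.1 ∧ dw.1 ≠ tmpReg k)
    (hw : ∀ dw ∈ L, ∀ l ∈ dw.2, kind k l.reg < T) (R : Registers q G GT)
    (hR : R.x (k + 1) = 1) (s : Option A.σ) :
    ∃ x, (compMany k L p).run B A R s = p.run B A { R with x := x } s ∧
      (∀ a, a ≠ tmpReg k → a ∉ L.map Prod.fst → x a = R.x a) ∧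
      ∀ dw ∈ L, x dw.1 = wordVal R dw.2 := by
  induction L generalizing R with
  | nil => exact ⟨R.x, rfl, fun _ _ _ => rfl, by simp⟩
  | cons dw L ih =>
    have hdw := hd dw List.mem_cons_self
    have hreg : ∀ a, kind k a < T → a ≠ tmpReg k ∧ a ≠ dw.1 := by
      intro a ha
      constructor
      · rintro rfl
        rw [kind_adr] at ha
        omega
      · rintro rfl
        omega
    obtain ⟨c, hc⟩ := run_compWord B A k dw.1 hdw.2 (compMany k L p) dw.2
      (fun l hl => hreg _ (hw dw List.mem_cons_self l hl)) R hR s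
    have hone := hreg (k + 1) (by rw [kind_of_lt (by omega)]; omega)
    rw [List.map_cons, List.nodup_cons] at hL
    obtain ⟨x, h1, h2, h3⟩ := ih hL.2 (fun dw h => hd dw (List.mem_cons_of_mem _ h))
      (fun dw h => hw dw (List.mem_cons_of_mem _ h))
      ((R.setX (tmpReg k) c).setX dw.1 (wordVal R dw.2))
      (by simp only [Registers.setX_x, hone.1, hone.2, if_false, hR])
    refine ⟨x, by rw [compMany, hc, h1]; rfl, ?_, ?_⟩
    · intro a ha ha'
      rw [List.map_cons, List.mem_cons, not_or] at ha'
      rw [h2 a ha ha'.2]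
      simp only [Registers.setX_x, ha, ha'.1, if_false]
    · intro dw' hdw'
      rcases List.mem_cons.1 hdw' with rfl | h
      · rw [h2 _ hdw.2 hL.1]
        simp [Registers.setX_x]
      · rw [h3 dw' h]
        unfold wordVal
        refine congrArg _ (List.map_congr_left fun l hl => ?_)
        have := hreg _ (hw dw' hdw' l hl)
        simp only [Letter.val, Registers.setX_x, this.1, this.2, if_false]
        rfl

/-- The product of the words `f i` over all positions `i`. -/
def overPositions (n : ℕ) (f : Fin n → List Letter) : List Letter := (List.finRange n).flatMap f

theorem mem_overPositions {f : Fin n → List Letter} {l : Letter} :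
    l ∈ overPositions n f ↔ ∃ i, l ∈ f i := by
  simp [overPositions]

theorem length_overPositions {c : ℕ} (f : Fin n → List Letter) (hf : ∀ i, (f i).length ≤ c) :
    (overPositions n f).length ≤ n * c := by
  unfold overPositions
  rw [List.length_flatMap]
  calc _ ≤ ((List.finRange n).map fun _ => c).sum := List.sum_le_sum fun i _ => hf i
    _ = n * c := by simp

/-- The word evaluates to `g ^ x`. -/
def Evals (B : BilinearGroups q G GT) (R : Registers q G GT) (w : List Letter) (x : ZMod q) :
    Prop := wordVal R w = B.exp x

variable {B : BilinearGroups q G GT} {R : Registers q G GT}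

theorem Evals.nil : Evals B R [] 0 := by
  simp [Evals, wordVal, B.exp_zero]

theorem Evals.append {w w' : List Letter} {x y : ZMod q} (h : Evals B R w x)
    (h' : Evals B R w' y) : Evals B R (w ++ w') (x + y) := by
  unfold Evals wordVal at *
  rw [List.map_append, List.prod_append, h, h', B.exp_add]

theorem Evals.congr {w : List Letter} {x y : ZMod q} (h : Evals B R w x) (hxy : x = y) :
    Evals B R w y := hxy ▸ h

theorem Evals.reg {a : ℕ} {x : ZMod q} (h : R.x a = B.exp x) :
    Evals B R [⟨a, none, false⟩] x := by
  simp [Evals, wordVal, Letter.val, h]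

theorem Evals.inv {a : ℕ} {x : ZMod q} (h : R.x a = B.exp x) :
    Evals B R [⟨a, none, true⟩] (-x) := by
  simp [Evals, wordVal, Letter.val, h, B.exp_neg]

theorem Evals.pow {a c : ℕ} {x : ZMod q} (h : R.x a = B.exp x) :
    Evals B R [⟨a, some c, false⟩] (x * R.s c) := by
  simp [Evals, wordVal, Letter.val, h, B.gexp_exp]

theorem Evals.powInv {a c : ℕ} {x : ZMod q} (h : R.x a = B.exp x) :
    Evals B R [⟨a, some c, true⟩] (-(x * R.s c)) := by
  simp [Evals, wordVal, Letter.val, h, B.gexp_exp, B.exp_neg]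

theorem Evals.overPositions {f : Fin n → List Letter} {x : Fin n → ZMod q}
    (h : ∀ i, Evals B R (f i) (x i)) : Evals B R (overPositions n f) (∑ i, x i) := by
  have key : ∀ l : List (Fin n), Evals B R (l.flatMap f) (l.map x).sum := by
    intro l
    induction l with
    | nil => simpa using Evals.nil
    | cons i l ih => simpa using (h i).append ih
  have := key (List.finRange n)
  rwa [← List.ofFn_eq_map, List.sum_ofFn] at this

end Words

/-! ### Generating rows from a `k`-BDHE instance -/

section Layout

variable (k : ℕ)

/-- The register of `u`. -/
abbrev uReg : ℕ := adr k 0 0 0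
/-- The register of `h j`. -/
abbrev hReg (j : ℕ) : ℕ := adr k 1 j 0
/-- The register of the component `A` of the row with number `id`. -/
abbrev aReg (id : ℕ) : ℕ := adr k 2 id 0
/-- The register of the component `B` of the row with number `id`. -/
abbrev bReg (id : ℕ) : ℕ := adr k 3 id 0
/-- The register of the component `K j` of the row with number `id`. -/
abbrev kReg (id j : ℕ) : ℕ := adr k 4 id j
/-- Registers for results. -/
abbrev resReg (c : ℕ) : ℕ := adr k (5 + c) 0 0
/-- The scalar register of the additive mask of `u`. -/
abbrev uMask : ℕ := adr k 0 0 0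
/-- The scalar register of the additive mask of `h j`. -/
abbrev hMask (j : ℕ) : ℕ := adr k 1 j 0
/-- The scalar register of the first exponent of the row with number `id`, up to its shift. -/
abbrev aMask (id : ℕ) : ℕ := adr k 2 id 0
/-- The scalar register of the second exponent of the row with number `id`, up to its shift. -/
abbrev bMask (id : ℕ) : ℕ := adr k 3 id 0
/-- The scalar register of the encryption exponent. -/
abbrev rhoReg : ℕ := adr k 4 0 0

end Layout

/-! ### Register invariants and what leaves them intact -/

section Invariants

variable {q : ℕ} [Fact q.Prime] {G GT : Type} [CommGroup G] [CommGroup GT] {n : ℕ}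

/-- The registers hold the `k`-BDHE instance with exponents `θ` and `h` and last component `Z`. -/
structure Loaded (B : BilinearGroups q G GT) (k : ℕ) (θ h : ZMod q) (Z : GT)
    (R : Registers q G GT) : Prop where
  power : ∀ i, i ≤ 2 * k → i ≠ k + 1 → R.x i = B.exp (θ ^ i)
  one : R.x (k + 1) = 1
  Q : R.x (2 * k + 1) = B.exp h
  Z : R.y 0 = Z

/-- The registers hold `u` and the `h j`, masked by `r` and the `y j`. -/
structure Masked (B : BilinearGroups q G GT) (k : ℕ) (θ r : ZMod q) (y : Fin n → ZMod q)
    (R : Registers q G GT) : Prop where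
  u : R.x (uReg k) = B.exp (r + θ)
  r : R.s (uMask k) = r
  h : ∀ j : Fin n, R.x (hReg k j) = B.exp (y j + θ ^ (j : ℕ))
  y : ∀ j : Fin n, R.s (hMask k j) = y j

/-- The registers hold the row with number `id` and exponents `a` and `b`, except possibly the
components `K j` for which `J j` is false. -/
structure HasRow (B : BilinearGroups q G GT) (k : ℕ) (μ : ZMod q) (η : Fin n → ZMod q)
    (R : Registers q G GT) (id : ℕ) (J : Fin n → Prop) (a b : ZMod q) : Prop where
  fst : R.x (aReg k id) = B.exp a
  snd : R.x (bReg k id) = B.exp b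
  K : ∀ j : Fin n, J j → R.x (kReg k id j) = B.exp (η j * a + μ * b)

/-- `R'` agrees with `R` on the input registers, on the registers for the system parameters, and on
those of the rows in `keep`. -/
structure Frame (k : ℕ) (keep : ℕ → Prop) (R R' : Registers q G GT) : Prop where
  input : ∀ a, a < 2 * k + 2 → R'.x a = R.x a
  x : ∀ t i j, (t < 2 ∨ t < 5 ∧ keep i) → R'.x (adr k t i j) = R.x (adr k t i j)
  s : ∀ t i j, (t < 2 ∨ t < 4 ∧ keep i) → R'.s (adr k t i j) = R.s (adr k t i j)
  y : R'.y 0 = R.y 0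

variable {B : BilinearGroups q G GT} {k : ℕ} {θ h r : ZMod q} {Z : GT} {y : Fin n → ZMod q}
  {keep : ℕ → Prop} {R R' R'' : Registers q G GT}

theorem Frame.trans (h : Frame k keep R R') (h' : Frame k keep R' R'') : Frame k keep R R'' :=
  ⟨fun a ha => (h'.input a ha).trans (h.input a ha),
    fun t i j ht => (h'.x t i j ht).trans (h.x t i j ht),
    fun t i j ht => (h'.s t i j ht).trans (h.s t i j ht), h'.y.trans h.y⟩

theorem Loaded.frame (hR : Loaded B k θ h Z R) (hF : Frame k keep R R') : Loaded B k θ h Z R' :=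
  ⟨fun i hi hi' => (hF.input i (by omega)).trans (hR.power i hi hi'),
    (hF.input _ (by omega)).trans hR.one, (hF.input _ (by omega)).trans hR.Q, hF.y.trans hR.Z⟩

theorem Masked.frame (hR : Masked B k θ r y R) (hF : Frame k keep R R') : Masked B k θ r y R' :=
  ⟨(hF.x _ _ _ (by simp)).trans hR.u, (hF.s _ _ _ (by simp)).trans hR.r,
    fun j => (hF.x _ _ _ (by simp)).trans (hR.h j), fun j => (hF.s _ _ _ (by simp)).trans (hR.y j)⟩

theorem HasRow.frame {μ : ZMod q} {η : Fin n → ZMod q} {id : ℕ} {J : Fin n → Prop} {a b : ZMod q}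
    (hR : HasRow B k μ η R id J a b) (hF : Frame k keep R R') (hid : keep id) :
    HasRow B k μ η R' id J a b :=
  ⟨(hF.x _ _ _ (by simp [hid])).trans hR.fst, (hF.x _ _ _ (by simp [hid])).trans hR.snd,
    fun j hj => (hF.x _ _ _ (by simp [hid])).trans (hR.K j hj)⟩

/-- Products leave the protected registers alone if their targets are result registers or belong to
a row that is not kept. -/
theorem Frame.of_comp {x : ℕ → G} {D : List ℕ} (hx : ∀ a, a ≠ tmpReg k → a ∉ D → x a = R.x a)
    (hD : ∀ d ∈ D, ∃ t i j, d = adr k t i j ∧ 2 ≤ t ∧ (5 ≤ t ∨ ¬ keep i)) :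
    Frame k keep R { R with x := x } := by
  refine ⟨fun a ha => hx a ?_ ?_, fun t i j ht => hx _ ?_ ?_, fun _ _ _ _ => rfl, rfl⟩
  · rintro rfl
    simp [adr] at ha
  · intro haD
    obtain ⟨t, i, j, rfl, -⟩ := hD a haD
    simp [adr] at ha
  · intro h
    have := (adr_inj.1 h).1
    omega
  · intro haD
    obtain ⟨t', i', j', h, h1, h2⟩ := hD _ haD
    obtain ⟨rfl, rfl, rfl⟩ := adr_inj.1 h
    rcases ht with ht | ht
    · omega
    · rcases h2 with h2 | h2
      · omega
      · exact h2 ht.2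

theorem Frame.setS {t i j : ℕ} {v : ZMod q} (ht : 2 ≤ t ∧ (4 ≤ t ∨ ¬ keep i)) :
    Frame k keep R (R.setS (adr k t i j) v) := by
  refine ⟨fun _ _ => rfl, fun _ _ _ _ => rfl, fun t' i' j' ht' => ?_, rfl⟩
  rw [Registers.setS_s, if_neg]
  intro h
  obtain ⟨rfl, rfl, rfl⟩ := adr_inj.1 h
  rcases ht' with ht' | ht'
  · omega
  · rcases ht.2 with h2 | h2
    · omega
    · exact h2 ht'.2

theorem Frame.setY {d : ℕ} {v : GT} (hd : d ≠ 0) : Frame k keep R (R.setY d v) := by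
  refine ⟨fun _ _ => rfl, fun _ _ _ _ => rfl, fun _ _ _ _ => rfl, ?_⟩
  rw [Registers.setY_y, if_neg (Ne.symm hd)]

end Invariants

/-! ### Shifts of the row exponents, and the words that realise them -/

section Rows

variable {q : ℕ} [Fact q.Prime] {G GT : Type} [CommGroup G] [CommGroup GT] {users n tuples : ℕ}

/-- The shift of the first exponent of a row at position `i`. -/
def shiftA (k : ℕ) (θ : ZMod q) (i : Fin n) : ZMod q :=
  if (i : ℕ) = 0 then ∑ l : Fin n, (if (l : ℕ) = 0 then 0 else -θ ^ (k + 1 - l))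
  else θ ^ (k + 1 - i)

/-- The shift of the second exponent of a row at position `i`. -/
def shiftB (k : ℕ) (θ : ZMod q) (i : Fin n) : ZMod q := if (i : ℕ) = 0 then θ ^ k else 0

/-- The word for `g ^ shiftA`. -/
def wordA (k : ℕ) (i : Fin n) : List Letter :=
  if (i : ℕ) = 0 then overPositions n fun l => if (l : ℕ) = 0 then [] else [⟨k + 1 - l, none, true⟩]
  else [⟨k + 1 - i, none, false⟩]

/-- The word for `g ^ shiftB`. -/
def wordB (k : ℕ) (i : Fin n) : List Letter := if (i : ℕ) = 0 then [⟨k, none, false⟩] else []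

/-- The word for `g ^ (θ ^ j * shiftA + μ * shiftB)`, if `j ≠ i`. -/
def wordK (k : ℕ) (i j : Fin n) : List Letter :=
  if (i : ℕ) = 0 then
    (overPositions n fun l =>
      if (l : ℕ) = 0 ∨ l = j then [] else [⟨k + 1 - l + j, none, true⟩]) ++ [⟨k, some (uMask k), false⟩]
  else [⟨k + 1 - i + j, none, false⟩]

/-- The word for `g ^ (θ ^ (k + 1))` if the first exponent of the row vanishes. -/
def wordBadA (k id : ℕ) (i : Fin n) : List Letter :=
  if (i : ℕ) = 0 then
    [⟨1, some (aMask k id), false⟩] ++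
      overPositions n fun l => if (l : ℕ) ≤ 1 then [] else [⟨k + 2 - l, none, true⟩]
  else [⟨i, some (aMask k id), true⟩]

/-- The word for `g ^ (θ ^ (k + 1))` if the second exponent of the row vanishes. -/
def wordBadB (k id : ℕ) : List Letter := [⟨1, some (bMask k id), true⟩]

variable {B : BilinearGroups q G GT} {k : ℕ} {θ h r : ZMod q} {Z : GT} {y : Fin n → ZMod q}
  {R : Registers q G GT}

theorem reg_lt_of_mem_wordA (i : Fin n) : ∀ l ∈ wordA k i, l.reg < 2 * k + 2 := by
  unfold wordA
  split
  · intro l hl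
    obtain ⟨j, hj⟩ := mem_overPositions.1 hl
    split at hj
    · simp at hj
    · obtain rfl := List.mem_singleton.1 hj
      dsimp only
      omega
  · intro l hl
    obtain rfl := List.mem_singleton.1 hl
    dsimp only
    omega

theorem reg_lt_of_mem_wordB (i : Fin n) : ∀ l ∈ wordB k i, l.reg < 2 * k + 2 := by
  unfold wordB
  split
  · intro l hl
    obtain rfl := List.mem_singleton.1 hl
    dsimp only
    omega
  · simp

/-- Here `n ≤ k` is essential: the powers θ^(k+1-l+j) with 1 ≤ l and j < n must have exponent at
most 2k. -/
theorem reg_lt_of_mem_wordK (hnk : n ≤ k) (i j : Fin n) :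
    ∀ l ∈ wordK k i j, l.reg < 2 * k + 2 := by
  unfold wordK
  split
  · intro l hl
    rcases List.mem_append.1 hl with hl | hl
    · obtain ⟨l', hl'⟩ := mem_overPositions.1 hl
      split at hl'
      · simp at hl'
      · obtain rfl := List.mem_singleton.1 hl'
        dsimp only
        omega
    · obtain rfl := List.mem_singleton.1 hl
      dsimp only
      omega
  · intro l hl
    obtain rfl := List.mem_singleton.1 hl
    dsimp only
    omega

theorem reg_lt_of_mem_wordBadA (hnk : n ≤ k) (id : ℕ) (i : Fin n) :
    ∀ l ∈ wordBadA k id i, l.reg < 2 * k + 2 := by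
  unfold wordBadA
  split
  · intro l hl
    rcases List.mem_append.1 hl with hl | hl
    · obtain rfl := List.mem_singleton.1 hl
      dsimp only
      omega
    · obtain ⟨l', hl'⟩ := mem_overPositions.1 hl
      split at hl'
      · simp at hl'
      · obtain rfl := List.mem_singleton.1 hl'
        dsimp only
        omega
  · intro l hl
    obtain rfl := List.mem_singleton.1 hl
    dsimp only
    omega

theorem length_wordA_le (i : Fin n) : (wordA k i).length ≤ n := by
  unfold wordA
  split
  · refine (length_overPositions (c := 1) _ fun l => ?_).trans (by omega)
    split <;> simp
  · have := i.isLt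
    simp
    omega

theorem length_wordB_le (i : Fin n) : (wordB k i).length ≤ 1 := by
  unfold wordB
  split <;> simp

theorem length_wordK_le (i j : Fin n) : (wordK k i j).length ≤ n + 1 := by
  unfold wordK
  split
  · rw [List.length_append]
    refine Nat.add_le_add ((length_overPositions (c := 1) _ fun l => ?_).trans (by omega)) le_rfl
    split <;> simp
  · simp

theorem length_wordBadA_le (id : ℕ) (i : Fin n) : (wordBadA k id i).length ≤ n + 1 := by
  unfold wordBadA
  split
  · rw [List.length_append, add_comm]
    refine Nat.add_le_add ((length_overPositions (c := 1) _ fun l => ?_).trans (by omega)) le_rfl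
    split <;> simp
  · simp

theorem evals_wordA (hR : Loaded B k θ h Z R) (i : Fin n) :
    Evals B R (wordA k i) (shiftA k θ i) := by
  unfold wordA shiftA
  split
  · refine Evals.overPositions fun l => ?_
    split
    · exact Evals.nil
    · exact Evals.inv (hR.power _ (by omega) (by omega))
  · exact Evals.reg (hR.power _ (by omega) (by omega))

theorem evals_wordB (hR : Loaded B k θ h Z R) (i : Fin n) :
    Evals B R (wordB k i) (shiftB k θ i) := by
  unfold wordB shiftB
  split
  · exact Evals.reg (hR.power _ (by omega) (by omega))
  · exact Evals.nil

/-- The missing power θ^(k+1) drops out. For i ≠ 0 it would need j = i. For i = 0 the summand l = j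
of θ^j · `shiftA` is -θ^(k+1), and the product (r+θ)θ^k supplies +θ^(k+1) besides the computable
rθ^k. -/
theorem evals_wordK (hnk : n ≤ k) (hR : Loaded B k θ h Z R) (hr : R.s (uMask k) = r) (i j : Fin n)
    (hij : j ≠ i) :
    Evals B R (wordK k i j) (θ ^ (j : ℕ) * shiftA k θ i + (r + θ) * shiftB k θ i) := by
  have hij' : (j : ℕ) ≠ i := fun h => hij (Fin.ext h)
  unfold wordK shiftA shiftB
  split
  · rename_i hi
    refine ((Evals.overPositions (x := fun l : Fin n => if (l : ℕ) = 0 ∨ l = j then 0 else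
      -θ ^ (k + 1 - l + j)) fun l => ?_).append
        (Evals.pow (hR.power k (by omega) (by omega)))).congr ?_
    · split
      · exact Evals.nil
      · rename_i hl
        have : (l : ℕ) ≠ j := fun h => hl (Or.inr (Fin.ext h))
        exact Evals.inv (hR.power _ (by omega) (by omega))
    · rw [hr, Finset.mul_sum]
      -- Omitting l = j from the word amounts to adding θ^(k+1) there. The position j is nonzero
      -- because j ≠ i, so the omitted summand exists.
      have h1 : ∀ l : Fin n, (if (l : ℕ) = 0 ∨ l = j then 0 else -θ ^ (k + 1 - (l : ℕ) + j)) =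
          θ ^ (j : ℕ) * (if (l : ℕ) = 0 then 0 else -θ ^ (k + 1 - (l : ℕ))) +
            if l = j then θ ^ (k + 1) else 0 := by
        intro l
        by_cases hl : (l : ℕ) = 0
        · have : l ≠ j := by rintro rfl; omega
          simp [hl, this]
        · by_cases hlj : l = j
          · subst hlj
            simp only [hl, or_true, if_true, if_false]
            rw [mul_neg, ← pow_add, show (l : ℕ) + (k + 1 - l) = k + 1 by omega]
            ring
          · simp only [hl, hlj, or_self, if_false]
            rw [pow_add]
            ring
      simp only [h1, Finset.sum_add_distrib, Finset.sum_ite_eq', Finset.mem_univ, if_true]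
      ring
  · refine (Evals.reg (hR.power _ (by omega) (by omega))).congr ?_
    rw [pow_add]
    ring

/-- A vanishing exponent means that the mask is minus the shift. For i ≠ 0, θ^i times θ^(k+1-i) is
the missing power. For i = 0, θ times the mask is Σ_{l≥1} θ^(k+2-l), whose summand l = 1 is the
missing power while the others are available. -/
theorem evals_wordBadA (hnk : n ≤ k) (hR : Loaded B k θ h Z R) (id : ℕ) (i : Fin n)
    (hi : (i : ℕ) ≠ 0 ∨ n ≠ 1) (ha : R.s (aMask k id) + shiftA k θ i = 0) :
    Evals B R (wordBadA k id i) (θ ^ (k + 1)) := by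
  have hs := eq_neg_of_add_eq_zero_left ha
  unfold wordBadA
  unfold shiftA at hs
  split
  · rename_i hi0
    rw [if_pos hi0] at hs
    refine ((Evals.pow (hR.power 1 (by omega) (by omega))).append
      (Evals.overPositions (x := fun l : Fin n => if (l : ℕ) ≤ 1 then 0 else
        -θ ^ (k + 2 - l)) fun l => ?_)).congr ?_
    · split
      · exact Evals.nil
      · exact Evals.inv (hR.power _ (by omega) (by omega))
    · have hn : 1 < n := by omega
      rw [hs, ← Finset.sum_neg_distrib, Finset.mul_sum, ← Finset.sum_add_distrib,
        -- Only l = 1 survives. That position exists because the case n = 1, i = 0, where the shift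
        -- is an empty sum, is excluded.
        Finset.sum_eq_single (⟨1, hn⟩ : Fin n)]
      · simp [pow_succ']
      · intro l _ hl
        have hl1 : (l : ℕ) ≠ 1 := fun h => hl (Fin.ext h)
        by_cases hl0 : (l : ℕ) = 0
        · simp [hl0]
        · have h2 : ¬ (l : ℕ) ≤ 1 := by omega
          simp only [hl0, h2, if_false, neg_neg, pow_one]
          rw [show k + 2 - (l : ℕ) = k + 1 - l + 1 by omega, pow_succ]
          ring
      · simp
  · rename_i hi0
    rw [if_neg hi0] at hs
    refine (Evals.powInv (hR.power _ (by omega) (by omega))).congr ?_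
    rw [hs, mul_neg, neg_neg, ← pow_add, show (i : ℕ) + (k + 1 - i) = k + 1 by omega]

theorem evals_wordBadB (hk : 1 ≤ k) (hR : Loaded B k θ h Z R) (id : ℕ)
    (hb : R.s (bMask k id) + θ ^ k = 0) : Evals B R (wordBadB k id) (θ ^ (k + 1)) := by
  refine (Evals.powInv (hR.power 1 (by omega) (by omega))).congr ?_
  rw [eq_neg_of_add_eq_zero_left hb]
  ring

end Rows

/-! ### Generating rows with exact distribution -/

section Generate

variable {q : ℕ} [Fact q.Prime] {G GT : Type} [CommGroup G] [CommGroup GT] {users n tuples : ℕ}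

/-- The products for a row with known exponents. -/
def knownRow (k n id : ℕ) : List (ℕ × List Letter) :=
  [(aReg k id, [⟨0, some (aMask k id), false⟩]), (bReg k id, [⟨0, some (bMask k id), false⟩])] ++
    (List.finRange n).map fun j : Fin n => (kReg k id j,
      [⟨hReg k j, some (aMask k id), false⟩, ⟨uReg k, some (bMask k id), false⟩])

/-- Generate a row with known exponents. -/
def genKnown (k id : ℕ) (p : Program users n tuples) : Program users n tuples :=
  .sampleUnit (aMask k id) <| .sampleUnit (bMask k id) <| compMany k (knownRow k n id) p

/-- Sample from `ℤ_q` if the flag is set and from `ℤ_q^*` otherwise. -/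
def sampleScalar (fl : Bool) (d : ℕ) (p : Program users n tuples) : Program users n tuples :=
  if fl then .sample d p else .sampleUnit d p

/-- Once `g ^ (θ ^ (k + 1))` can be computed, store the value of the pairing with `Q` in the register
`1` of the bank for `GT` and generate a row with known exponents. -/
def genRecovered (k id : ℕ) (w : List Letter) (p : Program users n tuples) :
    Program users n tuples :=
  compMany k [(resReg k 0, w)] <| .pair 1 (resReg k 0) (2 * k + 1) <| genKnown k id p

/-- The products for the components `A` and `B` of a row with shifted exponents. -/
def shiftedHead (k id : ℕ) (i : Fin n) : List (ℕ × List Letter) :=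
  [(aReg k id, wordA k i ++ [⟨0, some (aMask k id), false⟩]),
    (bReg k id, wordB k i ++ [⟨0, some (bMask k id), false⟩])]

/-- The products for the public components `K j` of a row with shifted exponents. -/
def shiftedTail (k id : ℕ) (i : Fin n) : List (ℕ × List Letter) :=
  ((List.finRange n).filter (· ≠ i)).map fun j : Fin n => (kReg k id j,
    [⟨aReg k id, some (hMask k j), false⟩] ++ [⟨j, some (aMask k id), false⟩] ++ wordK k i j ++
      [⟨uReg k, some (bMask k id), false⟩])

/-- Generate a row for position `i` whose exponents are shifted. The flag `w` tells whether the
solution of the `k`-BDHE problem is known. -/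
def genShifted (k id : ℕ) (i : Fin n) (w : Bool) (p : Bool → Program users n tuples) :
    Program users n tuples :=
  sampleScalar (decide ((i : ℕ) ≠ 0 ∨ n ≠ 1)) (aMask k id) <|
  sampleScalar (decide ((i : ℕ) = 0)) (bMask k id) <|
  compMany k (shiftedHead k id i) <|
  .eq (aReg k id) (k + 1) fun bad =>
    if bad then genRecovered k id (wordBadA k id i) (p true) else
  .eq (bReg k id) (k + 1) fun bad =>
    if bad then genRecovered k id (wordBadB k id) (p true) else
  compMany k (shiftedTail k id i) (p w)

theorem run_sampleScalar (B : BilinearGroups q G GT) (A : Adversary users n tuples G GT)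
    (fl : Bool) (d : ℕ) (p : Program users n tuples) (R : Registers q G GT) (s : Option A.σ) :
    (sampleScalar fl d p).run B A R s =
      (PMF.uniformScalar q fl).bind fun x => p.run B A (R.setS d x) s := by
  cases fl with
  | false =>
    simp only [PMF.uniformScalar, Bool.false_eq_true, if_false, PMF.bind_bind, PMF.pure_bind]
    rfl
  | true => rfl

variable {B : BilinearGroups q G GT} {A : Adversary users n tuples G GT} {k : ℕ} {θ h r : ZMod q}
  {Z : GT} {y : Fin n → ZMod q} {R : Registers q G GT} {s : Option A.σ}

/-- Stated for an arbitrary continuation whose output depends only on the row's exponents, so that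
such statements compose along the program. The rows for shifted and recovered exponents follow the
same scheme. -/
theorem run_genKnown (hR : Loaded B k θ h Z R) (hM : Masked B k θ r y R) (id : ℕ)
    (p : Program users n tuples) (f : (ZMod q)ˣ → (ZMod q)ˣ → PMF Bool)
    (hp : ∀ (a b : (ZMod q)ˣ) (R' : Registers q G GT), Frame k (· ≠ id) R R' → R'.y = R.y →
      HasRow B k (r + θ) (fun j => y j + θ ^ (j : ℕ)) R' id (fun _ => True) a b →
      R'.s (aMask k id) = a → R'.s (bMask k id) = b → p.run B A R' s = f a b) :
    (genKnown k id p).run B A R s = (PMF.uniformOfFintype (ZMod q)ˣ).bind fun a =>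
      (PMF.uniformOfFintype (ZMod q)ˣ).bind (f a) := by
  refine congrArg _ (funext fun a => congrArg _ (funext fun b => ?_))
  set R₁ := (R.setS (aMask k id) (a : ZMod q)).setS (bMask k id) (b : ZMod q) with hR₁
  have hF₁ : Frame k (· ≠ id) R R₁ := (Frame.setS (by simp)).trans (Frame.setS (by simp))
  have hsa : R₁.s (aMask k id) = a := by
    simp [hR₁, Registers.setS_s, adr_inj]
  have hsb : R₁.s (bMask k id) = b := by
    simp [hR₁, Registers.setS_s]
  have hL₁ := hR.frame hF₁
  have hM₁ := hM.frame hF₁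
  obtain ⟨x, h1, h2, h3⟩ := run_compMany B A k 3 (by omega) (by omega) p
    (knownRow k n id)
    (by
      simp only [knownRow]
      simp only [List.map_append, List.map_map, List.map_cons, List.map_nil]
      refine List.nodup_append.2 ⟨by simp [adr_inj], ?_, ?_⟩
      · refine (List.nodup_finRange n).map fun i j hij => ?_
        exact Fin.ext (by simpa [adr_inj] using hij)
      · intro c hc d hd
        simp only [List.mem_map, Function.comp] at hd
        obtain ⟨j, -, rfl⟩ := hd
        simp only [List.mem_cons, List.not_mem_nil, or_false] at hc
        rcases hc with rfl | rfl <;> simp [adr_inj])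
    (by
      intro dw hdw
      simp only [knownRow, List.mem_append, List.mem_cons, List.not_mem_nil, or_false, List.mem_map] at hdw
      rcases hdw with (rfl | rfl) | ⟨j, -, rfl⟩ <;> simp [adr_inj, kind_adr])
    (by
      intro dw hdw l hl
      simp only [knownRow, List.mem_append, List.mem_cons, List.not_mem_nil, or_false, List.mem_map] at hdw
      rcases hdw with (rfl | rfl) | ⟨j, -, rfl⟩
      · simp only [List.mem_singleton] at hl
        subst hl
        simp [kind_of_lt]
      · simp only [List.mem_singleton] at hl
        subst hl
        simp [kind_of_lt]
      · simp only [List.mem_cons, List.not_mem_nil, or_false] at hl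
        rcases hl with rfl | rfl <;> simp [kind_adr])
    R₁ hL₁.one s
  refine h1.trans (hp a b _ (hF₁.trans (Frame.of_comp h2 ?_)) rfl ⟨?_, ?_, ?_⟩ hsa hsb)
  · intro d hd
    simp only [knownRow, List.map_append, List.map_map, List.map_cons, List.map_nil, List.mem_append,
      List.mem_cons, List.not_mem_nil, or_false, List.mem_map, Function.comp] at hd
    rcases hd with (rfl | rfl) | ⟨j, -, rfl⟩
    · exact ⟨2, id, 0, rfl, by simp⟩
    · exact ⟨3, id, 0, rfl, by simp⟩
    · exact ⟨4, id, j, rfl, by simp⟩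
  · refine (h3 (aReg k id, _) (List.mem_append_left _ List.mem_cons_self)).trans ?_
    refine (Evals.pow (hL₁.power 0 (by omega) (by omega))).congr ?_
    simp [hsa]
  · refine (h3 (bReg k id, _)
      (List.mem_append_left _ (List.mem_cons_of_mem _ List.mem_cons_self))).trans ?_
    refine (Evals.pow (hL₁.power 0 (by omega) (by omega))).congr ?_
    simp [hsb]
  · intro j _
    refine (h3 (kReg k id j, [⟨hReg k j, some (aMask k id), false⟩,
      ⟨uReg k, some (bMask k id), false⟩])
        (List.mem_append_right _ (List.mem_map.2 ⟨j, List.mem_finRange j, rfl⟩))).trans ?_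
    refine (Evals.append (Evals.pow (hM₁.h j)) (Evals.pow hM₁.u)).congr ?_
    rw [hsa, hsb]

theorem run_genRecovered (hR : Loaded B k θ h Z R) (hM : Masked B k θ r y R) (id : ℕ)
    (w : List Letter) (hw : ∀ l ∈ w, l.reg < 2 * k + 2) (hw' : Evals B R w (θ ^ (k + 1)))
    (p : Program users n tuples) (f : (ZMod q)ˣ → (ZMod q)ˣ → PMF Bool)
    (hp : ∀ (a b : (ZMod q)ˣ) (R' : Registers q G GT), Frame k (· ≠ id) R R' →
      R'.y 1 = B.expT (θ ^ (k + 1) * h) →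
      HasRow B k (r + θ) (fun j => y j + θ ^ (j : ℕ)) R' id (fun _ => True) a b →
      p.run B A R' s = f a b) :
    (genRecovered k id w p).run B A R s = (PMF.uniformOfFintype (ZMod q)ˣ).bind fun a =>
      (PMF.uniformOfFintype (ZMod q)ˣ).bind (f a) := by
  obtain ⟨x, h1, h2, h3⟩ := run_compMany B A k 1 (by omega) (by omega)
    (.pair 1 (resReg k 0) (2 * k + 1) <| genKnown k id p) [(resReg k 0, w)] (by simp)
    (by simp [kind_adr, adr_inj])
    (by
      intro dw hdw l hl
      obtain rfl := List.mem_singleton.1 hdw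
      rw [kind_of_lt (hw l hl)]
      omega) R hR.one s
  rw [genRecovered, h1, Program.run]
  have hF : Frame k (· ≠ id) R { R with x := x } := by
    refine Frame.of_comp h2 fun d hd => ?_
    obtain rfl := List.mem_singleton.1 hd
    exact ⟨5, 0, 0, rfl, by simp⟩
  have hL₁ := hR.frame hF
  have hF' : Frame k (· ≠ id) R (Registers.setY { R with x := x } 1
      (B.e (x (resReg k 0)) (x (2 * k + 1)))) := hF.trans (Frame.setY (by simp))
  refine run_genKnown (hR.frame hF') (hM.frame hF') id p f
    fun a b R' hF₁ hy hrow _ _ => hp a b R' (hF'.trans hF₁) ?_ hrow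
  rw [hy, Registers.setY_y, if_pos rfl, h3 (resReg k 0, w) (by simp), hw', ← B.e_exp]
  exact congrArg _ hL₁.Q

/-- Whether the row arises from shifted masks or, after a vanishing exponent, from fresh units, its
exponents are independent uniform units. In the second case the masks no longer describe the shifts,
but then the solution has been stored and `w'` is set. -/
theorem run_genShifted (hnk : n ≤ k) (hR : Loaded B k θ h Z R) (hM : Masked B k θ r y R) (id : ℕ)
    (i : Fin n) (w : Bool) (hw : w = true → R.y 1 = B.expT (θ ^ (k + 1) * h))
    (p : Bool → Program users n tuples) (f : (ZMod q)ˣ → (ZMod q)ˣ → PMF Bool)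
    (hp : ∀ (a b : (ZMod q)ˣ) (w' : Bool) (R' : Registers q G GT), (w' = false → w = false) →
      Frame k (· ≠ id) R R' → (w' = true → R'.y 1 = B.expT (θ ^ (k + 1) * h)) →
      HasRow B k (r + θ) (fun j => y j + θ ^ (j : ℕ)) R' id (· ≠ i) a b →
      (w' = false → R'.s (aMask k id) + shiftA k θ i = a ∧ R'.s (bMask k id) + shiftB k θ i = b) →
      (p w').run B A R' s = f a b) :
    (genShifted k id i w p).run B A R s = (PMF.uniformOfFintype (ZMod q)ˣ).bind fun a =>
      (PMF.uniformOfFintype (ZMod q)ˣ).bind (f a) := by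
  unfold genShifted
  simp only [run_sampleScalar]
  -- For n = 1 `shiftA` is an empty sum, and for i ≠ 0 `shiftB` is zero. There the mask is the
  -- exponent itself and is sampled as a unit; a zero would reveal nothing.
  refine PMF.uniformScalar_pair_resample _ _ (shiftA k θ i) (shiftB k θ i) ?_ ?_ f _ rfl _ ?_
  · intro hfa
    have hfa' : (i : ℕ) = 0 ∧ n = 1 := by simpa using hfa
    obtain ⟨hi, rfl⟩ := hfa'
    simp [shiftA]
  · intro hfb
    have hfb' : (i : ℕ) ≠ 0 := by simpa using hfb
    simp [shiftB, hfb']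
  intro a b hfa hfb
  set R₁ := (R.setS (aMask k id) a).setS (bMask k id) b with hR₁
  have hF₁ : Frame k (· ≠ id) R R₁ := (Frame.setS (by simp)).trans (Frame.setS (by simp))
  have hsa : R₁.s (aMask k id) = a := by
    simp [hR₁, Registers.setS_s, adr_inj]
  have hsb : R₁.s (bMask k id) = b := by
    simp [hR₁, Registers.setS_s]
  have hL₁ := hR.frame hF₁
  obtain ⟨x, h1, h2, h3⟩ := run_compMany B A k 1 (by omega) (by omega)
    (.eq (aReg k id) (k + 1) fun bad =>
      if bad then genRecovered k id (wordBadA k id i) (p true) else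
      .eq (bReg k id) (k + 1) fun bad =>
        if bad then genRecovered k id (wordBadB k id) (p true) else
        compMany k (shiftedTail k id i) (p w)) (shiftedHead k id i)
    (by simp [shiftedHead, adr_inj]) (by simp [shiftedHead, kind_adr, adr_inj])
    (by
      intro dw hdw l hl
      rw [kind_of_lt (k := k)]
      · omega
      simp only [shiftedHead, List.mem_cons, List.not_mem_nil, or_false] at hdw
      rcases hdw with rfl | rfl
      · rcases List.mem_append.1 hl with hl | hl
        · exact reg_lt_of_mem_wordA i l hl
        · obtain rfl := List.mem_singleton.1 hl
          simp
      · rcases List.mem_append.1 hl with hl | hl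
        · exact reg_lt_of_mem_wordB i l hl
        · obtain rfl := List.mem_singleton.1 hl
          simp) R₁ hL₁.one s
  rw [h1]
  set R₂ : Registers q G GT := { R₁ with x := x } with hR₂
  have hF₂ : Frame k (· ≠ id) R R₂ := by
    refine hF₁.trans (Frame.of_comp h2 fun d hd => ?_)
    simp only [shiftedHead, List.map_cons, List.map_nil, List.mem_cons, List.not_mem_nil,
      or_false] at hd
    rcases hd with rfl | rfl
    · exact ⟨2, id, 0, rfl, by simp⟩
    · exact ⟨3, id, 0, rfl, by simp⟩
  have hL₂ := hR.frame hF₂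
  have hM₂ := hM.frame hF₂
  have hxa : R₂.x (aReg k id) = B.exp (a + shiftA k θ i) := by
    refine (h3 (aReg k id, _) List.mem_cons_self).trans ?_
    refine ((evals_wordA hL₁ i).append (Evals.pow (hL₁.power 0 (by omega) (by omega)))).congr ?_
    simp [hsa, add_comm]
  have hxb : R₂.x (bReg k id) = B.exp (b + shiftB k θ i) := by
    refine (h3 (bReg k id, _) (List.mem_cons_of_mem _ List.mem_cons_self)).trans ?_
    refine ((evals_wordB hL₁ i).append (Evals.pow (hL₁.power 0 (by omega) (by omega)))).congr ?_
    simp [hsb, add_comm]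
  simp only [Program.run]
  -- The program detects this by comparing `A` with register `k + 1`, which holds the identity.
  by_cases ha : a + shiftA k θ i = 0
  · have hd : R₂.x (aReg k id) = R₂.x (k + 1) := by rw [hxa, ha, B.exp_zero, hL₂.one]
    rw [dif_pos ha]
    simp only [hd, decide_true, if_true]
    refine run_genRecovered hL₂ hM₂ id _ ?_ ?_ (p true) f
      fun a b R' hF hy hrow => hp a b true R' (by simp) (hF₂.trans hF) (fun _ => hy)
        ⟨hrow.fst, hrow.snd, fun j _ => hrow.K j trivial⟩ (by simp)
    · exact reg_lt_of_mem_wordBadA hnk id i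
    · refine evals_wordBadA hnk hL₂ id i ?_ (by rw [← ha]; exact congrArg (· + _) hsa)
      by_contra hc
      have hfa' : a ≠ 0 := hfa (by simpa using hc)
      have : (i : ℕ) = 0 ∧ n = 1 := by simpa using hc
      obtain ⟨hi, rfl⟩ := this
      exact hfa' (by simpa [shiftA] using ha)
  · have hd : R₂.x (aReg k id) ≠ R₂.x (k + 1) := by
      rw [hxa, hL₂.one, Ne, B.exp_eq_one_iff]
      exact ha
    rw [dif_neg ha]
    simp only [hd, decide_false, Bool.false_eq_true, if_false]
    simp only [Program.run]
    by_cases hb : b + shiftB k θ i = 0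
    · have hd : R₂.x (bReg k id) = R₂.x (k + 1) := by rw [hxb, hb, B.exp_zero, hL₂.one]
      rw [dif_pos hb]
      simp only [hd, decide_true, if_true]
      have hi : (i : ℕ) = 0 := by
        by_contra hi
        exact hfb (by simpa using hi) (by simpa [shiftB, hi] using hb)
      refine run_genRecovered hL₂ hM₂ id _ ?_ ?_ (p true) f
        fun a b R' hF hy hrow => hp a b true R' (by simp) (hF₂.trans hF) (fun _ => hy)
          ⟨hrow.fst, hrow.snd, fun j _ => hrow.K j trivial⟩ (by simp)
      · intro l hl
        obtain rfl := List.mem_singleton.1 hl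
        dsimp only
        omega
      · refine evals_wordBadB (by have := i.isLt; omega) hL₂ id ?_
        rw [shiftB, if_pos hi] at hb
        rw [← hb]
        exact congrArg (· + _) hsb
    · have hd : R₂.x (bReg k id) ≠ R₂.x (k + 1) := by
        rw [hxb, hL₂.one, Ne, B.exp_eq_one_iff]
        exact hb
      rw [dif_neg hb]
      simp only [hd, decide_false, Bool.false_eq_true, if_false]
      obtain ⟨x', h1', h2', h3'⟩ := run_compMany B A k 4 (by omega) (by omega) (p w)
        (shiftedTail k id i)
        (by
          rw [shiftedTail, List.map_map]
          refine ((List.nodup_finRange n).filter _).map fun i j hij => ?_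
          exact Fin.ext (by simpa [adr_inj] using hij))
        (by
          intro dw hdw
          simp only [shiftedTail, List.mem_map] at hdw
          obtain ⟨j, -, rfl⟩ := hdw
          simp [adr_inj, kind_adr])
        (by
          intro dw hdw l hl
          simp only [shiftedTail, List.mem_map] at hdw
          obtain ⟨j, -, rfl⟩ := hdw
          simp only [List.mem_append, List.mem_singleton] at hl
          rcases hl with ((rfl | rfl) | hl) | rfl
          · simp [kind_adr]
          · rw [kind_of_lt (by dsimp only; omega)]
            omega
          · rw [kind_of_lt (reg_lt_of_mem_wordK hnk i j l hl)]
            omega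
          · simp [kind_adr]) R₂ hL₂.one s
      rw [h1']
      have hF₃ : Frame k (· ≠ id) R { R₂ with x := x' } := by
        refine hF₂.trans (Frame.of_comp h2' fun d hd => ?_)
        simp only [shiftedTail, List.map_map, List.mem_map, Function.comp] at hd
        obtain ⟨j, -, rfl⟩ := hd
        exact ⟨4, id, j, rfl, by simp⟩
      -- The tail writes only entries `K` and the scratch register, so `A` and `B` survive.
      have hrest : ∀ t, t ≠ 4 → t ≠ 20 → x' (adr k t id 0) = R₂.x (adr k t id 0) := by
        intro t ht ht'
        refine h2' _ (by simp [adr_inj, ht']) ?_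
        simp only [shiftedTail, List.map_map, List.mem_map, Function.comp, not_exists, not_and]
        intro j _ hj
        exact ht (adr_inj.1 hj).1.symm
      refine hp (Units.mk0 _ ha) (Units.mk0 _ hb) w _ (fun hw => hw) hF₃ hw ⟨?_, ?_, ?_⟩ ?_
      · exact (hrest 2 (by simp) (by simp)).trans hxa
      · exact (hrest 3 (by simp) (by simp)).trans hxb
      · intro j hj
        refine (h3' (kReg k id j, _) (List.mem_map.2 ⟨j, by simpa using hj, rfl⟩)).trans ?_
        -- Split (y_j + θ^j)a + μb as y_j·a + θ^j·mask_a + (θ^j·shift_a + μ·shift_b) + μ·mask_b. The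
        -- first term is a power of the computed `A`, and the third is `wordK`.
        refine ((((Evals.pow hxa).append (Evals.pow (hL₂.power j (by omega) (by omega)))).append
          (evals_wordK hnk hL₂ hM₂.r i j hj)).append (Evals.pow hM₂.u)).congr ?_
        rw [hM₂.y j, show R₂.s (aMask k id) = a from hsa, show R₂.s (bMask k id) = b from hsb]
        simp only [Units.val_mk0]
        ring
      · intro _
        exact ⟨congrArg (· + _) hsa, congrArg (· + _) hsb⟩

end Generate

/-! ### Step counts for rows -/

section Cost

variable {users n tuples : ℕ}

theorem genKnown_halts {k id t : ℕ} {p : Program users n tuples} (hp : p.HaltsWithin t) :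
    (genKnown k id p).HaltsWithin (t + (7 * n + 16)) := by
  have h := compMany_halts (k := k) (c := 2) hp (knownRow k n id) (by
    intro dw hdw
    simp only [knownRow, List.mem_append, List.mem_cons, List.not_mem_nil, or_false,
      List.mem_map] at hdw
    rcases hdw with (rfl | rfl) | ⟨j, -, rfl⟩ <;> simp)
  have hlen : (knownRow k n id).length = n + 2 := by simp [knownRow]
  rw [hlen] at h
  exact h.mono (t' := t + (7 * n + 14)) (by omega)

theorem genRecovered_halts {k id t c : ℕ} {p : Program users n tuples} (hp : p.HaltsWithin t)
    (w : List Letter) (hw : w.length ≤ c) :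
    (genRecovered k id w p).HaltsWithin (t + (7 * n + 18 + 3 * c)) := by
  have h : (Program.pair 1 (resReg k 0) (2 * k + 1) <| genKnown k id p).HaltsWithin
      (t + (7 * n + 16) + 1) := genKnown_halts hp
  exact (compMany_halts (k := k) (c := c) h [(resReg k 0, w)] (by simpa using hw)).mono
    (by simp; omega)

/-- The number of steps for a row. -/
def rowCost (n : ℕ) : ℕ := 3 * n * n + 40 * n + 50

theorem genShifted_halts {k id t : ℕ} {p : Bool → Program users n tuples} (i : Fin n) (w : Bool)
    (hp : ∀ w, (p w).HaltsWithin t) : (genShifted k id i w p).HaltsWithin (t + rowCost n) := by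
  have hsample : ∀ (fl : Bool) (d u : ℕ) (p : Program users n tuples), p.HaltsWithin u →
      (sampleScalar fl d p).HaltsWithin (u + 1) := by
    intro fl d u p h
    cases fl <;> exact h
  have h3 : (compMany k (shiftedTail k id i) (p w)).HaltsWithin (t + n * (3 * (n + 4) + 1)) := by
    refine (compMany_halts (c := n + 4) (hp w) _ ?_).mono ?_
    · intro dw hdw
      simp only [shiftedTail, List.mem_map] at hdw
      obtain ⟨j, -, rfl⟩ := hdw
      have := length_wordK_le (k := k) i j
      simp
      omega
    · refine Nat.add_le_add le_rfl (Nat.mul_le_mul ?_ le_rfl)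
      simp only [shiftedTail, List.length_map]
      exact (List.length_filter_le _ _).trans (by simp)
  -- The tail and the recovery are alternatives, but the bound adds both instead of taking a
  -- maximum; the two extra steps are the equality tests.
  have h2 := compMany_halts (k := k) (c := n + 1) (t := t + n * (3 * (n + 4) + 1) +
    (7 * n + 18 + 3 * (n + 1)) + 1 + 1) (l := shiftedHead k id i)
    (p := .eq (aReg k id) (k + 1) fun bad =>
      if bad then genRecovered k id (wordBadA k id i) (p true) else
      .eq (bReg k id) (k + 1) fun bad =>
        if bad then genRecovered k id (wordBadB k id) (p true) else
        compMany k (shiftedTail k id i) (p w))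
    (by
      intro bad
      cases bad with
      | true =>
        exact (genRecovered_halts (hp true) _ (length_wordBadA_le id i)).mono (by omega)
      | false =>
        intro bad
        cases bad with
        | true =>
          exact (genRecovered_halts (c := n + 1) (hp true) _ (by simp [wordBadB])).mono (by omega)
        | false => exact h3.mono (by omega))
    (by
      intro dw hdw
      simp only [shiftedHead, List.mem_cons, List.not_mem_nil, or_false] at hdw
      have hA := length_wordA_le (k := k) i
      have hB := length_wordB_le (k := k) i
      have hi := i.isLt
      rcases hdw with rfl | rfl <;> simp <;> omega)
  have h1 := hsample (decide ((i : ℕ) ≠ 0 ∨ n ≠ 1)) (aMask k id) _ _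
    (hsample (decide ((i : ℕ) = 0)) (bMask k id) _ _ h2)
  refine Program.HaltsWithin.mono h1 ?_
  simp only [shiftedHead, List.length_cons, List.length_nil, rowCost]
  ring_nf
  omega

end Cost

/-- The number of the row of the user `v`. -/
def userRow {users : ℕ} (v : Fin users) : ℕ := 2 * v

/-- The number of the row of the tuple `γ` at position `i`. -/
def tupleRow {n tuples : ℕ} (γ : Fin tuples) (i : Fin n) : ℕ := 2 * Nat.pair γ i + 1

theorem userRow_inj {users : ℕ} {v w : Fin users} : userRow v = userRow w ↔ v = w := by
  simp [userRow, Fin.ext_iff]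

theorem tupleRow_inj {n tuples : ℕ} {γ γ' : Fin tuples} {i i' : Fin n} :
    tupleRow γ i = tupleRow γ' i' ↔ γ = γ' ∧ i = i' := by
  simp [tupleRow, Nat.pair_eq_pair, Fin.ext_iff]

theorem userRow_ne_tupleRow {users n tuples : ℕ} (v : Fin users) (γ : Fin tuples) (i : Fin n) :
    userRow v ≠ tupleRow γ i := by
  unfold userRow tupleRow
  omega

/-! ### The invariant of the simulation, and sums over positions -/

section Simulation

variable {q : ℕ} [Fact q.Prime] {G GT : Type} [CommGroup G] [CommGroup GT] {users n tuples : ℕ}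

/-- The exponents of the system parameters with masks `r` and `y`. -/
def maskedExponents (θ r : ZMod q) (y : Fin n → ZMod q)
    (t : Fin tuples → Fin n → (ZMod q)ˣ × (ZMod q)ˣ) : Exponents q n tuples :=
  ⟨r + θ, fun j => y j + θ ^ (j : ℕ), t⟩

/-- The registers hold a simulation of the challenger: the rows of the tuples have shifted exponents,
as do those of the users in `U` at the positions in the pattern `e`, and the other rows have known
exponents. This may fail if `w` is set, but then the solution of the `k`-BDHE problem is known. -/
structure Simulates (B : BilinearGroups q G GT) (k : ℕ) (θ h : ZMod q) (Z : GT) (r : ZMod q)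
    (y : Fin n → ZMod q) (t : Fin tuples → Fin n → (ZMod q)ˣ × (ZMod q)ˣ) (U : Finset (Fin users))
    (e : Fin n → Bool) (pos : Fin users → Option (Fin n))
    (keys : Fin users → (ZMod q)ˣ × (ZMod q)ˣ) (w : Bool) (R : Registers q G GT) : Prop where
  loaded : Loaded B k θ h Z R
  masked : Masked B k θ r y R
  solution : w = true → R.y 1 = B.expT (θ ^ (k + 1) * h)
  tuple : ∀ γ i, HasRow B k (r + θ) (fun j => y j + θ ^ (j : ℕ)) R (tupleRow γ i) (· ≠ i)
    (t γ i).1 (t γ i).2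
  tuple_shift : w = false → ∀ γ i,
    R.s (aMask k (tupleRow γ i)) + shiftA k θ i = (t γ i).1 ∧
      R.s (bMask k (tupleRow γ i)) + shiftB k θ i = (t γ i).2
  user : ∀ v i, pos v = some i → HasRow B k (r + θ) (fun j => y j + θ ^ (j : ℕ)) R (userRow v)
    (fun j => j ≠ i ∨ v ∉ U) (keys v).1 (keys v).2
  user_shift : w = false → ∀ v i, pos v = some i →
    R.s (aMask k (userRow v)) + (if v ∈ U ∧ e i = true then shiftA k θ i else 0) = (keys v).1 ∧
      R.s (bMask k (userRow v)) + (if v ∈ U ∧ e i = true then shiftB k θ i else 0) = (keys v).2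

variable {B : BilinearGroups q G GT} {A : Adversary users n tuples G GT} {k : ℕ} {θ h r : ZMod q}
  {Z : GT} {y : Fin n → ZMod q} {t : Fin tuples → Fin n → (ZMod q)ˣ × (ZMod q)ˣ}
  {U : Finset (Fin users)} {e : Fin n → Bool} {pos : Fin users → Option (Fin n)}
  {keys : Fin users → (ZMod q)ˣ × (ZMod q)ˣ} {w : Bool} {R R' : Registers q G GT} {s : A.σ}

theorem Simulates.frame (hS : Simulates B k θ h Z r y t U e pos keys w R)
    (hF : Frame k (fun _ => True) R R') (hy : R'.y 1 = R.y 1) :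
    Simulates B k θ h Z r y t U e pos keys w R' := by
  have hs : ∀ id, R'.s (aMask k id) = R.s (aMask k id) ∧ R'.s (bMask k id) = R.s (bMask k id) :=
    fun id => ⟨hF.s _ _ _ (by simp), hF.s _ _ _ (by simp)⟩
  refine ⟨hS.loaded.frame hF, hS.masked.frame hF, fun hw => hy.trans (hS.solution hw),
    fun γ i => (hS.tuple γ i).frame hF trivial, fun hw γ i => ?_,
    fun v i hv => (hS.user v i hv).frame hF trivial, fun hw v i hv => ?_⟩
  · rw [(hs _).1, (hs _).2]
    exact hS.tuple_shift hw γ i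
  · rw [(hs _).1, (hs _).2]
    exact hS.user_shift hw v i hv

/-- The number of the row used at position `j`. -/
def seatRow (γ : Fin tuples) (seats : Fin n → Option (Fin users)) (j : Fin n) : ℕ :=
  match seats j with
  | none => tupleRow γ j
  | some v => userRow v

/-- The diagonal entry is available exactly where it may be needed: at seats of users outside `U`,
whose exponents are known. -/
theorem Simulates.seat (hS : Simulates B k θ h Z r y t U e pos keys w R) (γ : Fin tuples)
    (seats : Fin n → Option (Fin users)) (hseats : ∀ j v, seats j = some v → pos v = some j)
    (j : Fin n) :
    HasRow B k (r + θ) (fun j => y j + θ ^ (j : ℕ)) R (seatRow γ seats j)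
      (fun l => l ≠ j ∨ ∃ v, seats j = some v ∧ v ∉ U)
      ((maskedExponents θ r y t).seat keys γ seats j).1
      ((maskedExponents θ r y t).seat keys γ seats j).2 := by
  unfold seatRow Exponents.seat
  cases hj : seats j with
  | none =>
    have := hS.tuple γ j
    exact ⟨this.fst, this.snd, fun l hl => this.K l (by simpa using hl)⟩
  | some v =>
    have := hS.user v j (hseats j v hj)
    exact ⟨this.fst, this.snd, fun l hl => this.K l (by simpa using hl)⟩

/-- The words for `(Y₁, Y₂)`. -/
def infoWords (k : ℕ) (γ : Fin tuples) (seats : Fin n → Option (Fin users)) :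
    List (ℕ × List Letter) :=
  [(resReg k 0, overPositions n fun j => [⟨aReg k (seatRow γ seats j), none, false⟩]),
    (resReg k 1, overPositions n fun j => [⟨bReg k (seatRow γ seats j), none, false⟩])]

/-- The word for the decryption key of position `i`. -/
def decWord (k : ℕ) (γ : Fin tuples) (seats : Fin n → Option (Fin users)) (i : Fin n) :
    List Letter :=
  overPositions n fun j => [⟨kReg k (seatRow γ seats j) i, none, false⟩]

/-- The addresses of the public part of a row that belongs to position `i`. -/
def pubAddresses (k id : ℕ) (i : Fin n) : PubRow n i ℕ :=
  ⟨aReg k id, bReg k id, fun j _ => kReg k id j⟩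

theorem HasRow.map_pubAddresses {id : ℕ} {J : Fin n → Prop} {ab : (ZMod q)ˣ × (ZMod q)ˣ}
    {i : Fin n} (hJ : ∀ j, j ≠ i → J j)
    (hrow : HasRow B k (r + θ) (fun j => y j + θ ^ (j : ℕ)) R id J ab.1 ab.2) :
    (pubAddresses k id i).map R.x = ((maskedExponents θ r y t).row B ab).pub i := by
  unfold pubAddresses PubRow.map Row.pub Exponents.row
  congr 1
  · exact hrow.fst
  · exact hrow.snd
  · funext j hj
    exact hrow.K j (hJ j hj)

/-- The numbers of the rows that position `j` contributes to an encryption for `S`. -/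
def shareRows (γ : Fin tuples) (seats : Fin n → Option (Fin users)) (S : Finset (Fin users))
    (j : Fin n) : List ℕ :=
  match seats j with
  | none => [tupleRow γ j]
  | some v => if v ∈ S then [userRow v] else [userRow v, tupleRow γ j]

theorem length_shareRows_le (γ : Fin tuples) (seats : Fin n → Option (Fin users))
    (S : Finset (Fin users)) (j : Fin n) : (shareRows γ seats S j).length ≤ 2 := by
  unfold shareRows
  split
  · simp
  · split <;> simp

/-- The product over all contributed rows of the letters `f`. -/
def shareWord (γ : Fin tuples) (seats : Fin n → Option (Fin users)) (S : Finset (Fin users))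
    (f : ℕ → Letter) : List Letter :=
  overPositions n fun j => (shareRows γ seats S j).map f

theorem length_shareWord_le (γ : Fin tuples) (seats : Fin n → Option (Fin users))
    (S : Finset (Fin users)) (f : ℕ → Letter) : (shareWord γ seats S f).length ≤ n * 2 :=
  length_overPositions _ fun j => by simpa using length_shareRows_le γ seats S j

theorem mem_shareWord {γ : Fin tuples} {seats : Fin n → Option (Fin users)}
    {S : Finset (Fin users)} {f : ℕ → Letter} {l : Letter} (hl : l ∈ shareWord γ seats S f) :
    ∃ id, l = f id := by
  obtain ⟨j, hj⟩ := mem_overPositions.1 hl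
  obtain ⟨id, -, rfl⟩ := List.mem_map.1 hj
  exact ⟨id, rfl⟩

/-- Products over contributed rows evaluate to sums of shares. -/
theorem evals_shareWord (γ : Fin tuples) (seats : Fin n → Option (Fin users))
    (S : Finset (Fin users)) (f : ℕ → Letter) (c : ZMod q)
    (pr : (ZMod q)ˣ × (ZMod q)ˣ → (ZMod q)ˣ) (hseats : ∀ j v, seats j = some v → pos v = some j)
    (htup : ∀ γ (i : Fin n), Evals B R [f (tupleRow γ i)] (c * pr (t γ i)))
    (husr : ∀ v i, pos v = some i → Evals B R [f (userRow v)] (c * pr (keys v))) :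
    Evals B R (shareWord γ seats S f)
      (c * ∑ j, (maskedExponents θ r y t).share keys γ seats S pr j) := by
  rw [Finset.mul_sum]
  refine Evals.overPositions fun j => ?_
  unfold shareRows Exponents.share
  cases hj : seats j with
  | none => exact htup γ j
  | some v =>
    by_cases hv : v ∈ S
    · simp only [hv, if_true]
      exact husr v j (hseats j v hj)
    · simp only [hv, if_false]
      refine ((husr v j (hseats j v hj)).append (htup γ j)).congr ?_
      rw [mul_add]
      rfl

/-- The shift at position 0 was chosen as minus the sum of the others. The header of a challenge can
therefore be computed from the masks alone. -/
theorem sum_shiftA (hn : 0 < n) : ∑ i : Fin n, shiftA k θ i = 0 := by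
  have h : ∀ i : Fin n, shiftA k θ i = (if i = ⟨0, hn⟩ then
      ∑ l : Fin n, (if (l : ℕ) = 0 then 0 else -θ ^ (k + 1 - l)) else 0) -
      (if (i : ℕ) = 0 then 0 else -θ ^ (k + 1 - (i : ℕ))) := by
    intro i
    by_cases hi : (i : ℕ) = 0
    · have : i = ⟨0, hn⟩ := Fin.ext hi
      simp [shiftA, this]
    · have : i ≠ ⟨0, hn⟩ := fun h => hi (congrArg Fin.val h)
      simp [shiftA, hi, this]
  simp only [h, Finset.sum_sub_distrib, Finset.sum_ite_eq', Finset.mem_univ, if_true, sub_self]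

theorem sum_shiftB (hn : 0 < n) : ∑ i : Fin n, shiftB k θ i = θ ^ k := by
  rw [Finset.sum_eq_single (⟨0, hn⟩ : Fin n)]
  · simp [shiftB]
  · intro i _ hi
    have : (i : ℕ) ≠ 0 := fun h => hi (Fin.ext h)
    simp [shiftB, this]
  · simp

/-- Products over contributed rows of powers of a fixed element by the known parts of the exponents
evaluate to sums of shares without the shifts, if the pattern is the required one. -/
theorem evals_shareWord_mask (γ : Fin tuples) (seats : Fin n → Option (Fin users))
    (S : Finset (Fin users)) (hSU : S ⊆ U) (f : ℕ → Letter) (c : ZMod q)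
    (pr : (ZMod q)ˣ × (ZMod q)ˣ → (ZMod q)ˣ) (sh : Fin n → ZMod q) (mask : ℕ → ZMod q)
    (hseats : ∀ j v, seats j = some v → pos v = some j) (he : e = requiredPattern U S seats)
    (hf : ∀ id, Evals B R [f id] (c * mask id))
    (htup : ∀ γ i, mask (tupleRow γ i) + sh i = pr (t γ i))
    (husr : ∀ v i, pos v = some i →
      mask (userRow v) + (if v ∈ U ∧ e i = true then sh i else 0) = pr (keys v)) :
    Evals B R (shareWord γ seats S f)
      (c * (∑ j, (maskedExponents θ r y t).share keys γ seats S pr j - ∑ j, sh j)) := by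
  rw [← Finset.sum_sub_distrib, Finset.mul_sum]
  refine Evals.overPositions fun j => ?_
  have hej := congrFun he j
  unfold requiredPattern at hej
  unfold shareRows Exponents.share
  cases hj : seats j with
  | none =>
    refine (hf (tupleRow γ j)).congr ?_
    rw [show (maskedExponents θ r y t).t = t from rfl]
    dsimp only
    rw [← htup γ j]
    ring
  | some v =>
    rw [hj] at hej
    have hv := husr v j (hseats j v hj)
    -- A recipient lies in `U` at an on position, so its own row carries the shift. An excluded
    -- member contributes the shift through the tuple row, so its own row must carry none.
    by_cases hvS : v ∈ S
    · have hvU := hSU hvS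
      have hej' : e j = true := by simpa [hvS] using hej
      simp only [hvU, hej', and_self, if_true] at hv
      simp only [hvS, if_true]
      refine (hf (userRow v)).congr ?_
      rw [← hv]
      ring
    · have hv0 : ¬ (v ∈ U ∧ e j = true) := by
        rintro ⟨h1, h2⟩
        rw [h2] at hej
        simp [h1, hvS] at hej
      rw [if_neg hv0] at hv
      simp only [hvS, if_false]
      refine ((hf (userRow v)).append (hf (tupleRow γ j))).congr ?_
      rw [show (maskedExponents θ r y t).t = t from rfl, ← hv, ← htup γ j]
      ring

end Simulation

/-! ### Answering the challenge -/

section Challenge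

variable {q : ℕ} [Fact q.Prime] {G GT : Type} [CommGroup G] [CommGroup GT] {users n tuples : ℕ}

/-- The products for an encryption with known exponent. -/
def encWords (k : ℕ) (γ : Fin tuples) (seats : Fin n → Option (Fin users))
    (S : Finset (Fin users)) : List (ℕ × List Letter) :=
  [(resReg k 0, [⟨0, some (rhoReg k), false⟩]),
    (resReg k 1, shareWord γ seats S fun id => ⟨aReg k id, some (rhoReg k), false⟩),
    (resReg k 2, [⟨uReg k, some (rhoReg k), false⟩]),
    (resReg k 3, shareWord γ seats S fun id => ⟨bReg k id, none, false⟩)]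

/-- Answer the challenge if the solution of the `k`-BDHE problem is known: encrypt, and multiply the
session key by the quotient of `Z` and the solution. -/
def challengeKnown (k : ℕ) (γ : Fin tuples) (seats : Fin n → Option (Fin users))
    (S : Finset (Fin users)) (p : Program users n tuples) : Program users n tuples :=
  .sampleUnit (rhoReg k) <| compMany k (encWords k γ seats S) <|
    .pair 2 (resReg k 2) (resReg k 3) <| .mulT 2 2 0 <| .invT 3 1 <| .mulT 2 2 3 <|
      .reply (.challenge (resReg k 0) (resReg k 1) 2) p

/-- The products that depend on the contributed rows in the embedding of the instance. -/
def embedWords (k : ℕ) (γ : Fin tuples) (seats : Fin n → Option (Fin users))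
    (S : Finset (Fin users)) : List (ℕ × List Letter) :=
  [(resReg k 6, shareWord γ seats S fun id => ⟨resReg k 4, some (aMask k id), false⟩),
    (resReg k 7, (shareWord γ seats S fun id => ⟨uReg k, some (bMask k id), false⟩) ++
      [⟨k, some (uMask k), false⟩])]

/-- Answer the challenge by embedding the `k`-BDHE instance. -/
def challengeEmbed (k : ℕ) (γ : Fin tuples) (seats : Fin n → Option (Fin users))
    (S : Finset (Fin users)) (p : Bool → Program users n tuples) : Program users n tuples :=
  .sample (rhoReg k) <|
  compMany k [(resReg k 4, [⟨2 * k + 1, none, false⟩] ++ [⟨0, some (rhoReg k), false⟩]),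
    (resReg k 5, [⟨k, some (rhoReg k), true⟩])] <|
  .eq (resReg k 4) (k + 1) fun bad =>
    if bad then .pair 1 1 (resReg k 5) <| challengeKnown k γ seats S (p true) else
  compMany k (embedWords k γ seats S) <|
    .pair 2 (resReg k 7) (resReg k 4) <| .mulT 2 2 0 <| .pair 3 1 (resReg k 5) <| .invT 3 3 <|
      .mulT 2 2 3 <| .reply (.challenge (resReg k 4) (resReg k 6) 2) (p false)

theorem challengeKnown_halts {k u : ℕ} (γ : Fin tuples) (seats : Fin n → Option (Fin users))
    (S : Finset (Fin users)) {p : Program users n tuples} (hp : p.HaltsWithin u) :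
    (challengeKnown k γ seats S p).HaltsWithin (u + (24 * n + 22)) := by
  have h1 : (Program.pair 2 (resReg k 2) (resReg k 3) <| .mulT 2 2 0 <| .invT 3 1 <|
      .mulT 2 2 3 <| .reply (.challenge (resReg k 0) (resReg k 1) 2) p).HaltsWithin
      (u + 1 + 1 + 1 + 1 + 1) := hp
  have h2 := compMany_halts (k := k) (c := n * 2 + 1) h1 (encWords k γ seats S) (by
    intro dw hdw
    simp only [encWords, List.mem_cons, List.not_mem_nil, or_false] at hdw
    rcases hdw with rfl | rfl | rfl | rfl
    · simp
    · exact (length_shareWord_le γ seats S _).trans (by omega)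
    · simp
    · exact (length_shareWord_le γ seats S _).trans (by omega))
  have h3 : (challengeKnown k γ seats S p).HaltsWithin
      (u + 1 + 1 + 1 + 1 + 1 + 4 * (3 * (n * 2 + 1) + 1) + 1) := h2
  exact h3.mono (by omega)

theorem challengeEmbed_halts {k u : ℕ} (γ : Fin tuples) (seats : Fin n → Option (Fin users))
    (S : Finset (Fin users)) {p : Bool → Program users n tuples}
    (hp : ∀ w, (p w).HaltsWithin u) :
    (challengeEmbed k γ seats S p).HaltsWithin (u + (36 * n + 60)) := by
  have h1 : (Program.pair 2 (resReg k 7) (resReg k 4) <| .mulT 2 2 0 <|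
      .pair 3 1 (resReg k 5) <| .invT 3 3 <| .mulT 2 2 3 <|
      .reply (.challenge (resReg k 4) (resReg k 6) 2) (p false)).HaltsWithin
      (u + 1 + 1 + 1 + 1 + 1 + 1) := hp false
  have h2 := compMany_halts (k := k) (c := n * 2 + 1) h1 (embedWords k γ seats S) (by
    intro dw hdw
    simp only [embedWords, List.mem_cons, List.not_mem_nil, or_false] at hdw
    rcases hdw with rfl | rfl
    · exact (length_shareWord_le γ seats S _).trans (by omega)
    · rw [List.length_append]
      exact Nat.add_le_add (length_shareWord_le γ seats S _) (by simp))
  have h2' : (compMany k (embedWords k γ seats S) (Program.pair 2 (resReg k 7) (resReg k 4) <|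
      .mulT 2 2 0 <| .pair 3 1 (resReg k 5) <| .invT 3 3 <| .mulT 2 2 3 <|
      .reply (.challenge (resReg k 4) (resReg k 6) 2) (p false))).HaltsWithin
      (u + 1 + 1 + 1 + 1 + 1 + 1 + 2 * (3 * (n * 2 + 1) + 1)) := h2
  have h3 : (Program.pair 1 1 (resReg k 5) <| challengeKnown k γ seats S (p true)).HaltsWithin
      (u + (24 * n + 22) + 1) := challengeKnown_halts γ seats S (hp true)
  -- The summand 24n + 23 pays for the branch with known solution and 12n + 14 for the embedding;
  -- the bound adds both.
  have h4 := compMany_halts (k := k) (c := 2) (t := u + (24 * n + 22) + 1 + 12 * n + 14 + 1)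
    (p := .eq (resReg k 4) (k + 1) fun bad =>
      if bad then .pair 1 1 (resReg k 5) <| challengeKnown k γ seats S (p true) else
      compMany k (embedWords k γ seats S) <|
      .pair 2 (resReg k 7) (resReg k 4) <| .mulT 2 2 0 <| .pair 3 1 (resReg k 5) <| .invT 3 3 <|
      .mulT 2 2 3 <| .reply (.challenge (resReg k 4) (resReg k 6) 2) (p false))
    (by
      intro bad
      cases bad with
      | true => exact h3.mono (by omega)
      | false => exact h2'.mono (by omega))
    [(resReg k 4, [⟨2 * k + 1, none, false⟩] ++ [⟨0, some (rhoReg k), false⟩]),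
      (resReg k 5, [⟨k, some (rhoReg k), true⟩])] (by simp)
  have h5 : (challengeEmbed k γ seats S p).HaltsWithin
      (u + (24 * n + 22) + 1 + 12 * n + 14 + 1 + 2 * (3 * 2 + 1) + 1) := h4
  exact h5.mono (by omega)

variable {B : BilinearGroups q G GT} {A : Adversary users n tuples G GT} {k : ℕ} {θ h r : ZMod q}
  {Z : GT} {y : Fin n → ZMod q} {t : Fin tuples → Fin n → (ZMod q)ˣ × (ZMod q)ˣ}
  {U : Finset (Fin users)} {e : Fin n → Bool} {pos : Fin users → Option (Fin n)}
  {keys : Fin users → (ZMod q)ˣ × (ZMod q)ˣ} {w : Bool} {R R' : Registers q G GT} {s : A.σ}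

/-- The answer to the challenge with exponent `ρ`. -/
def challengeAnswer (B : BilinearGroups q G GT) (X : Exponents q n tuples)
    (keys : Fin users → (ZMod q)ˣ × (ZMod q)ˣ) (γ : Fin tuples)
    (seats : Fin n → Option (Fin users)) (S : Finset (Fin users)) (ζ : GT) (ρ : (ZMod q)ˣ) :
    Answer users n G GT :=
  .challenge (B.exp ρ) (B.exp ((∑ j, X.share keys γ seats S Prod.fst j) * ρ))
    (B.expT (X.μ * ρ * ∑ j, X.share keys γ seats S Prod.snd j) * ζ)

/-- All rows are available as group elements, so one can encrypt honestly. The factor `ζ` is Z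
divided by the stored solution. -/
theorem run_challengeKnown (hS : Simulates B k θ h Z r y t U e pos keys true R) (γ : Fin tuples)
    (seats : Fin n → Option (Fin users)) (S : Finset (Fin users))
    (hseats : ∀ j v, seats j = some v → pos v = some j) (ζ : GT)
    (hζ : Z = B.expT (θ ^ (k + 1) * h) * ζ) (p : Program users n tuples) (F : A.σ → PMF Bool)
    (hp : ∀ R' s', Simulates B k θ h Z r y t U e pos keys true R' →
      p.run B A R' (some s') = F s') :
    (challengeKnown k γ seats S p).run B A R (some s) =
      (PMF.uniformOfFintype (ZMod q)ˣ).bind fun ρ =>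
        (A.receive s (challengeAnswer B (maskedExponents θ r y t) keys γ seats S ζ ρ)).bind F := by
  refine congrArg (PMF.bind _) (funext fun ρ => ?_)
  set R₁ := R.setS (rhoReg k) (ρ : ZMod q) with hR₁
  have hS₁ : Simulates B k θ h Z r y t U e pos keys true R₁ :=
    hS.frame (Frame.setS (by simp)) rfl
  have hρ : R₁.s (rhoReg k) = ρ := by simp [hR₁, Registers.setS_s]
  obtain ⟨x, h1, h2, h3⟩ := run_compMany B A k 6 (by omega) (by omega)
    (.pair 2 (resReg k 2) (resReg k 3) <| .mulT 2 2 0 <| .invT 3 1 <| .mulT 2 2 3 <|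
      .reply (.challenge (resReg k 0) (resReg k 1) 2) p) (encWords k γ seats S)
    (by simp [encWords, adr_inj]) (by simp [encWords, adr_inj, kind_adr])
    (by
      intro dw hdw l hl
      simp only [encWords, List.mem_cons, List.not_mem_nil, or_false] at hdw
      rcases hdw with rfl | rfl | rfl | rfl
      · obtain rfl := List.mem_singleton.1 hl
        simp [kind_of_lt]
      · obtain ⟨id, rfl⟩ := mem_shareWord hl
        simp [kind_adr]
      · obtain rfl := List.mem_singleton.1 hl
        simp [kind_adr]
      · obtain ⟨id, rfl⟩ := mem_shareWord hl
        simp [kind_adr]) R₁ hS₁.loaded.one (some s)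
  have e0 : x (resReg k 0) = B.exp ρ := by
    refine (h3 (resReg k 0, _) List.mem_cons_self).trans ?_
    refine (Evals.pow (hS₁.loaded.power 0 (by omega) (by omega))).congr ?_
    simp [hρ]
  have e1 : x (resReg k 1) =
      B.exp ((∑ j, (maskedExponents θ r y t).share keys γ seats S Prod.fst j) * ρ) := by
    refine (h3 (resReg k 1, _) (List.mem_cons_of_mem _ List.mem_cons_self)).trans ?_
    refine (evals_shareWord γ seats S _ (ρ : ZMod q) Prod.fst hseats (fun γ i => ?_)
      fun v i hv => ?_).congr (mul_comm _ _)
    · exact (Evals.pow (hS₁.tuple γ i).fst).congr (by rw [hρ, mul_comm])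
    · exact (Evals.pow (hS₁.user v i hv).fst).congr (by rw [hρ, mul_comm])
  have e2 : x (resReg k 2) = B.exp ((r + θ) * ρ) := by
    refine (h3 (resReg k 2, _) (List.mem_cons_of_mem _ (List.mem_cons_of_mem _
      List.mem_cons_self))).trans ?_
    exact (Evals.pow hS₁.masked.u).congr (by rw [hρ])
  have e3 : x (resReg k 3) =
      B.exp (1 * ∑ j, (maskedExponents θ r y t).share keys γ seats S Prod.snd j) := by
    refine (h3 (resReg k 3, _) (List.mem_cons_of_mem _ (List.mem_cons_of_mem _
      (List.mem_cons_of_mem _ List.mem_cons_self)))).trans ?_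
    refine evals_shareWord γ seats S _ 1 Prod.snd hseats (fun γ i => ?_) fun v i hv => ?_
    · exact (Evals.reg (hS₁.tuple γ i).snd).congr (by rw [one_mul])
    · exact (Evals.reg (hS₁.user v i hv).snd).congr (by rw [one_mul])
  rw [h1]
  have hS₂ : Simulates B k θ h Z r y t U e pos keys true { R₁ with x := x } := by
    refine hS₁.frame (Frame.of_comp h2 fun d hd => ?_) rfl
    simp only [encWords, List.map_cons, List.map_nil, List.mem_cons, List.not_mem_nil,
      or_false] at hd
    rcases hd with rfl | rfl | rfl | rfl <;> exact ⟨_, _, _, rfl, by simp⟩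
  simp only [Program.run, PMF.monad_bind_eq_bind]
  refine congrArg₂ PMF.bind (congrArg (A.receive s) ?_) (funext fun s' => hp _ s' ?_)
  · have hZ : R₁.y 0 = Z := hS₁.loaded.Z
    have hy : R₁.y 1 = B.expT (θ ^ (k + 1) * h) := hS₁.solution rfl
    simp only [Answer.map, challengeAnswer, Registers.setY, Function.update_apply, e0, e1, e2, e3,
      hZ, hy, hζ, B.e_exp, if_true, if_false, one_mul,
      Nat.reduceEqDiff, OfNat.zero_ne_ofNat, OfNat.one_ne_ofNat]
    congr 1
    -- The program multiplies by Z and then divides by the solution, which leaves `ζ`.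
    rw [mul_comm (B.expT (θ ^ (k + 1) * h)) ζ, ← mul_assoc, mul_inv_cancel_right]
    rfl
  · refine hS₂.frame (((Frame.setY ?_).trans (Frame.setY ?_)).trans
      ((Frame.setY ?_).trans (Frame.setY ?_))) ?_ <;> simp [Registers.setY_y]

/-- With ρ = c + h the key exponent is ρ((r+θ)Σmask_b + rθ^k) + θ^(k+1)c + θ^(k+1)h. The first
summand is a pairing with Q g^c, the second a pairing of g^θ with g^(θ^k c), and the third is
replaced by Z. If ρ = 0, then c = -h reveals the solution and the honest encryption takes over. -/
theorem run_challengeEmbed (hk : 1 ≤ k) (hn : 0 < n)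
    (hS : Simulates B k θ h Z r y t U e pos keys false R) (γ : Fin tuples)
    (seats : Fin n → Option (Fin users)) (S : Finset (Fin users)) (hSU : S ⊆ U)
    (he : e = requiredPattern U S seats)
    (hseats : ∀ j v, seats j = some v → pos v = some j) (ζ : GT)
    (hζ : Z = B.expT (θ ^ (k + 1) * h) * ζ) (p : Bool → Program users n tuples)
    (F : A.σ → PMF Bool)
    (hp : ∀ w' R' s', Simulates B k θ h Z r y t U e pos keys w' R' →
      (p w').run B A R' (some s') = F s') :
    (challengeEmbed k γ seats S p).run B A R (some s) =
      (PMF.uniformOfFintype (ZMod q)ˣ).bind fun ρ =>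
        (A.receive s (challengeAnswer B (maskedExponents θ r y t) keys γ seats S ζ ρ)).bind F := by
  -- Replace the uniform unit ρ by c + h for uniform c, redrawing a unit if this is 0.
  rw [← PMF.uniform_zmod_add_resample h]
  refine congrArg (PMF.bind _) (funext fun c => ?_)
  set R₁ := R.setS (rhoReg k) c with hR₁
  have hS₁ : Simulates B k θ h Z r y t U e pos keys false R₁ :=
    hS.frame (Frame.setS (by simp)) rfl
  have hc : R₁.s (rhoReg k) = c := by simp [hR₁, Registers.setS_s]
  obtain ⟨x, h1, h2, h3⟩ := run_compMany B A k 1 (by omega) (by omega)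
    (.eq (resReg k 4) (k + 1) fun bad =>
      if bad then .pair 1 1 (resReg k 5) <| challengeKnown k γ seats S (p true) else
      compMany k (embedWords k γ seats S) <|
      .pair 2 (resReg k 7) (resReg k 4) <| .mulT 2 2 0 <| .pair 3 1 (resReg k 5) <| .invT 3 3 <|
      .mulT 2 2 3 <| .reply (.challenge (resReg k 4) (resReg k 6) 2) (p false))
    [(resReg k 4, [⟨2 * k + 1, none, false⟩] ++ [⟨0, some (rhoReg k), false⟩]),
      (resReg k 5, [⟨k, some (rhoReg k), true⟩])]
    (by simp [adr_inj]) (by simp [adr_inj, kind_adr])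
    (by
      intro dw hdw l hl
      rw [kind_of_lt]
      · omega
      simp only [List.mem_cons, List.not_mem_nil, or_false] at hdw
      rcases hdw with rfl | rfl
      · simp only [List.cons_append, List.nil_append, List.mem_cons, List.not_mem_nil,
          or_false] at hl
        rcases hl with rfl | rfl <;> simp
      · obtain rfl := List.mem_singleton.1 hl
        dsimp only
        omega) R₁ hS₁.loaded.one (some s)
  refine h1.trans ?_
  set R₂ : Registers q G GT := { R₁ with x := x } with hR₂
  have hS₂ : Simulates B k θ h Z r y t U e pos keys false R₂ := by
    refine hS₁.frame (Frame.of_comp h2 fun d hd => ?_) rfl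
    simp only [List.map_cons, List.map_nil, List.mem_cons, List.not_mem_nil, or_false] at hd
    rcases hd with rfl | rfl <;> exact ⟨_, _, _, rfl, by simp⟩
  have e4 : R₂.x (resReg k 4) = B.exp (c + h) := by
    refine (h3 (resReg k 4, _) List.mem_cons_self).trans ?_
    refine ((Evals.reg hS₁.loaded.Q).append
      (Evals.pow (hS₁.loaded.power 0 (by omega) (by omega)))).congr ?_
    simp [hc, add_comm]
  have e5 : R₂.x (resReg k 5) = B.exp (-(θ ^ k * c)) := by
    refine (h3 (resReg k 5, _) (List.mem_cons_of_mem _ List.mem_cons_self)).trans ?_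
    exact (Evals.powInv (hS₁.loaded.power k (by omega) (by omega))).congr (by rw [hc])
  have x1 : R₂.x 1 = B.exp θ := by
    rw [hS₂.loaded.power 1 (by omega) (by omega), pow_one]
  simp only [Program.run]
  by_cases hbad : c + h = 0
  · have hd : R₂.x (resReg k 4) = R₂.x (k + 1) := by
      rw [e4, hbad, B.exp_zero, hS₂.loaded.one]
    rw [dif_pos hbad]
    simp only [hd, decide_true, if_true, Program.run]
    -- For c = -h the register holds g^(θ^k h), and pairing with g^θ gives the solution.
    have hsol : B.e (R₂.x 1) (R₂.x (resReg k 5)) = B.expT (θ ^ (k + 1) * h) := by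
      rw [x1, e5, B.e_exp, eq_neg_of_add_eq_zero_left hbad]
      congr 1
      ring
    have hS₃ : Simulates B k θ h Z r y t U e pos keys true
        (R₂.setY 1 (B.e (R₂.x 1) (R₂.x (resReg k 5)))) := by
      have hL : Loaded B k θ h Z (R₂.setY 1 (B.e (R₂.x 1) (R₂.x (resReg k 5)))) :=
        hS₂.loaded.frame (keep := fun _ => True) (Frame.setY (by simp))
      have hF : Frame k (fun _ => True) R₂ (R₂.setY 1 (B.e (R₂.x 1) (R₂.x (resReg k 5)))) :=
        Frame.setY (by simp)
      exact ⟨hL, hS₂.masked.frame hF, fun _ => by simp [Registers.setY_y, hsol],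
        fun γ i => (hS₂.tuple γ i).frame hF trivial, by simp,
        fun v i hv => (hS₂.user v i hv).frame hF trivial, by simp⟩
    exact run_challengeKnown hS₃ γ seats S hseats ζ hζ (p true) F fun R' s' => hp true R' s'
  · have hd : R₂.x (resReg k 4) ≠ R₂.x (k + 1) := by
      rw [e4, hS₂.loaded.one, Ne, B.exp_eq_one_iff]
      exact hbad
    rw [dif_neg hbad]
    simp only [hd, decide_false, Bool.false_eq_true, if_false]
    obtain ⟨x', h1', h2', h3'⟩ := run_compMany B A k 11 (by omega) (by omega)
      (.pair 2 (resReg k 7) (resReg k 4) <| .mulT 2 2 0 <| .pair 3 1 (resReg k 5) <|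
        .invT 3 3 <| .mulT 2 2 3 <| .reply (.challenge (resReg k 4) (resReg k 6) 2) (p false))
      (embedWords k γ seats S) (by simp [embedWords, adr_inj])
      (by simp [embedWords, adr_inj, kind_adr])
      (by
        intro dw hdw l hl
        simp only [embedWords, List.mem_cons, List.not_mem_nil, or_false] at hdw
        rcases hdw with rfl | rfl
        · obtain ⟨id, rfl⟩ := mem_shareWord hl
          simp [kind_adr]
        · rcases List.mem_append.1 hl with hl | hl
          · obtain ⟨id, rfl⟩ := mem_shareWord hl
            simp [kind_adr]
          · obtain rfl := List.mem_singleton.1 hl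
            rw [kind_of_lt (by dsimp only; omega)]
            omega) R₂ hS₂.loaded.one (some s)
    rw [h1']
    set R₃ : Registers q G GT := { R₂ with x := x' } with hR₃
    have hS₃ : Simulates B k θ h Z r y t U e pos keys false R₃ := by
      refine hS₂.frame (Frame.of_comp h2' fun d hd => ?_) rfl
      simp only [embedWords, List.map_cons, List.map_nil, List.mem_cons, List.not_mem_nil,
        or_false] at hd
      rcases hd with rfl | rfl <;> exact ⟨_, _, _, rfl, by simp⟩
    have f4 : R₃.x (resReg k 4) = B.exp (c + h) :=
      (h2' _ (by simp [adr_inj]) (by simp [embedWords, adr_inj])).trans e4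
    have f5 : R₃.x (resReg k 5) = B.exp (-(θ ^ k * c)) :=
      (h2' _ (by simp [adr_inj]) (by simp [embedWords, adr_inj])).trans e5
    have f1 : R₃.x 1 = B.exp θ := by
      rw [hS₃.loaded.power 1 (by omega) (by omega), pow_one]
    -- The zero is the sum of the shifts `shiftA`, written so that the masked evaluation applies.
    have f6 : R₃.x (resReg k 6) = B.exp ((c + h) *
        (∑ j, (maskedExponents θ r y t).share keys γ seats S Prod.fst j - 0)) := by
      refine (h3' (resReg k 6, _) List.mem_cons_self).trans ?_
      rw [← sum_shiftA (k := k) (θ := θ) hn]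
      exact evals_shareWord_mask γ seats S hSU _ (c + h) Prod.fst (shiftA k θ)
        (fun id => R₂.s (aMask k id)) hseats he (fun id => Evals.pow e4)
        (fun γ i => (hS₂.tuple_shift rfl γ i).1) fun v i hv => (hS₂.user_shift rfl v i hv).1
    -- The summand rθ^k is the computable part of (r+θ)θ^k; the remaining θ^(k+1) is left to Z and
    -- `resReg k 5`.
    have f7 : R₃.x (resReg k 7) = B.exp ((r + θ) *
        (∑ j, (maskedExponents θ r y t).share keys γ seats S Prod.snd j - θ ^ k) + θ ^ k * r) := by
      refine (h3' (resReg k 7, _) (List.mem_cons_of_mem _ List.mem_cons_self)).trans ?_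
      rw [← sum_shiftB (k := k) (θ := θ) hn]
      refine Evals.append (evals_shareWord_mask γ seats S hSU _ (r + θ) Prod.snd (shiftB k θ)
        (fun id => R₂.s (bMask k id)) hseats he (fun id => Evals.pow hS₂.masked.u)
        (fun γ i => (hS₂.tuple_shift rfl γ i).2) fun v i hv => (hS₂.user_shift rfl v i hv).2) ?_
      rw [sum_shiftB hn]
      exact (Evals.pow (hS₂.loaded.power k (by omega) (by omega))).congr (by rw [hS₂.masked.r])
    simp only [Program.run, PMF.monad_bind_eq_bind]
    refine congrArg₂ PMF.bind (congrArg (A.receive s) ?_) (funext fun s' => hp false _ s' ?_)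
    · have hZ : R₃.y 0 = Z := hS₃.loaded.Z
      simp only [Answer.map, challengeAnswer, Registers.setY, Function.update_apply, f1, f4, f5,
        f6, f7, hZ, hζ, B.e_exp, if_true, if_false,
        Nat.reduceEqDiff, OfNat.zero_ne_ofNat, Units.val_mk0, sub_zero]
      congr 1
      · rw [mul_comm]
      · rw [← B.expT_neg, ← mul_assoc, mul_right_comm, ← B.expT_add, ← B.expT_add]
        congr 2
        simp only [maskedExponents]
        ring
    · refine hS₃.frame (((Frame.setY ?_).trans (Frame.setY ?_)).trans
        ((Frame.setY ?_).trans ((Frame.setY ?_).trans (Frame.setY ?_)))) ?_ <;>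
        simp [Registers.setY_y]

end Challenge

/-! ### Executing the challenger's actions -/

section Handle

variable {q : ℕ} [Fact q.Prime] {G GT : Type} [CommGroup G] [CommGroup GT] {users n tuples : ℕ}

/-- The action concerns registered users at their positions, and gives no secret of a user in `U`
away. -/
def Act.Valid (pos : Fin users → Option (Fin n)) (U : Finset (Fin users)) :
    Act users n tuples → Prop
  | .refuse => True
  | .showKey v i => pos v = some i
  | .newKey v _ => pos v = none
  | .privateKey v i => pos v = some i ∧ v ∉ U
  | .form _ _ i seats =>
    (∀ j v, seats j = some v → pos v = some j) ∧ ∃ v, seats i = some v ∧ v ∉ U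
  | .update _ _ _ seats => ∀ j v, seats j = some v → pos v = some j
  | .decryptionKey _ seats i =>
    (∀ j v, seats j = some v → pos v = some j) ∧ ∃ v, seats i = some v ∧ v ∉ U
  | .challenge S _ seats => (∀ j v, seats j = some v → pos v = some j) ∧ S ⊆ U

/-- The positions of the users after the action. -/
def Act.newPos (pos : Fin users → Option (Fin n)) : Act users n tuples → Fin users → Option (Fin n)
  | .newKey v i => Function.update pos v (some i)
  | _ => pos

/-- Admissibility of the queries is what guarantees that the simulator is never asked for a diagonal
entry of a user in `U`. -/
theorem SymState.plan_valid {st : SymState users n tuples} (hst : st.Seated) (N L : ℕ)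
    (U : Finset (Fin users)) (x : Query users n tuples) :
    (st.plan N L U x).1.Valid st.pos U ∧
      (st.plan N L U x).2.pos = (st.plan N L U x).1.newPos st.pos := by
  cases x with
  | register γ v i =>
    simp only [SymState.plan]
    split
    · exact ⟨by assumption, rfl⟩
    · exact ⟨by assumption, rfl⟩
  | extract v =>
    simp only [SymState.plan]
    split
    · split
      · exact ⟨trivial, rfl⟩
      · exact ⟨⟨by assumption, by assumption⟩, rfl⟩
    · exact ⟨trivial, rfl⟩
  | execute γ i seats =>
    simp only [SymState.plan]
    split
    · rename_i h
      obtain ⟨v, hv⟩ := Option.isSome_iff_exists.1 h.2.1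
      exact ⟨⟨fun j v hv => (h.2.2 j v hv).1, v, hv, (h.2.2 i v hv).2⟩, rfl⟩
    · exact ⟨trivial, rfl⟩
  | join v π =>
    simp only [SymState.plan]
    split
    · rename_i gr I hgr hv
      split
      · rename_i seats hs
        split
        · refine ⟨fun j w hw => ?_, rfl⟩
          by_cases hj : j = I
          · subst hj
            rw [Function.update_self] at hw
            obtain rfl := Option.some.inj hw
            exact hv
          · rw [Function.update_of_ne hj] at hw
            exact hst gr (List.mem_of_getElem? hgr) seats (List.mem_of_getLast? hs) j w hw
        · exact ⟨trivial, rfl⟩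
      · exact ⟨trivial, rfl⟩
    · exact ⟨trivial, rfl⟩
  | leave π J =>
    simp only [SymState.plan]
    split
    · rename_i gr hgr
      split
      · rename_i seats hs
        split
        · refine ⟨fun j w hw => ?_, rfl⟩
          by_cases hj : j = J
          · subst hj
            simp at hw
          · rw [Function.update_of_ne hj] at hw
            exact hst gr (List.mem_of_getElem? hgr) seats (List.mem_of_getLast? hs) j w hw
        · exact ⟨trivial, rfl⟩
      · exact ⟨trivial, rfl⟩
    · exact ⟨trivial, rfl⟩
  | reveal v π l =>
    simp only [SymState.plan]
    split
    · rename_i gr i hgr hv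
      split
      · rename_i seats hs
        split
        · rename_i h
          exact ⟨⟨fun j w hw => hst gr (List.mem_of_getElem? hgr) seats (List.mem_of_getElem? hs)
            j w hw, v, h⟩, rfl⟩
        · exact ⟨trivial, rfl⟩
      · exact ⟨trivial, rfl⟩
    · exact ⟨trivial, rfl⟩
  | test S π l =>
    simp only [SymState.plan]
    split
    · rename_i gr hgr
      split
      · rename_i seats hs
        split
        · rename_i h
          exact ⟨⟨fun j w hw => hst gr (List.mem_of_getElem? hgr) seats (List.mem_of_getElem? hs)
            j w hw, h.2.1⟩, rfl⟩
        · exact ⟨trivial, rfl⟩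
      · exact ⟨trivial, rfl⟩
    · exact ⟨trivial, rfl⟩

open Classical in
/-- Take the given action, then continue with `p`, which receives the information whether the
solution of the `k`-BDHE problem is known. A challenge that the pattern `e` does not fit leads to
`fail`. -/
noncomputable def handle (k : ℕ) (e : Fin n → Bool) (U : Finset (Fin users)) (w : Bool)
    (p : Bool → Program users n tuples) (fail : Program users n tuples) :
    Act users n tuples → Program users n tuples
  | .refuse => .reply .refused (p w)
  | .showKey v i => .reply (.publicKey i (pubAddresses k (userRow v) i)) (p w)
  | .newKey v i =>
    if v ∈ U ∧ e i = true then
      genShifted k (userRow v) i w fun w' =>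
        .reply (.publicKey i (pubAddresses k (userRow v) i)) (p w')
    else
      genKnown k (userRow v) <| .reply (.publicKey i (pubAddresses k (userRow v) i)) (p w)
  | .privateKey v i => .reply (.privateKey (kReg k (userRow v) i)) (p w)
  | .form π γ i seats =>
    compMany k (infoWords k γ seats ++ [(resReg k 2, decWord k γ seats i)]) <|
      .reply (.formed ⟨π, 0, seats, resReg k 0, resReg k 1⟩ (resReg k 2)) (p w)
  | .update π l γ seats =>
    compMany k (infoWords k γ seats) <|
      .reply (.updated ⟨π, l, seats, resReg k 0, resReg k 1⟩) (p w)
  | .decryptionKey γ seats i =>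
    compMany k [(resReg k 2, decWord k γ seats i)] <| .reply (.decryptionKey (resReg k 2)) (p w)
  | .challenge S γ seats =>
    if e = requiredPattern U S seats then
      if w then challengeKnown k γ seats S (p true) else challengeEmbed k γ seats S p
    else fail

/-- The number of steps for an action. -/
def actCost (n : ℕ) : ℕ := rowCost n + 36 * n + 61

theorem length_decWord_le (k : ℕ) (γ : Fin tuples) (seats : Fin n → Option (Fin users))
    (i : Fin n) : (decWord k γ seats i).length ≤ n :=
  (length_overPositions (c := 1) _ (by simp)).trans (by omega)

theorem length_infoWords_le (k : ℕ) (γ : Fin tuples) (seats : Fin n → Option (Fin users)) :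
    ∀ dw ∈ infoWords k γ seats, dw.2.length ≤ n := by
  intro dw hdw
  simp only [infoWords, List.mem_cons, List.not_mem_nil, or_false] at hdw
  rcases hdw with rfl | rfl <;> simpa using length_overPositions (c := 1) _ (by simp)

theorem handle_halts {k u u' : ℕ} (e : Fin n → Bool) (U : Finset (Fin users)) (w : Bool)
    {p : Bool → Program users n tuples} {fail : Program users n tuples}
    (hp : ∀ w, (p w).HaltsWithin u) (hfail : fail.HaltsWithin u') (hu : u' ≤ u)
    (act : Act users n tuples) : (handle k e U w p fail act).HaltsWithin (u + actCost n) := by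
  have hreply : ∀ w (ans : Answer users n ℕ ℕ), (Program.reply ans (p w)).HaltsWithin (u + 1) :=
    fun w _ => hp w
  have hpos : ∀ (ans : Answer users n ℕ ℕ), (Program.reply ans (p w)).HaltsWithin (u + actCost n) :=
    fun ans => (hreply w ans).mono (by unfold actCost; omega)
  cases act with
  | refuse => exact hpos _
  | showKey v i => exact hpos _
  | newKey v i =>
    simp only [handle]
    split
    · exact (genShifted_halts i w fun w' => hreply w' _).mono (by unfold actCost; omega)
    · exact (genKnown_halts (hreply w _)).mono (by unfold actCost; omega)
  | privateKey v i => exact hpos _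
  | form π γ i seats =>
    refine (compMany_halts (c := n) (hreply w _) _ ?_).mono ?_
    · intro dw hdw
      rcases List.mem_append.1 hdw with hdw | hdw
      · exact length_infoWords_le k γ seats dw hdw
      · obtain rfl := List.mem_singleton.1 hdw
        exact length_decWord_le k γ seats i
    · simp only [infoWords, List.length_append, List.length_cons, List.length_nil, actCost]
      omega
  | update π l γ seats =>
    refine (compMany_halts (c := n) (hreply w _) _ (length_infoWords_le k γ seats)).mono ?_
    simp only [infoWords, List.length_cons, List.length_nil, actCost]
    omega
  | decryptionKey γ seats i =>
    refine (compMany_halts (c := n) (hreply w _) _ ?_).mono ?_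
    · simpa using length_decWord_le k γ seats i
    · simp only [List.length_cons, List.length_nil, actCost]
      omega
  | challenge S γ seats =>
    simp only [handle]
    split
    · split
      · exact (challengeKnown_halts γ seats S (hp true)).mono (by unfold actCost; omega)
      · exact (challengeEmbed_halts γ seats S hp).mono (by unfold actCost; omega)
    · exact hfail.mono (by omega)

variable {B : BilinearGroups q G GT} {A : Adversary users n tuples G GT} {k : ℕ} {θ h r : ZMod q}
  {Z : GT} {y : Fin n → ZMod q} {t : Fin tuples → Fin n → (ZMod q)ˣ × (ZMod q)ˣ}
  {U : Finset (Fin users)} {e : Fin n → Bool} {pos : Fin users → Option (Fin n)}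
  {keys : Fin users → (ZMod q)ˣ × (ZMod q)ˣ} {w : Bool} {R R' : Registers q G GT} {s : A.σ}

/-- Products that are computed into the registers for results leave the simulation intact. -/
theorem Simulates.run_compMany (hS : Simulates B k θ h Z r y t U e pos keys w R)
    (l : List (ℕ × List Letter)) (hl : (l.map Prod.fst).Nodup)
    (hd : ∀ dw ∈ l, ∃ c < 15, dw.1 = resReg k c)
    (hw : ∀ dw ∈ l, ∀ a ∈ dw.2, kind k a.reg < 6) (p : Program users n tuples) (s : Option A.σ) :
    ∃ R', (compMany k l p).run B A R s = p.run B A R' s ∧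
      Simulates B k θ h Z r y t U e pos keys w R' ∧ ∀ dw ∈ l, R'.x dw.1 = wordVal R dw.2 := by
  obtain ⟨x, h1, h2, h3⟩ := _root_.run_compMany B A k 6 (by omega) (by omega) p l hl
    (by
      intro dw hdw
      obtain ⟨c, hc, hdc⟩ := hd dw hdw
      rw [hdc, kind_adr]
      refine ⟨by omega, fun h => ?_⟩
      have := (adr_inj.1 h).1
      omega) hw R hS.loaded.one s
  refine ⟨_, h1, hS.frame (Frame.of_comp h2 fun d hd' => ?_) rfl, h3⟩
  obtain ⟨dw, hdw, rfl⟩ := List.mem_map.1 hd'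
  obtain ⟨c, -, hdc⟩ := hd dw hdw
  exact ⟨_, _, _, hdc, by omega, Or.inl (by omega)⟩

theorem Simulates.infoWords (hS : Simulates B k θ h Z r y t U e pos keys w R) (γ : Fin tuples)
    (seats : Fin n → Option (Fin users)) (hseats : ∀ j v, seats j = some v → pos v = some j)
    (hv : ∀ dw ∈ infoWords k γ seats, R'.x dw.1 = wordVal R dw.2) :
    R'.x (resReg k 0) =
        B.exp (∑ j, (((maskedExponents θ r y t).seat keys γ seats j).1 : ZMod q)) ∧
      R'.x (resReg k 1) =
        B.exp (∑ j, (((maskedExponents θ r y t).seat keys γ seats j).2 : ZMod q)) := by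
  constructor
  · refine (hv (resReg k 0, _) List.mem_cons_self).trans ?_
    exact Evals.overPositions fun j => Evals.reg (hS.seat γ seats hseats j).fst
  · refine (hv (resReg k 1, _) (List.mem_cons_of_mem _ List.mem_cons_self)).trans ?_
    exact Evals.overPositions fun j => Evals.reg (hS.seat γ seats hseats j).snd

theorem Simulates.decWord (hS : Simulates B k θ h Z r y t U e pos keys w R) (γ : Fin tuples)
    (seats : Fin n → Option (Fin users)) (hseats : ∀ j v, seats j = some v → pos v = some j)
    (i : Fin n) (hi : ∃ v, seats i = some v ∧ v ∉ U) :
    wordVal R (decWord k γ seats i) = B.exp ((maskedExponents θ r y t).dec keys γ seats i) := by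
  refine Evals.overPositions fun j => Evals.reg ((hS.seat γ seats hseats j).K i ?_)
  -- Off the own position the entry is public; at the own position the member lies outside `U`, so
  -- its secret entry is known.
  by_cases hij : i = j
  · subst hij
    exact Or.inr hi
  · exact Or.inl hij

theorem kind_infoWords_lt (k : ℕ) (γ : Fin tuples) (seats : Fin n → Option (Fin users)) :
    ∀ dw ∈ infoWords k γ seats, ∀ a ∈ dw.2, kind k a.reg < 6 := by
  intro dw hdw a ha
  simp only [_root_.infoWords, List.mem_cons, List.not_mem_nil, or_false] at hdw
  rcases hdw with rfl | rfl
  · obtain ⟨j, hj⟩ := mem_overPositions.1 ha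
    obtain rfl := List.mem_singleton.1 hj
    simp [kind_adr]
  · obtain ⟨j, hj⟩ := mem_overPositions.1 ha
    obtain rfl := List.mem_singleton.1 hj
    simp [kind_adr]

theorem kind_decWord_lt (k : ℕ) (γ : Fin tuples) (seats : Fin n → Option (Fin users)) (i : Fin n) :
    ∀ a ∈ decWord k γ seats i, kind k a.reg < 6 := by
  intro a ha
  obtain ⟨j, hj⟩ := mem_overPositions.1 ha
  obtain rfl := List.mem_singleton.1 hj
  simp [kind_adr]

/-- The registers after a new user has been registered. -/
theorem Simulates.newKey (hS : Simulates B k θ h Z r y t U e pos keys w R) {v : Fin users}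
    {i : Fin n} (hv : pos v = none) {a b : (ZMod q)ˣ} {w' : Bool} (hww : w' = false → w = false)
    (hF : Frame k (· ≠ userRow v) R R') (hw' : w' = true → R'.y 1 = B.expT (θ ^ (k + 1) * h))
    (hrow : HasRow B k (r + θ) (fun j => y j + θ ^ (j : ℕ)) R' (userRow v)
      (fun j => j ≠ i ∨ v ∉ U) a b)
    (hshift : w' = false →
      R'.s (aMask k (userRow v)) + (if v ∈ U ∧ e i = true then shiftA k θ i else 0) = a ∧
      R'.s (bMask k (userRow v)) + (if v ∈ U ∧ e i = true then shiftB k θ i else 0) = b) :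
    Simulates B k θ h Z r y t U e (Function.update pos v (some i)) (Function.update keys v (a, b))
      w' R' := by
  have hs : ∀ id, id ≠ userRow v →
      R'.s (aMask k id) = R.s (aMask k id) ∧ R'.s (bMask k id) = R.s (bMask k id) :=
    fun id hid => ⟨hF.s _ _ _ (by simp [hid]), hF.s _ _ _ (by simp [hid])⟩
  refine ⟨hS.loaded.frame hF, hS.masked.frame hF, hw',
    fun γ i => (hS.tuple γ i).frame hF (userRow_ne_tupleRow v γ i).symm, fun hw γ i => ?_,
    fun v' i' hv' => ?_, fun hw v' i' hv' => ?_⟩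
  · rw [(hs _ (userRow_ne_tupleRow v γ i).symm).1, (hs _ (userRow_ne_tupleRow v γ i).symm).2]
    exact hS.tuple_shift (hww hw) γ i
  · by_cases h : v' = v
    · subst h
      rw [Function.update_self] at hv' ⊢
      obtain rfl := Option.some.inj hv'
      exact hrow
    · rw [Function.update_of_ne h] at hv' ⊢
      exact (hS.user v' i' hv').frame hF fun h' => h (userRow_inj.1 h')
  · by_cases h : v' = v
    · subst h
      rw [Function.update_self] at hv' ⊢
      obtain rfl := Option.some.inj hv'
      exact hshift hw
    · rw [Function.update_of_ne h] at hv' ⊢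
      have hne : userRow v' ≠ userRow v := fun h' => h (userRow_inj.1 h')
      rw [(hs _ hne).1, (hs _ hne).2]
      exact hS.user_shift (hww hw) v' i' hv'

end Handle

/-! ### The simulated query phase -/

section Simulate

variable {q : ℕ} [Fact q.Prime] {G GT : Type} [CommGroup G] [CommGroup GT] {users n tuples : ℕ}

variable {B : BilinearGroups q G GT} {A : Adversary users n tuples G GT} {k : ℕ} {θ h r : ZMod q}
  {Z : GT} {y : Fin n → ZMod q} {t : Fin tuples → Fin n → (ZMod q)ˣ × (ZMod q)ˣ}
  {U : Finset (Fin users)} {e : Fin n → Bool} {pos : Fin users → Option (Fin n)}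
  {keys : Fin users → (ZMod q)ˣ × (ZMod q)ˣ} {w : Bool} {R R' : Registers q G GT} {s : A.σ}

/-- For a fitting pattern the simulation is exact: answer and new keys have precisely the
challenger's law, whatever `w` is. A misfit shows only at the challenge and then leads to `fail`,
which relies on nothing but the loaded instance. -/
theorem run_handle (hnk : n ≤ k) (hn : 0 < n)
    (hS : Simulates B k θ h Z r y t U e pos keys w R) (ζ : GT)
    (hζ : Z = B.expT (θ ^ (k + 1) * h) * ζ) (act : Act users n tuples) (hact : act.Valid pos U)
    (p : Bool → Program users n tuples) (fail : Program users n tuples)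
    (F : (Fin users → (ZMod q)ˣ × (ZMod q)ˣ) → A.σ → PMF Bool) (Ff : PMF Bool)
    (hp : ∀ w' keys' R' s', Simulates B k θ h Z r y t U e (act.newPos pos) keys' w' R' →
      (p w').run B A R' (some s') = F keys' s')
    (hfail : ∀ R' s', Loaded B k θ h Z R' → fail.run B A R' s' = Ff) :
    (handle k e U w p fail act).run B A R (some s) =
      if act.passes (fun S seats => decide (e = requiredPattern U S seats)) then
        ((maskedExponents θ r y t).respond B ζ keys act).bind fun z =>
          (A.receive s z.1).bind (F z.2)
      else Ff := by
  cases act with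
  | refuse =>
    simp only [handle, Act.passes, if_true, Exponents.respond, PMF.pure_bind, Program.run,
      Answer.map, PMF.monad_bind_eq_bind]
    exact congrArg _ (funext fun s' => hp w keys R s' hS)
  | showKey v i =>
    simp only [handle, Act.passes, if_true, Exponents.respond, PMF.pure_bind, Program.run,
      Answer.map, PMF.monad_bind_eq_bind]
    rw [HasRow.map_pubAddresses (t := t) (ab := keys v) (fun j hj => Or.inl hj)
      (hS.user v i hact)]
    exact congrArg _ (funext fun s' => hp w keys R s' hS)
  | newKey v i =>
    simp only [handle, Act.passes, if_true, Exponents.respond, PMF.pure_bind, PMF.bind_bind]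
    have hcont : ∀ (w' : Bool) (a b : (ZMod q)ˣ) (R' : Registers q G GT),
        (w' = false → w = false) → Frame k (· ≠ userRow v) R R' →
        (w' = true → R'.y 1 = B.expT (θ ^ (k + 1) * h)) →
        HasRow B k (r + θ) (fun j => y j + θ ^ (j : ℕ)) R' (userRow v) (fun j => j ≠ i ∨ v ∉ U)
          a b →
        (w' = false →
          R'.s (aMask k (userRow v)) + (if v ∈ U ∧ e i = true then shiftA k θ i else 0) = a ∧
          R'.s (bMask k (userRow v)) + (if v ∈ U ∧ e i = true then shiftB k θ i else 0) = b) →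
        (Program.reply (.publicKey i (pubAddresses k (userRow v) i)) (p w')).run B A R' (some s) =
          (A.receive s (.publicKey i (((maskedExponents θ r y t).row B (a, b)).pub i))).bind
            (F (Function.update keys v (a, b))) := by
      intro w' a b R' hww hF hw' hrow hshift
      simp only [Program.run, Answer.map, PMF.monad_bind_eq_bind]
      rw [HasRow.map_pubAddresses (t := t) (ab := (a, b)) (fun j hj => Or.inl hj) hrow]
      exact congrArg _ (funext fun s' => hp w' _ R' s'
        (hS.newKey hact hww hF hw' hrow hshift))
    split
    · rename_i hvi
      refine run_genShifted hnk hS.loaded hS.masked (userRow v) i w hS.solution _ _ ?_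
      intro a b w' R' hww hF hw' hrow hshift
      refine hcont w' a b R' hww hF hw' ⟨hrow.fst, hrow.snd, fun j hj => hrow.K j ?_⟩ ?_
      · exact hj.resolve_right fun h => h hvi.1
      · simpa only [hvi, and_self, if_true] using hshift
    · rename_i hvi
      refine run_genKnown hS.loaded hS.masked (userRow v) _ _ ?_
      intro a b R' hF hy hrow ha hb
      refine hcont w a b R' id hF (fun hw => by rw [hy]; exact hS.solution hw)
        ⟨hrow.fst, hrow.snd, fun j _ => hrow.K j trivial⟩ ?_
      intro _
      simp only [hvi, if_false, add_zero]
      exact ⟨ha, hb⟩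
  | privateKey v i =>
    simp only [handle, Act.passes, if_true, Exponents.respond, PMF.pure_bind, Program.run,
      Answer.map, PMF.monad_bind_eq_bind]
    rw [(hS.user v i hact.1).K i (Or.inr hact.2)]
    exact congrArg _ (funext fun s' => hp w keys R s' hS)
  | form π γ i seats =>
    simp only [handle, Act.passes, if_true, Exponents.respond, PMF.pure_bind]
    obtain ⟨R', h1, h2, h3⟩ := hS.run_compMany (A := A)
      (infoWords k γ seats ++ [(resReg k 2, decWord k γ seats i)])
      (by simp [infoWords, adr_inj])
      (by
        intro dw hdw
        simp only [infoWords, List.cons_append, List.nil_append, List.mem_cons, List.not_mem_nil,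
          or_false] at hdw
        rcases hdw with rfl | rfl | rfl
        exacts [⟨0, by omega, rfl⟩, ⟨1, by omega, rfl⟩, ⟨2, by omega, rfl⟩])
      (by
        intro dw hdw
        rcases List.mem_append.1 hdw with hdw | hdw
        · exact kind_infoWords_lt k γ seats dw hdw
        · obtain rfl := List.mem_singleton.1 hdw
          exact kind_decWord_lt k γ seats i) _ (some s)
    obtain ⟨hY₁, hY₂⟩ := hS.infoWords γ seats hact.1
      fun dw hdw => h3 dw (List.mem_append_left _ hdw)
    have hd := (h3 (resReg k 2, _) (List.mem_append_right _ (List.mem_singleton_self _))).trans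
      (hS.decWord γ seats hact.1 i hact.2)
    rw [h1]
    simp only [Program.run, Answer.map, GroupInfo.map, PMF.monad_bind_eq_bind, hY₁, hY₂, hd]
    exact congrArg _ (funext fun s' => hp w keys R' s' h2)
  | update π l γ seats =>
    simp only [handle, Act.passes, if_true, Exponents.respond, PMF.pure_bind]
    obtain ⟨R', h1, h2, h3⟩ := hS.run_compMany (A := A) (infoWords k γ seats)
      (by simp [infoWords, adr_inj])
      (by
        intro dw hdw
        simp only [infoWords, List.mem_cons, List.not_mem_nil, or_false] at hdw
        rcases hdw with rfl | rfl
        exacts [⟨0, by omega, rfl⟩, ⟨1, by omega, rfl⟩])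
      (kind_infoWords_lt k γ seats) _ (some s)
    obtain ⟨hY₁, hY₂⟩ := hS.infoWords γ seats hact h3
    rw [h1]
    simp only [Program.run, Answer.map, GroupInfo.map, PMF.monad_bind_eq_bind, hY₁, hY₂]
    exact congrArg _ (funext fun s' => hp w keys R' s' h2)
  | decryptionKey γ seats i =>
    simp only [handle, Act.passes, if_true, Exponents.respond, PMF.pure_bind]
    obtain ⟨R', h1, h2, h3⟩ := hS.run_compMany (A := A) [(resReg k 2, decWord k γ seats i)]
      (by simp)
      (by
        intro dw hdw
        obtain rfl := List.mem_singleton.1 hdw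
        exact ⟨2, by omega, rfl⟩)
      (by
        intro dw hdw
        obtain rfl := List.mem_singleton.1 hdw
        exact kind_decWord_lt k γ seats i) _ (some s)
    have hd := (h3 (resReg k 2, _) (List.mem_singleton_self _)).trans
      (hS.decWord γ seats hact.1 i hact.2)
    rw [h1]
    simp only [Program.run, Answer.map, PMF.monad_bind_eq_bind, hd]
    exact congrArg _ (funext fun s' => hp w keys R' s' h2)
  | challenge S γ seats =>
    simp only [handle, Act.passes, Exponents.respond, PMF.pure_bind, PMF.bind_bind,
      decide_eq_true_eq]
    split
    · rename_i he
      cases w with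
      | true =>
        exact run_challengeKnown hS γ seats S hact.1 ζ hζ (p true) (F keys)
          fun R' s' h => hp true keys R' s' h
      | false =>
        exact run_challengeEmbed (by omega) hn hS γ seats S hact.2 he hact.1 ζ hζ p (F keys)
          fun w' R' s' h => hp w' keys R' s' h
    · exact hfail R (some s) hS.loaded

/-- The query phase of a simulation with the pattern `e`. -/
noncomputable def simulate (k N L : ℕ) (e : Fin n → Bool) (U : Finset (Fin users))
    (fail : Program users n tuples) :
    ℕ → SymState users n tuples → Bool → Program users n tuples
  | 0, st, _ => if st.tested || decide (e = fun _ => true) then .guess .output else fail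
  | m + 1, st, w => .query fun x =>
      handle k e U w (simulate k N L e U fail m (st.plan N L U x).2) fail (st.plan N L U x).1

/-- The cost `u` of `fail` is paid once, since entering `fail` abandons the simulation. -/
theorem simulate_halts {k u : ℕ} (N L : ℕ) (e : Fin n → Bool) (U : Finset (Fin users))
    {fail : Program users n tuples} (hfail : fail.HaltsWithin u) (m : ℕ)
    (st : SymState users n tuples) (w : Bool) :
    (simulate k N L e U fail m st w).HaltsWithin (u + 1 + m * (actCost n + 1)) := by
  induction m generalizing st w with
  | zero =>
    unfold simulate
    split
    · rw [zero_mul, add_zero]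
      intro b
      cases u <;> trivial
    · exact hfail.mono (by omega)
  | succ m ih =>
    have h : (simulate k N L e U fail (m + 1) st w).HaltsWithin
        (u + 1 + m * (actCost n + 1) + actCost n + 1) := fun x =>
      handle_halts e U w (fun w' => ih _ w') hfail (by omega) _
    exact h.mono (by ring_nf; omega)

/-- The output of a run of a simulation, if failure leads to the distribution `Ff`. -/
noncomputable def orElse (P : PMF (Option Bool)) (Ff : PMF Bool) : PMF Bool :=
  P.bind fun o => o.elim Ff PMF.pure

theorem orElse_bind {α : Type} (P : PMF α) (f : α → PMF (Option Bool)) (Ff : PMF Bool) :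
    orElse (P.bind f) Ff = P.bind fun a => orElse (f a) Ff := PMF.bind_bind _ _ _

theorem orElse_none (Ff : PMF Bool) : orElse (PMF.pure none) Ff = Ff := PMF.pure_bind _ _

/-- Induction on the remaining queries, keeping the register invariant; the outcome `none` of the
symbolic phase corresponds to running `fail`. -/
theorem run_simulate (hnk : n ≤ k) (hn : 0 < n) (N L : ℕ) (ζ : GT)
    (hζ : Z = B.expT (θ ^ (k + 1) * h) * ζ) (fail : Program users n tuples) (Ff : PMF Bool)
    (hfail : ∀ R' s', Loaded B k θ h Z R' → fail.run B A R' s' = Ff) (m : ℕ)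
    (st : SymState users n tuples) (hst : st.Seated)
    (hS : Simulates B k θ h Z r y t U e st.pos keys w R) :
    (simulate k N L e U fail m st w).run B A R (some s) =
      orElse (symPhase B N L A (maskedExponents θ r y t) ζ U
        (fun S seats => decide (e = requiredPattern U S seats)) (decide (e = fun _ => true)) m st
        keys s) Ff := by
  induction m generalizing st keys w R s with
  | zero =>
    unfold simulate symPhase
    split
    · simp only [Program.run, PMF.monad_bind_eq_bind, PMF.monad_pure_eq_pure, orElse]
      rw [PMF.bind_map]
      rfl
    · rw [orElse_none]
      exact hfail R _ hS.loaded
  | succ m ih =>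
    simp only [simulate, symPhase, Program.run, PMF.monad_bind_eq_bind, orElse_bind]
    refine congrArg _ (funext fun x => ?_)
    obtain ⟨hv, hpos⟩ := SymState.plan_valid hst N L U x.1
    rw [run_handle hnk hn hS ζ hζ (st.plan N L U x.1).1 hv _ fail _ Ff
      (fun w' keys' R' s' hS' => ih (st.plan N L U x.1).2 (hst.plan N L U x.1) (hpos ▸ hS')) hfail]
    split
    · simp only [orElse_bind]
    · rw [orElse_none]

end Simulate

/-! ### One trial: system parameters and query phase -/

section Trial

variable {q : ℕ} [Fact q.Prime] {G GT : Type} [CommGroup G] [CommGroup GT] {users n tuples : ℕ}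

/-- Generate a random element times the input element `i` in the register `d`. -/
def genMasked (k d i : ℕ) (p : Program users n tuples) : Program users n tuples :=
  .sample d <| compMany k [(d, [⟨i, none, false⟩] ++ [⟨0, some d, false⟩])] p

/-- Generate the `h j` for the listed positions. -/
def genBases (k : ℕ) (p : Program users n tuples) : List (Fin n) → Program users n tuples
  | [] => p
  | j :: l => genMasked k (hReg k j) j (genBases k p l)

/-- Generate the listed rows of tuples. -/
def genTuples (k : ℕ) (p : Bool → Program users n tuples) :
    List (Fin tuples × Fin n) → Bool → Program users n tuples
  | [], w => p w
  | x :: l, w => genShifted k (tupleRow x.1 x.2) x.2 w (genTuples k p l)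

/-- The addresses of the system parameters. -/
def paramAddresses (k n tuples : ℕ) : PubParams n tuples ℕ where
  u := uReg k
  h j := hReg k j
  tuple γ i := pubAddresses k (tupleRow γ i) i

/-- Run the adversary in a simulation with the pattern `e`, and then `fail` if the pattern does not
fit. -/
noncomputable def trial (k N L m : ℕ) (e : Fin n → Bool) (fail : Program users n tuples) :
    Program users n tuples :=
  genMasked k (uReg k) 1 <| genBases k
    (genTuples k
      (fun w => .start (paramAddresses k n tuples) fun U =>
        simulate k N L e U fail m (SymState.init users n tuples) w)
      ((List.finRange tuples).product (List.finRange n)) false)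
    (List.finRange n)

theorem genMasked_halts {k d i u : ℕ} {p : Program users n tuples} (hp : p.HaltsWithin u) :
    (genMasked k d i p).HaltsWithin (u + 8) :=
  compMany_halts (k := k) (c := 2) hp [(d, [Letter.mk i none false] ++ [Letter.mk 0 (some d) false])]
    (by simp)

theorem genBases_halts {k u : ℕ} {p : Program users n tuples} (hp : p.HaltsWithin u)
    (l : List (Fin n)) : (genBases k p l).HaltsWithin (u + l.length * 8) := by
  induction l with
  | nil => simpa [genBases] using hp
  | cons j l ih => exact (genMasked_halts ih).mono (by rw [List.length_cons]; omega)

theorem genTuples_halts {k u : ℕ} {p : Bool → Program users n tuples}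
    (hp : ∀ w, (p w).HaltsWithin u) (l : List (Fin tuples × Fin n)) (w : Bool) :
    (genTuples k p l w).HaltsWithin (u + l.length * rowCost n) := by
  induction l generalizing w with
  | nil => simpa [genTuples] using hp w
  | cons x l ih =>
    exact (genShifted_halts x.2 w ih).mono (by rw [List.length_cons, Nat.succ_mul]; omega)

theorem trial_halts {k u : ℕ} (N L m : ℕ) (e : Fin n → Bool) {fail : Program users n tuples}
    (hfail : fail.HaltsWithin u) :
    (trial k N L m e fail).HaltsWithin
      (u + (m * (actCost n + 1) + tuples * (n * rowCost n) + (8 * n + 10))) := by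
  have h1 : ∀ w, (Program.start (paramAddresses k n tuples) fun U =>
      simulate k N L e U fail m (SymState.init users n tuples) w).HaltsWithin
      (u + 1 + m * (actCost n + 1) + 1) := fun w U => simulate_halts N L e U hfail m _ w
  have h2 := genMasked_halts (k := k) (d := uReg k) (i := 1) (genBases_halts (k := k)
    (genTuples_halts (k := k) h1 ((List.finRange tuples).product (List.finRange n)) false)
    (List.finRange n))
  refine h2.mono ?_
  rw [show ((List.finRange tuples).product (List.finRange n)).length = tuples * n by
    simp [List.product, List.length_flatMap], List.length_finRange, mul_assoc]
  omega

variable {B : BilinearGroups q G GT} {A : Adversary users n tuples G GT} {k : ℕ} {θ h r : ZMod q}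
  {Z : GT} {y : Fin n → ZMod q} {R R' : Registers q G GT} {s : Option A.σ}

/-- Needed while u and the h_j are written, when `Frame` is not available because it protects these
registers too. -/
theorem Loaded.of_eq (hR : Loaded B k θ h Z R) (hx : ∀ a, a < 2 * k + 2 → R'.x a = R.x a)
    (hy : R'.y 0 = R.y 0) : Loaded B k θ h Z R' :=
  ⟨fun i hi hi' => (hx i (by omega)).trans (hR.power i hi hi'),
    (hx _ (by omega)).trans hR.one, (hx _ (by omega)).trans hR.Q, hy.trans hR.Z⟩

theorem run_genMasked (hR : Loaded B k θ h Z R) (t j i : ℕ) (ht : t < 20) (hi : i ≤ 2 * k)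
    (hi' : i ≠ k + 1) (p : Program users n tuples) (F : ZMod q → PMF Bool)
    (hp : ∀ (a : ZMod q) (R' : Registers q G GT), Loaded B k θ h Z R' →
      R'.x (adr k t j 0) = B.exp (a + θ ^ i) → R'.s (adr k t j 0) = a →
      (∀ t' j', t' < 20 → adr k t' j' 0 ≠ adr k t j 0 →
        R'.x (adr k t' j' 0) = R.x (adr k t' j' 0) ∧
          R'.s (adr k t' j' 0) = R.s (adr k t' j' 0)) → p.run B A R' s = F a) :
    (genMasked k (adr k t j 0) i p).run B A R s = (PMF.uniformOfFintype (ZMod q)).bind F := by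
  refine congrArg _ (funext fun a => ?_)
  set R₁ := R.setS (adr k t j 0) a with hR₁
  have hs : R₁.s (adr k t j 0) = a := by simp [hR₁, Registers.setS_s]
  have hL₁ : Loaded B k θ h Z R₁ := hR.of_eq (fun _ _ => rfl) rfl
  obtain ⟨x, h1, h2, h3⟩ := run_compMany B A k 1 (by omega) (by omega) p
    [(adr k t j 0, [⟨i, none, false⟩] ++ [⟨0, some (adr k t j 0), false⟩])] (by simp)
    (by
      intro dw hdw
      obtain rfl := List.mem_singleton.1 hdw
      refine ⟨by rw [kind_adr]; omega, fun h => ?_⟩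
      have := (adr_inj.1 h).1
      omega)
    (by
      intro dw hdw l hl
      obtain rfl := List.mem_singleton.1 hdw
      simp only [List.cons_append, List.nil_append, List.mem_cons, List.not_mem_nil,
        or_false] at hl
      rw [kind_of_lt]
      · omega
      rcases hl with rfl | rfl <;> dsimp only <;> omega) R₁ hL₁.one s
  refine h1.trans (hp a _ (hL₁.of_eq (fun a ha => h2 a ?_ ?_) rfl) ?_ hs fun t' j' ht' hne => ?_)
  · rintro rfl
    simp [adr] at ha
  · intro haD
    obtain rfl := List.mem_singleton.1 haD
    simp [adr] at ha
  · refine (h3 _ (List.mem_singleton_self _)).trans ?_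
    refine ((Evals.reg (hL₁.power i hi hi')).append
      (Evals.pow (hL₁.power 0 (by omega) (by omega)))).congr ?_
    rw [hs, pow_zero, one_mul, add_comm]
  · refine ⟨h2 _ (fun h => ?_) (fun h => hne (List.mem_singleton.1 h)), ?_⟩
    · have := (adr_inj.1 h).1
      omega
    · simp [hR₁, Registers.setS_s, hne]

theorem run_genBases (hnk : n ≤ k) (p : Program users n tuples) (F : (Fin n → ZMod q) → PMF Bool)
    (hp : ∀ y R', Loaded B k θ h Z R' → Masked B k θ r y R' → p.run B A R' s = F y)
    (l : List (Fin n)) (y : Fin n → ZMod q) (hR : Loaded B k θ h Z R)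
    (hu : R.x (uReg k) = B.exp (r + θ)) (hr : R.s (uMask k) = r)
    (hy : ∀ j, j ∉ l → R.x (hReg k j) = B.exp (y j + θ ^ (j : ℕ)) ∧ R.s (hMask k j) = y j) :
    (genBases k p l).run B A R s = (PMF.sampleList l y).bind F := by
  induction l generalizing R y with
  | nil =>
    rw [PMF.sampleList, PMF.pure_bind]
    exact hp y R hR ⟨hu, hr, fun j => (hy j (by simp)).1, fun j => (hy j (by simp)).2⟩
  | cons j l ih =>
    rw [PMF.sampleList, PMF.bind_bind]
    refine run_genMasked hR 1 j j (by omega) (by omega) (by omega) _ _ fun a R' hR' hx hs hF => ?_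
    refine ih _ hR' ?_ ?_ fun j' hj' => ?_
    · exact (hF 0 0 (by omega) (by simp [adr_inj])).1.trans hu
    · exact (hF 0 0 (by omega) (by simp [adr_inj])).2.trans hr
    · by_cases hjj : j' = j
      · subst hjj
        rw [Function.update_self]
        exact ⟨hx, hs⟩
      · rw [Function.update_of_ne hjj]
        have hne : (j' : ℕ) ≠ j := fun h => hjj (Fin.ext h)
        have := hF 1 j' (by omega) (by simp [adr_inj, hne])
        have h' := hy j' (by simp [hjj, hj'])
        exact ⟨this.1.trans h'.1, this.2.trans h'.2⟩

/-- The registers hold the system parameters, except for the rows of tuples in `l`. -/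
structure Prepared (B : BilinearGroups q G GT) (k : ℕ) (θ h : ZMod q) (Z : GT) (r : ZMod q)
    (y : Fin n → ZMod q) (l : List (Fin tuples × Fin n))
    (t : Fin tuples × Fin n → (ZMod q)ˣ × (ZMod q)ˣ) (w : Bool) (R : Registers q G GT) : Prop where
  loaded : Loaded B k θ h Z R
  masked : Masked B k θ r y R
  solution : w = true → R.y 1 = B.expT (θ ^ (k + 1) * h)
  tuple : ∀ x, x ∉ l → HasRow B k (r + θ) (fun j => y j + θ ^ (j : ℕ)) R (tupleRow x.1 x.2)
    (· ≠ x.2) (t x).1 (t x).2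
  tuple_shift : w = false → ∀ x, x ∉ l →
    R.s (aMask k (tupleRow x.1 x.2)) + shiftA k θ x.2 = (t x).1 ∧
      R.s (bMask k (tupleRow x.1 x.2)) + shiftB k θ x.2 = (t x).2

theorem run_genTuples (hnk : n ≤ k) (p : Bool → Program users n tuples)
    (F : (Fin tuples × Fin n → (ZMod q)ˣ × (ZMod q)ˣ) → PMF Bool)
    (hp : ∀ t w R', Prepared B k θ h Z r y [] t w R' → (p w).run B A R' s = F t)
    (l : List (Fin tuples × Fin n)) (t : Fin tuples × Fin n → (ZMod q)ˣ × (ZMod q)ˣ) (w : Bool)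
    (hR : Prepared B k θ h Z r y l t w R) :
    (genTuples k p l w).run B A R s = (PMF.sampleList l t).bind F := by
  induction l generalizing R t w with
  | nil =>
    rw [PMF.sampleList, PMF.pure_bind]
    exact hp t w R hR
  | cons x l ih =>
    rw [PMF.sampleList, PMF.bind_bind, PMF.uniformOfFintype_prod_bind]
    refine run_genShifted hnk hR.loaded hR.masked (tupleRow x.1 x.2) x.2 w hR.solution _ _
      fun a b w' R' hww hF hw' hrow hshift => ?_
    have hne : ∀ x' : Fin tuples × Fin n, x' ≠ x → tupleRow x'.1 x'.2 ≠ tupleRow x.1 x.2 :=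
      fun x' hx' h => hx' (Prod.ext_iff.2 (tupleRow_inj.1 h))
    refine ih _ w' ⟨hR.loaded.frame hF, hR.masked.frame hF, hw', fun x' hx' => ?_,
      fun hw x' hx' => ?_⟩
    · by_cases hxx : x' = x
      · subst hxx
        rw [Function.update_self]
        exact hrow
      · rw [Function.update_of_ne hxx]
        exact (hR.tuple x' (by simp [hxx, hx'])).frame hF (hne x' hxx)
    · by_cases hxx : x' = x
      · subst hxx
        rw [Function.update_self]
        exact hshift hw
      · rw [Function.update_of_ne hxx]
        have h := hR.tuple_shift (hww hw) x' (by simp [hxx, hx'])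
        have h1 : R'.s (aMask k (tupleRow x'.1 x'.2)) = R.s (aMask k (tupleRow x'.1 x'.2)) :=
          hF.s _ _ _ (by simp [hne x' hxx])
        have h2 : R'.s (bMask k (tupleRow x'.1 x'.2)) = R.s (bMask k (tupleRow x'.1 x'.2)) :=
          hF.s _ _ _ (by simp [hne x' hxx])
        rw [h1, h2]
        exact h

/-- For a fixed instance and pattern the masks alone make the published exponents uniform, so the
trial reproduces the symbolic game exactly. The output depends on the instance only through `ζ`,
apart from `Ff`. -/
theorem run_trial (hnk : n ≤ k) (hn : 0 < n) (N L m : ℕ) (ζ : GT)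
    (hζ : Z = B.expT (θ ^ (k + 1) * h) * ζ) (e : Fin n → Bool) (fail : Program users n tuples)
    (Ff : PMF Bool) (hfail : ∀ R' s', Loaded B k θ h Z R' → fail.run B A R' s' = Ff)
    (hR : Loaded B k θ h Z R) :
    (trial k N L m e fail).run B A R s =
      orElse (symGame B N L m A ζ (fun U S seats => decide (e = requiredPattern U S seats))
        (decide (e = fun _ => true))) Ff := by
  unfold symGame
  -- A uniform μ is r + θ with r uniform; the h_j are treated in the same way below.
  rw [orElse_bind, PMF.uniformOfFintype_bind_equiv (Equiv.addRight θ)]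
  refine run_genMasked hR 0 0 1 (by omega) (by omega) (by omega) _ _ fun r R₁ hR₁ hu hr _ => ?_
  rw [orElse_bind, PMF.uniformOfFintype_bind_equiv
      (Equiv.addRight fun j : Fin n => θ ^ (j : ℕ)),
    ← PMF.sampleList_eq_uniformOfFintype (List.finRange n) (List.nodup_finRange n)
      List.mem_finRange 0]
  refine run_genBases hnk _ _ (fun y R₂ hR₂ hM => ?_) _ _ hR₁ (by rw [hu, pow_one]) hr
    fun j hj => absurd (List.mem_finRange j) hj
  rw [orElse_bind, ← PMF.sampleList_eq_uniformOfFintype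
    ((List.finRange tuples).product (List.finRange n))
    ((List.nodup_finRange tuples).product (List.nodup_finRange n))
    (fun x => List.pair_mem_product.2 ⟨List.mem_finRange _, List.mem_finRange _⟩) 1]
  refine run_genTuples hnk _ _ (fun t w R₃ hP => ?_) _ _ false
    ⟨hR₂, hM, by simp, fun x hx => absurd ?_ hx, fun _ x hx => absurd ?_ hx⟩
  · have hpub : (paramAddresses k n tuples).map R₃.x =
        ((maskedExponents θ r y fun γ i => t (γ, i)).sys B).pub := by
      unfold PubParams.map SysParams.pub Exponents.sys paramAddresses
      congr 1
      · exact hP.masked.u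
      · funext j
        exact hP.masked.h j
      · funext γ i
        exact HasRow.map_pubAddresses (ab := t (γ, i)) (fun j hj => hj) (hP.tuple (γ, i) (by simp))
    simp only [Program.run, PMF.monad_bind_eq_bind, orElse_bind, hpub]
    refine congrArg _ (funext fun x => ?_)
    refine run_simulate hnk hn N L ζ hζ fail Ff hfail m (SymState.init users n tuples) ?_
      ⟨hP.loaded, hP.masked, hP.solution, fun γ i => hP.tuple (γ, i) (by simp),
        fun hw γ i => hP.tuple_shift hw (γ, i) (by simp), ?_, ?_⟩
    · intro gr hgr
      simp [SymState.init] at hgr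
    · intro v i hv
      simp [SymState.init] at hv
    · intro _ v i hv
      simp [SymState.init] at hv
  · exact List.pair_mem_product.2 ⟨List.mem_finRange _, List.mem_finRange _⟩
  · exact List.pair_mem_product.2 ⟨List.mem_finRange _, List.mem_finRange _⟩

end Trial

/-! ### The reduction -/

section Reduction

variable {q : ℕ} [Fact q.Prime] {G GT : Type} [CommGroup G] [CommGroup GT] {users n tuples : ℕ}

/-- Choose the values of a pattern at the listed positions at random. -/
def choosePattern (p : (Fin n → Bool) → Program users n tuples) :
    List (Fin n) → (Fin n → Bool) → Program users n tuples
  | [], e => p e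
  | i :: l, e => .coin fun b => choosePattern p l (Function.update e i b)

/-- Up to `T` trials with random patterns. -/
noncomputable def trials (k N L m : ℕ) : ℕ → Program users n tuples
  | 0 => .output true
  | T + 1 => choosePattern (fun e => trial k N L m e (trials k N L m T)) (List.finRange n)
      fun _ => true

theorem choosePattern_halts {u : ℕ} {p : (Fin n → Bool) → Program users n tuples}
    (hp : ∀ e, (p e).HaltsWithin u) (l : List (Fin n)) (e : Fin n → Bool) :
    (choosePattern p l e).HaltsWithin (u + l.length) := by
  induction l generalizing e with
  | nil => exact hp e
  | cons i l ih => exact fun b => ih _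

/-- The number of steps for a trial, per query and tuple. -/
def trialCost (n : ℕ) : ℕ := actCost n + n * rowCost n + 9 * n + 11

/-- The coefficient per query, the one per tuple and the constant are all bounded by `trialCost n`.
The extra n pays for choosing the pattern. -/
theorem cost_le (n m tuples : ℕ) :
    m * (actCost n + 1) + tuples * (n * rowCost n) + (8 * n + 10) + n ≤
      trialCost n * (m + tuples + 1) := by
  unfold trialCost
  generalize actCost n = a
  generalize n * rowCost n = b
  calc _ = m * (a + 1) + tuples * b + 1 * (9 * n + 10) := by ring
    _ ≤ m * (a + b + 9 * n + 11) + tuples * (a + b + 9 * n + 11) + 1 * (a + b + 9 * n + 11) := by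
      gcongr ?_ * ?_ + ?_ * ?_ + ?_ * ?_ <;> omega
    _ = _ := by ring

theorem trial_halts_mul {k u : ℕ} (N L m : ℕ) (e : Fin n → Bool) {fail : Program users n tuples}
    (hfail : fail.HaltsWithin u) :
    (trial k N L m e fail).HaltsWithin (u + trialCost n * (m + tuples + 1)) :=
  (trial_halts N L m e hfail).mono (by have := cost_le n m tuples; omega)

theorem trials_halts (k N L m T : ℕ) :
    (trials k N L m T : Program users n tuples).HaltsWithin
      (T * (trialCost n * (m + tuples + 1))) := by
  induction T with
  | zero => exact trivial
  | succ T ih =>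
    refine (choosePattern_halts (fun e => trial_halts N L m e ih) (List.finRange n) _).mono ?_
    rw [List.length_finRange, Nat.succ_mul T]
    have := cost_le n m tuples
    omega

variable {B : BilinearGroups q G GT} {A : Adversary users n tuples G GT} {k : ℕ}

theorem run_choosePattern (p : (Fin n → Bool) → Program users n tuples) (l : List (Fin n))
    (e : Fin n → Bool) (R : Registers q G GT) (s : Option A.σ) :
    (choosePattern p l e).run B A R s =
      (PMF.sampleList l e).bind fun e => (p e).run B A R s := by
  induction l generalizing e with
  | nil => rw [PMF.sampleList, PMF.pure_bind]; rfl
  | cons i l ih =>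
    rw [PMF.sampleList, PMF.bind_bind]
    exact congrArg _ (funext fun b => ih _)

theorem orElse_congr {P : PMF (Option Bool)} (hP : P none = 0) (F F' : PMF Bool) :
    orElse P F = orElse P F' := by
  ext b
  simp only [orElse, PMF.bind_apply]
  refine tsum_congr fun o => ?_
  cases o with
  | none => simp [hP]
  | some c => rfl

theorem orElse_map_some (P : PMF Bool) (F : PMF Bool) : orElse (P.map some) F = P := by
  rw [orElse, PMF.bind_map]
  exact PMF.bind_pure P

/-- The real game always yields a bit. It is a mixture over `ζ` in which, for challenge bit `true`,
every `ζ` has positive weight, so no component can have mass at `none`. -/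
theorem symGame_none [Fintype G] [Fintype GT] (N L m : ℕ) (ζ : GT) :
    symGame B N L m A ζ (fun _ _ _ => true) true none = 0 := by
  have h : (game B N L m A true).map some none = 0 := by
    rw [PMF.apply_eq_zero_iff, PMF.support_map]
    simp
  rw [game_map_some, PMF.bind_apply, ENNReal.tsum_eq_zero] at h
  have h1 := h ζ
  rw [mul_eq_zero] at h1
  refine h1.resolve_left ?_
  simp [keyMask, PMF.uniformOfFintype_apply]

/-- A random pattern fits with the same probability whatever the adversary does. -/
theorem uniform_bind_symGame (N L m : ℕ) (ζ : GT) :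
    ((PMF.uniformOfFintype (Fin n → Bool)).bind fun e =>
      symGame B N L m A ζ (fun U S seats => decide (e = requiredPattern U S seats))
        (decide (e = fun _ => true))) =
    (PMF.uniformOfFintype (Fin n → Bool)).bind fun e => if e = fun _ => true then
      symGame B N L m A ζ (fun _ _ _ => true) true else PMF.pure none := by
  have hpull : ∀ (e : Fin n → Bool) {α : Type} (p : PMF α) (f : α → PMF (Option Bool)),
      (if e = (fun _ => true) then p.bind f else PMF.pure none) =
        p.bind fun a => if e = (fun _ => true) then f a else PMF.pure none := by
    intro e α p f
    split <;> simp
  simp only [symGame, hpull]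
  iterate 4
    rw [PMF.bind_comm]
    conv_rhs => rw [PMF.bind_comm]
    refine congrArg _ (funext fun _ => ?_)
  exact uniform_bind_symPhase B N L A _ ζ _ m _ rfl _ _

/-- The adversary's guess in the game whose challenge key is multiplied by `ζ`. -/
noncomputable def symGuess (B : BilinearGroups q G GT) (N L m : ℕ)
    (A : Adversary users n tuples G GT) (ζ : GT) : PMF Bool :=
  orElse (symGame B N L m A ζ (fun _ _ _ => true) true) (PMF.pure true)

theorem keyMask_bind_symGuess [Fintype G] [Fintype GT] (N L m : ℕ) (b : Bool) :
    (keyMask GT b).bind (symGuess B N L m A) = game B N L m A b := by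
  unfold symGuess
  rw [← orElse_bind, ← game_map_some, orElse_map_some]

/-- The output of `T` trials. -/
noncomputable def trialsOutput (B : BilinearGroups q G GT) (N L m : ℕ)
    (A : Adversary users n tuples G GT) (ζ : GT) : ℕ → PMF Bool
  | 0 => PMF.pure true
  | T + 1 => (PMF.uniformOfFintype (Fin n → Bool)).bind fun e => if e = fun _ => true then
      symGuess B N L m A ζ else trialsOutput B N L m A ζ T

/-- Each trial succeeds with probability exactly 2^(-n) and then returns a faithful guess. The next
trial needs only the intact input registers and starts the adversary afresh, so the induction runs
over arbitrary loaded registers. -/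
theorem run_trials [Fintype G] [Fintype GT] (hnk : n ≤ k) (hn : 0 < n) (N L m T : ℕ)
    {θ h : ZMod q} (ζ : GT) {R : Registers q G GT}
    (hR : Loaded B k θ h (B.expT (θ ^ (k + 1) * h) * ζ) R) (s : Option A.σ) :
    (trials k N L m T).run B A R s = trialsOutput B N L m A ζ T := by
  induction T generalizing R s with
  | zero => rfl
  | succ T ih =>
    rw [trials, run_choosePattern, PMF.sampleList_eq_uniformOfFintype (List.finRange n)
      (List.nodup_finRange n) List.mem_finRange]
    simp only [run_trial hnk hn N L m ζ rfl _ (trials k N L m T) (trialsOutput B N L m A ζ T)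
      (fun R' s' hR' => ih hR' s') hR]
    rw [← orElse_bind, uniform_bind_symGame, orElse_bind, trialsOutput]
    refine congrArg _ (funext fun e => ?_)
    split
    · exact orElse_congr (symGame_none N L m ζ) _ _
    · exact orElse_none _

/-- If groups have only one session, a single trial suffices. -/
theorem run_trial_of_le_one (hnk : n ≤ k) (hn : 0 < n) (N m : ℕ) {L : ℕ} (hL : L ≤ 1)
    {θ h : ZMod q} (ζ : GT) {R : Registers q G GT}
    (hR : Loaded B k θ h (B.expT (θ ^ (k + 1) * h) * ζ) R) (s : Option A.σ) :
    (trial k N L m (fun _ => true) (.output true)).run B A R s = symGuess B N L m A ζ := by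
  rw [run_trial hnk hn N L m ζ rfl _ (.output true) (PMF.pure true) (fun _ _ _ => rfl) hR, symGuess]
  refine congrArg (orElse · _) ?_
  unfold symGame
  refine congrArg _ (funext fun μ => congrArg _ (funext fun η => congrArg _ (funext fun t =>
    congrArg _ (funext fun x => ?_))))
  simp only [decide_true]
  refine symPhase_of_le_one B N hL A _ ζ x.1 m _ ?_ _ _
  intro gr hgr
  simp [SymState.init] at hgr

theorem loaded_registers (hk : 1 ≤ k) (h : ZMod q) (θ : (ZMod q)ˣ) (Z : GT) :
    Loaded B k (θ : ZMod q) h Z (bdheInstance B k h θ Z).registers := by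
  refine ⟨fun i hi hi' => ?_, ?_, ?_, rfl⟩
  · simp only [BDHEInstance.registers, bdheInstance]
    by_cases h0 : i = 0
    · subst h0
      simp [B.exp_one]
    · rw [if_neg h0, if_neg (by omega), dif_pos (by omega)]
      rfl
  · simp only [BDHEInstance.registers]
    rw [if_neg (by omega), if_neg (by omega), dif_neg (by omega)]
  · simp only [BDHEInstance.registers]
    rw [if_neg (by omega), if_pos trivial]
    rfl

variable [Fintype GT]

/-- A program whose output depends only on the quotient `ζ` of `Z` and the solution. -/
theorem bdhe_solver (hk : 1 ≤ k) (D : Program users n tuples) (F : GT → PMF Bool)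
    (hD : ∀ (θ h : ZMod q) (ζ : GT) (R : Registers q G GT) (s : Option A.σ),
      Loaded B k θ h (B.expT (θ ^ (k + 1) * h) * ζ) R → D.run B A R s = F ζ) :
    bdheReal B k (D.solver B A) = (keyMask GT false).bind F ∧
      bdheRandom B k (D.solver B A) = (keyMask GT true).bind F := by
  constructor
  · have : ∀ (h : ZMod q) (θ : (ZMod q)ˣ), D.solver B A (bdheInstance B k h θ
        (B.e (gexp B.g ((θ : ZMod q) ^ (k + 1))) (gexp B.g h))) = F 1 := by
      intro h θ
      refine hD θ h 1 _ _ ?_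
      rw [mul_one, ← B.e_exp]
      exact loaded_registers hk h θ _
    simp only [bdheReal, PMF.monad_bind_eq_bind, this, PMF.bind_const, keyMask, Bool.false_eq_true,
      if_false, PMF.pure_bind]
  · have : ∀ (h : ZMod q) (θ : (ZMod q)ˣ), ((PMF.uniformOfFintype GT).bind fun Z =>
        D.solver B A (bdheInstance B k h θ Z)) = (PMF.uniformOfFintype GT).bind F := by
      intro h θ
      -- For each fixed h and θ, a uniform Z is the solution times a uniform `ζ`.
      rw [PMF.uniformOfFintype_bind_equiv
        (Equiv.mulLeft (B.expT ((θ : ZMod q) ^ (k + 1) * h)))]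
      exact congrArg _ (funext fun ζ => hD θ h ζ _ _ (loaded_registers hk h θ _))
    simp only [bdheRandom, PMF.monad_bind_eq_bind, this, PMF.bind_const, keyMask, if_true]

variable [Fintype G]

theorem toReal_uniform_bind_ite {α : Type} [Fintype α] [Nonempty α] [DecidableEq α] (a : α)
    (P P' : PMF Bool) (b : Bool) :
    (((PMF.uniformOfFintype α).bind fun c => if c = a then P else P') b).toReal =
      (Fintype.card α : ℝ)⁻¹ * (P b).toReal + (1 - (Fintype.card α : ℝ)⁻¹) * (P' b).toReal := by
  have hc : (Fintype.card α : ℝ) ≠ 0 := by exact_mod_cast Fintype.card_ne_zero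
  rw [PMF.bind_apply, tsum_fintype, ENNReal.toReal_sum fun c _ => by
    exact ENNReal.mul_ne_top (PMF.apply_ne_top _ _) (PMF.apply_ne_top _ _)]
  have h : ∀ c : α, (PMF.uniformOfFintype α c * (if c = a then P else P') b).toReal =
      (Fintype.card α : ℝ)⁻¹ * (P' b).toReal +
        if c = a then (Fintype.card α : ℝ)⁻¹ * ((P b).toReal - (P' b).toReal) else 0 := by
    intro c
    rw [PMF.uniformOfFintype_apply, ENNReal.toReal_mul, ENNReal.toReal_inv, ENNReal.toReal_natCast]
    split <;> ring
  simp only [h, Finset.sum_add_distrib, Finset.sum_const, Finset.card_univ, nsmul_eq_mul,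
    Finset.sum_ite_eq', Finset.mem_univ, if_true]
  field_simp
  ring

/-- If all trials fail the output is `true`, which contributes nothing to the probability of
`false`. That probability is therefore the game's, scaled by the chance of some success, a factor
that is the same for both challenge bits. -/
theorem toReal_trialsOutput (N L m T : ℕ) (b : Bool) :
    (((keyMask GT b).bind fun ζ => trialsOutput B N L m A ζ T) false).toReal =
      (1 - (1 - ((2 : ℝ) ^ n)⁻¹) ^ T) * (game B N L m A b false).toReal := by
  induction T with
  | zero => simp [trialsOutput]
  | succ T ih =>
    have h : ((keyMask GT b).bind fun ζ => trialsOutput B N L m A ζ (T + 1)) =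
        (PMF.uniformOfFintype (Fin n → Bool)).bind fun e => if e = fun _ => true then
          game B N L m A b else (keyMask GT b).bind fun ζ => trialsOutput B N L m A ζ T := by
      simp only [trialsOutput]
      rw [PMF.bind_comm]
      refine congrArg _ (funext fun e => ?_)
      split
      · exact keyMask_bind_symGuess N L m b
      · rfl
    rw [h, toReal_uniform_bind_ite, ih]
    simp only [Fintype.card_fun, Fintype.card_bool, Fintype.card_fin, Nat.cast_pow, Nat.cast_ofNat]
    ring

/-- Since Pr[b' = b] averages the two games, 2 Pr[b' = b] - 1 is the difference of their
probabilities of guessing `false`, the quantity compared in the decision problem. -/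
theorem advantage_eq (N L m : ℕ) :
    A.advantage B N L m =
      |(game B N L m A false false).toReal - (game B N L m A true false).toReal| := by
  have hsum : (game B N L m A true true).toReal + (game B N L m A true false).toReal = 1 := by
    have := PMF.tsum_coe (game B N L m A true)
    rw [tsum_fintype, Fintype.sum_bool] at this
    rw [← ENNReal.toReal_add (PMF.apply_ne_top _ _) (PMF.apply_ne_top _ _), this, ENNReal.toReal_one]
  have hwin : (gameWin B N L m A true).toReal =
      ((game B N L m A false false).toReal + (game B N L m A true true).toReal) / 2 := by
    have h : ∀ b : Bool, ((game B N L m A b).bind fun b' => PMF.pure (b' == b)) true =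
        game B N L m A b b := by
      intro b
      rw [PMF.bind_apply, tsum_fintype, Fintype.sum_bool]
      cases b <;> simp
    simp only [gameWin, PMF.monad_bind_eq_bind, PMF.monad_pure_eq_pure]
    rw [PMF.bind_apply, tsum_fintype, Fintype.sum_bool, h, h]
    simp only [PMF.uniformOfFintype_apply, Fintype.card_bool]
    rw [← mul_add, ENNReal.toReal_mul, ENNReal.toReal_add (PMF.apply_ne_top _ _)
      (PMF.apply_ne_top _ _)]
    simp
    ring
  rw [Adversary.advantage, hwin]
  congr 1
  linarith

/-- Without positions there is never a challenge, so the game does not depend on the bit. -/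
theorem advantage_of_isEmpty [IsEmpty (Fin n)] (N L m : ℕ) : A.advantage B N L m = 0 := by
  have hgame : ∀ ζ ζ' : GT, symGuess B N L m A ζ = symGuess B N L m A ζ' := by
    intro ζ ζ'
    unfold symGuess symGame
    refine congrArg (orElse · _) ?_
    refine congrArg _ (funext fun μ => congrArg _ (funext fun η => congrArg _ (funext fun t =>
      congrArg _ (funext fun x => ?_))))
    exact symPhase_of_isEmpty B N L A _ ζ ζ' x.1 _ true m _ rfl _ _
  have h : ∀ b, game B N L m A b = symGuess B N L m A 1 := by
    intro b
    rw [← keyMask_bind_symGuess, show symGuess B N L m A = fun _ => symGuess B N L m A 1 from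
      funext fun ζ => hgame ζ 1, PMF.bind_const]
  rw [advantage_eq, h, h, sub_self, abs_zero]

/-- With `2 ^ n` trials the success probability is at least one half. -/
theorem half_le_success (n : ℕ) : (1 / 2 : ℝ) ≤ 1 - (1 - ((2 : ℝ) ^ n)⁻¹) ^ 2 ^ n := by
  set p : ℝ := ((2 : ℝ) ^ n)⁻¹ with hp
  have hp0 : 0 ≤ p := by positivity
  have hp1 : p ≤ 1 := inv_le_one_of_one_le₀ (one_le_pow₀ (by norm_num))
  -- Bernoulli's inequality with 2^n · p = 1.
  have h1 : (2 : ℝ) ≤ (1 + p) ^ 2 ^ n := by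
    have := one_add_mul_le_pow (a := p) (by linarith) (2 ^ n)
    have h2 : ((2 ^ n : ℕ) : ℝ) * p = 1 := by
      rw [hp]
      push_cast
      exact mul_inv_cancel₀ (by positivity)
    linarith
  -- Since (1 - p)(1 + p) ≤ 1, the failure probability is at most the inverse of (1 + p)^(2^n),
  -- hence at most 1/2.
  have h2 : (1 - p) ^ 2 ^ n * (1 + p) ^ 2 ^ n ≤ 1 := by
    rw [← mul_pow]
    refine pow_le_one₀ (by nlinarith) (by nlinarith)
  have h3 : 0 ≤ (1 - p) ^ 2 ^ n := pow_nonneg (by linarith) _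
  nlinarith

end Reduction

theorem theorem1 (n k : ℕ) (hnk : n ≤ k) :
    ∃ C : ℕ, ∀ (users tuples N L m q : ℕ) [Fact q.Prime] (G GT : Type)
      [CommGroup G] [Fintype G] [CommGroup GT] [Fintype GT]
      (B : BilinearGroups q G GT) (A : Adversary users n tuples G GT) (ε : ℝ),
      A.advantage B N L m = ε →
        ∃ D : Program users n tuples,
          D.HaltsWithin (C * (m + tuples + 1)) ∧
            ε / (N * L) ≤ bdheAdvantage B k (D.solver B A) := by
  -- One trial costs at most `trialCost n * (m + tuples + 1)` steps, and there are at most 2^n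
  -- trials.
  refine ⟨2 ^ n * trialCost n, ?_⟩
  intro users tuples N L m q _ G GT _ _ _ _ B A ε hε
  have hε0 : 0 ≤ ε := hε ▸ abs_nonneg _
  have hout : ∀ t, (Program.output true : Program users n tuples).HaltsWithin t := by
    intro t
    cases t <;> trivial
  -- This also covers N = 0 and L = 0, where the quotient is 0 by convention; afterwards N, L ≥ 1.
  by_cases htriv : ε / (N * L) = 0
  · exact ⟨.output true, hout _, htriv ▸ abs_nonneg _⟩
  have hNL : (N : ℝ) * L ≠ 0 := fun h => htriv (by rw [h, div_zero])
  have hN : (1 : ℝ) ≤ N := by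
    exact_mod_cast Nat.one_le_iff_ne_zero.2 fun h => hNL (by simp [h])
  have hL : (1 : ℝ) ≤ L := by
    exact_mod_cast Nat.one_le_iff_ne_zero.2 fun h => hNL (by simp [h])
  -- A position is needed to carry the shift θ^k; together with `n ≤ k` this also gives k ≥ 1.
  have hn : 0 < n := by
    rcases Nat.eq_zero_or_pos n with rfl | h
    · exact absurd (by rw [← hε, advantage_of_isEmpty, zero_div]) htriv
    · exact h
  rw [advantage_eq] at hε
  -- With L = 1 and N = 1 no loss is allowed, so guessing is not affordable; but then users of U are
  -- never seated and the all-true pattern always fits.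
  by_cases hL1 : L ≤ 1
  · refine ⟨trial k N L m (fun _ => true) (.output true), ?_, ?_⟩
    · refine (trial_halts_mul N L m _ (hout 0)).mono ?_
      rw [zero_add, mul_assoc]
      exact Nat.le_mul_of_pos_left _ (by positivity)
    · obtain ⟨h1, h2⟩ := bdhe_solver (B := B) (A := A) (k := k) (by omega)
        (trial k N L m (fun _ => true) (.output true)) (symGuess B N L m A)
        fun θ h ζ R s hR => run_trial_of_le_one hnk hn N m hL1 ζ hR s
      rw [bdheAdvantage, h1, h2, keyMask_bind_symGuess, keyMask_bind_symGuess, hε]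
      exact div_le_self hε0 (by nlinarith)
  · refine ⟨trials k N L m (2 ^ n), ?_, ?_⟩
    · rw [mul_assoc]
      exact trials_halts k N L m (2 ^ n)
    · obtain ⟨h1, h2⟩ := bdhe_solver (B := B) (A := A) (k := k) (by omega)
        (trials k N L m (2 ^ n)) (fun ζ => trialsOutput B N L m A ζ (2 ^ n))
        fun θ h ζ R s hR => run_trials hnk hn N L m (2 ^ n) ζ hR s
      have hhalf := half_le_success n
      rw [bdheAdvantage, h1, h2, toReal_trialsOutput, toReal_trialsOutput, ← mul_sub, abs_mul, hε,
        abs_of_nonneg (by linarith)]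
      -- Now NL ≥ 2, so the factor 1/2 lost by the repeated guessing is within the bound.
      have hL2 : (2 : ℝ) ≤ L := by exact_mod_cast (by omega : 2 ≤ L)
      calc ε / (N * L) ≤ ε / 2 := div_le_div_of_nonneg_left hε0 (by norm_num) (by nlinarith)
        _ = 1 / 2 * ε := by ring
        _ ≤ _ := mul_le_mul_of_nonneg_right hhalf hε0
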